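/- Write $\mathbb R^{1,1}$ for the plane with coordinates $(t,x)=(x^0,x^1)$ and $\eta=\mathrm{diag}(-1,1)$. Let $f:\mathbb R\to\mathbb R$ be of class $C^3$, and consider the quasilinear wave equation $$\partial_\mu\big(e^{f(\sigma)}\eta^{\mu\nu}\partial_\nu\phi\big)=0,\qquad \sigma=\eta^{-1}(d\phi,d\phi)=-(\partial_t\phi)^2+(\partial_x\phi)^2,\tag{1}$$ with data $\phi(0,x)=\phi_0(x)$, $\partial_t\phi(0,x)=\phi_1(x)$. Put $$H(\sigma)=-\frac{2f'(\sigma)}{1+2f'(\sigma)\sigma},\qquad G(\sigma)=\frac{f''(\sigma)\sigma+f'(\sigma)}{1+2f'(\sigma)\sigma}+f'(\sigma).$$ Let $M_0,m_0>0$ be constants such that for all $|\sigma|\le m_0$ one has $1+2f'(\sigma)\sigma\ne0$ and $$|G|,|H|,|f'|,|G'|,|H'|,|1+2f'(\sigma)\sigma|,|1+2f'(\sigma)\sigma|^{-1},|f''|,|H''|\le M_0$$ (for every $f\in C^3$ such constants exist). Write $O_{\epsilon,\gamma}(x)=\epsilon(1+|x|)^{-1-\gamma}$. For a $C^2$ solution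 $\phi$ of (1) let $g^{\mu\nu}=\eta^{\mu\nu}+2f'(\sigma)\,\eta^{\mu\alpha}\partial_\alpha\phi\,\eta^{\nu\beta}\partial_\beta\phi$ be the inverse acoustic metric. A *dynamical double null coordinate system* of $\phi$ is a $C^1$ diffeomorphism $U=(u,\underline u)$ from the $(t,x)$-plane onto $\mathbb R^2$ with $$g^{-1}(du,du)=g^{-1}(d\underline u,d\underline u)=0,\quad u(0,x)=x,\quad \underline u(0,x)=-x,\quad \partial_t\underline u(0,x)>0 .$$ Put $\Psi=\partial_t\phi+\partial_x\phi$ and $\underline\Psi=\partial_t\phi-\partial_x\phi$. **Theorem.** Given $M_0$, $m_0$, $M_\zeta$, $\bar\gamma$, $\kappa>0$ there are $\bar\epsilon>0$ and $C>0$, depending only on these five numbers, such that the following holds for every $f\in C^3$ satisfying the above bounds and every $\zeta\in C^2(\mathbb R)$ with $$|\zeta(x)|,|\zeta'(x)|,|\zeta''(x)|\le O_{M_\zeta,\bar\gamma}(x)\ (x\in\mathbb R),\qquad \inf_{x}H(0)\,\zeta'(x)^2\ge-1+\kappa .$$ Call $(\phi_0,\phi_1)\in C^2\times C^1$ admissible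 if for all $x$ $$|\phi_0(x)-\zeta(-x)|,\ |\phi_0'(x)+\zeta'(-x)|,\ |\phi_0''(x)-\zeta''(-x)|,\ |\phi_1(x)-\zeta'(-x)|,\ |\phi_1'(x)+\zeta''(-x)|\le O_{\bar\epsilon,\bar\gamma}(x).$$ 1. For all admissible data there is exactly one $C^2$ solution $\phi$ of (1) on all of $\mathbb R^{1,1}$ with these data, and it has exactly one dynamical double null coordinate system. 2. The solution depends Lipschitz-continuously on the data in the respective dynamical double null coordinates. Let $\phi,\tilde\phi$ be the solutions with admissible data $(\phi_0,\phi_1)$, $(\tilde\phi_0,\tilde\phi_1)$, and let $U,\tilde U$ be their dynamical double null coordinate systems. If $D$ satisfies $$|\phi_0-\tilde\phi_0|,\ |\phi_0'-\tilde\phi_0'|,\ |\phi_0''-\tilde\phi_0''|,\ |\phi_1-\tilde\phi_1|,\ |\phi_1'-\tilde\phi_1'|\le O_{D,\bar\gamma}(x)\quad\text{for all }x,$$ then for each of the pairs $(A,\tilde A)=(\phi\circ U^{-1},\tilde\phi\circ\tilde U^{-1})$, $(\Psi\circ U^{-1},\tilde\Psi\circ\tilde U^{-1})$, $(\underline\Psi\circ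 U^{-1},\underline{\tilde\Psi}\circ\tilde U^{-1})$ one has, at all $(u,\underline u)\in\mathbb R^2$, $$|A-\tilde A|\le CD,\qquad |\partial_uA-\partial_u\tilde A|\le O_{CD,\bar\gamma}(u),\qquad |\partial_{\underline u}A-\partial_{\underline u}\tilde A|\le O_{CD,\bar\gamma}(\underline u).$$ -/

import Mathlib

noncomputable section

namespace SimpleWave

/-- First partial derivative of a function on the plane in the slot `μ`. On the physical plane the
coordinates are `(t, x)`; on the double null plane they are `(u, ubar)`. -/
def pd (μ : Fin 2) (F : ℝ × ℝ → ℝ) (p : ℝ × ℝ) : ℝ :=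
  fderiv ℝ F p (if μ = 0 then (1, 0) else (0, 1))

/-- The Minkowski (inverse) metric on the plane, `diag (-1, 1)`. -/
def η : Matrix (Fin 2) (Fin 2) ℝ := !![-1, 0; 0, 1]

/-- `σ = η⁻¹(dφ, dφ)`. -/
def sigma (φ : ℝ × ℝ → ℝ) (p : ℝ × ℝ) : ℝ :=
  ∑ μ, ∑ ν, η μ ν * pd μ φ p * pd ν φ p

/-- The wave equation `∂_μ (e^{f(σ)} η^{μν} ∂_ν φ) = 0` on the whole plane. -/
def WaveEquation (f : ℝ → ℝ) (φ : ℝ × ℝ → ℝ) : Prop :=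
  ∀ p, ∑ μ, pd μ (fun q => ∑ ν, Real.exp (f (sigma φ q)) * η μ ν * pd ν φ q) p = 0

/-- `φ` is a global `C²` solution of the wave equation with data
`φ(0, x) = φ₀ x`, `∂_t φ(0, x) = φ₁ x`. -/
structure IsGlobalSolution (f φ₀ φ₁ : ℝ → ℝ) (φ : ℝ × ℝ → ℝ) : Prop where
  contDiff : ContDiff ℝ 2 φ
  equation : WaveEquation f φ
  initial : ∀ x, φ (0, x) = φ₀ x
  initial_deriv : ∀ x, pd 0 φ (0, x) = φ₁ x

/-- `H(σ) = - 2 f'(σ) / (1 + 2 f'(σ) σ)`. -/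
def H (f : ℝ → ℝ) (s : ℝ) : ℝ :=
  -(2 * deriv f s / (1 + 2 * deriv f s * s))

/-- `G(σ) = (f''(σ) σ + f'(σ)) / (1 + 2 f'(σ) σ) + f'(σ)`. -/
def G (f : ℝ → ℝ) (s : ℝ) : ℝ :=
  (deriv (deriv f) s * s + deriv f s) / (1 + 2 * deriv f s * s) + deriv f s

/-- The bounds on the nonlinearity by `M₀` on the interval `|σ| ≤ m₀`. -/
def NonlinearityBounds (f : ℝ → ℝ) (M₀ m₀ : ℝ) : Prop :=
  ∀ s, |s| ≤ m₀ →
    1 + 2 * deriv f s * s ≠ 0 ∧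
    |G f s| ≤ M₀ ∧ |H f s| ≤ M₀ ∧ |deriv f s| ≤ M₀ ∧
    |deriv (G f) s| ≤ M₀ ∧ |deriv (H f) s| ≤ M₀ ∧
    |1 + 2 * deriv f s * s| ≤ M₀ ∧ |1 + 2 * deriv f s * s|⁻¹ ≤ M₀ ∧
    |deriv (deriv f) s| ≤ M₀ ∧ |deriv (deriv (H f)) s| ≤ M₀

/-- The weight `ε / (1 + |x|)^(1 + γ)` that defines moderate decrease. -/
def modDec (ε γ x : ℝ) : ℝ := ε / (1 + |x|) ^ (1 + γ)

/-- The profile and its first two derivatives are of moderate decrease. -/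
def ProfileDecay (M γ : ℝ) (ζ : ℝ → ℝ) : Prop :=
  ∀ x, |ζ x| ≤ modDec M γ x ∧ |deriv ζ x| ≤ modDec M γ x ∧ |deriv (deriv ζ) x| ≤ modDec M γ x

/-- The data `(φ₀, φ₁)` and `(χ₀, χ₁)` are `ε`-close in the weighted `C² × C¹` sense. -/
def DataClose (ε γ : ℝ) (φ₀ φ₁ χ₀ χ₁ : ℝ → ℝ) : Prop :=
  ∀ x, |φ₀ x - χ₀ x| ≤ modDec ε γ x ∧
    |deriv φ₀ x - deriv χ₀ x| ≤ modDec ε γ x ∧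
    |deriv (deriv φ₀) x - deriv (deriv χ₀) x| ≤ modDec ε γ x ∧
    |φ₁ x - χ₁ x| ≤ modDec ε γ x ∧
    |deriv φ₁ x - deriv χ₁ x| ≤ modDec ε γ x

/-- `(φ₀, φ₁)` are `C² × C¹` data that are `ε`-close to the data
`(ζ (-x), ζ' (-x))` of the simple wave `ζ (t - x)`. -/
structure AdmissibleData (ε γ : ℝ) (ζ φ₀ φ₁ : ℝ → ℝ) : Prop where
  contDiff_fst : ContDiff ℝ 2 φ₀
  contDiff_snd : ContDiff ℝ 1 φ₁
  close : DataClose ε γ φ₀ φ₁ (fun x => ζ (-x)) (fun x => deriv ζ (-x))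

/-- The inverse acoustic metric
`g^{μν} = η^{μν} + 2 f'(σ) η^{μα} ∂_α φ η^{νβ} ∂_β φ`. -/
def invMetric (f : ℝ → ℝ) (φ : ℝ × ℝ → ℝ) (p : ℝ × ℝ) (μ ν : Fin 2) : ℝ :=
  η μ ν + 2 * deriv f (sigma φ p) *
    (∑ α, η μ α * pd α φ p) * (∑ β, η ν β * pd β φ p)

/-- The eikonal equation `g⁻¹(dw, dw) = 0` for the acoustic metric of `φ`. -/
def Eikonal (f : ℝ → ℝ) (φ w : ℝ × ℝ → ℝ) : Prop :=
  ∀ p, ∑ μ, ∑ ν, invMetric f φ p μ ν * pd μ w p * pd ν w p = 0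

/-- `U = (u, ubar)` is the dynamical double null coordinate system of `φ`: a `C¹` diffeomorphism
of the `(t, x)` plane onto the `(u, ubar)` plane (so `du` and `dubar` are independent everywhere)
whose components are null functions for the acoustic metric, normalized by
`u (0, x) = x`, `ubar (0, x) = -x`, `∂_t ubar (0, x) > 0`. -/
structure IsDoubleNull (f : ℝ → ℝ) (φ : ℝ × ℝ → ℝ) (U : ℝ × ℝ ≃ ℝ × ℝ) : Prop where
  contDiff : ContDiff ℝ 1 U
  contDiff_symm : ContDiff ℝ 1 U.symm
  eikonal_u : Eikonal f φ (fun p => (U p).1)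
  eikonal_ubar : Eikonal f φ (fun p => (U p).2)
  initial : ∀ x, U (0, x) = (x, -x)
  orientation : ∀ x, 0 < pd 0 (fun p => (U p).2) (0, x)

/-- `Ψ = ∂_t φ + ∂_x φ`. -/
def Psi (φ : ℝ × ℝ → ℝ) (p : ℝ × ℝ) : ℝ := pd 0 φ p + pd 1 φ p

/-- `Ψbar = ∂_t φ - ∂_x φ`. -/
def Psibar (φ : ℝ × ℝ → ℝ) (p : ℝ × ℝ) : ℝ := pd 0 φ p - pd 1 φ p

/-- Two functions of the double null coordinates `(u, ubar)` differ by at most `K` in the norm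
in which `∂_u` carries the weight in `u` and `∂_ubar` carries the weight in `ubar`. -/
def NullClose (K γ : ℝ) (A B : ℝ × ℝ → ℝ) : Prop :=
  ∀ q, |A q - B q| ≤ K ∧
    |pd 0 A q - pd 0 B q| ≤ modDec K γ q.1 ∧
    |pd 1 A q - pd 1 B q| ≤ modDec K γ q.2

/-- `φ` and `χ`, each together with its rectangular derivatives `Ψ`, `Ψbar` and each regarded as a
function of its own double null coordinates, differ by at most `K`. -/
def SolutionClose (K γ : ℝ) (φ : ℝ × ℝ → ℝ) (U : ℝ × ℝ ≃ ℝ × ℝ)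
    (χ : ℝ × ℝ → ℝ) (V : ℝ × ℝ ≃ ℝ × ℝ) : Prop :=
  NullClose K γ (φ ∘ U.symm) (χ ∘ V.symm) ∧
  NullClose K γ (Psi φ ∘ U.symm) (Psi χ ∘ V.symm) ∧
  NullClose K γ (Psibar φ ∘ U.symm) (Psibar χ ∘ V.symm)

end SimpleWave

end

/-! In one space dimension the equation is a first-order system for `(Ψ, Ψbar)` whose coefficients
depend on these two unknowns only, so it has Riemann invariants. Let c = √(1 + 2 f'(σ) σ) be the
sound speed and E = exp ∫₀^σ f'/(1 + c). Then R = Ψ E and S = Ψbar E are each constant along one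
family of characteristics: in null coordinates R = R(u) and S = S(ubar), and both are read off from
the data. With τ = R S and e = 1/E as a function of τ, one has Ψ = R e(τ) and Ψbar = S e(τ) on the
whole null plane.

What remains is to place the null plane over the physical one. Put L = ∂_t + ∂_x and Lbar = ∂_t -
∂_x. The null directions are L - R² q(τ) Lbar and Lbar - S² q(τ) L, so v = t + x and w = t - x
satisfy ∂_ubar v = -S² q ∂_ubar w and ∂_u w = -R² q ∂_u v, a linear (hodograph) system with known
coefficients. Cross-differentiation gives a system for V = ∂_u v and W = ∂_ubar w. Its coefficients
are small because R and R' are small near the simple wave, and they carry a weight that is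
integrable in the variable of integration. A single contraction on the bounded continuous functions
on the plane solves it globally (`Coeffs.exists_solution`), and V, W stay close to their initial
values. The hypothesis on H(0) ζ'² says exactly that V is initially bounded below; S itself may be
large. As ∂_u w is small, (u, ubar) ↦ (v, w) is a global diffeomorphism
(`bijective_of_diagonally_dominant`). The solution is obtained by integrating its differential in
null coordinates (`RiemannData.nonempty_nullSolution`).

Uniqueness: the first derivatives of any other solution, written in the null coordinates of the
constructed one, differ from R e and S e by functions that obey a homogeneous hyperbolic inequality
with zero data (`eq_zero_of_hyperbolic_inequality`). For the coordinates, the eikonal equation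
forces each component of a second system to depend on one of u, ubar only; normalization and
orientation leave the identity (`eq_of_isDoubleNull`).

Lipschitz dependence: Ψ and Ψbar are explicit in R and S, and the solution depends on them through
the linear system, whose fixed points vary Lipschitz-continuously with the coefficients
(`Coeffs.norm_solution_sub_le`). Constants must not depend on f, which is why bounds and Lipschitz
constants are propagated together, through `Ctl` and `UCtl`. -/

noncomputable section

open Set Filter Topology MeasureTheory

namespace SimpleWave

/-! ### Pairs of numbers with controlled size and difference -/

/-- `x` and `y` are at most `B * w` in size and differ by at most `B * w * d`. -/
def Ctl (B w d x y : ℝ) : Prop := |x| ≤ B * w ∧ |y| ≤ B * w ∧ |x - y| ≤ B * w * d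

namespace Ctl

variable {B B' w d x y x' y' : ℝ}

theorem const (c : ℝ) (hd : 0 ≤ d) : Ctl |c| 1 d c c := by
  refine ⟨by simp, by simp, ?_⟩
  rw [sub_self, abs_zero]; positivity

theorem add (h : Ctl B w d x y) (h' : Ctl B' w d x' y') : Ctl (B + B') w d (x + x') (y + y') := by
  obtain ⟨h1, h2, h3⟩ := h
  obtain ⟨h1', h2', h3'⟩ := h'
  refine ⟨?_, ?_, ?_⟩
  · linarith [abs_add_le x x']
  · linarith [abs_add_le y y']
  · have := abs_add_le (x - y) (x' - y')
    rw [show x + x' - (y + y') = x - y + (x' - y') by ring]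
    linarith

theorem neg (h : Ctl B w d x y) : Ctl B w d (-x) (-y) := by
  obtain ⟨h1, h2, h3⟩ := h
  refine ⟨by rwa [abs_neg], by rwa [abs_neg], ?_⟩
  rw [show -x - -y = -(x - y) by ring, abs_neg]; exact h3

theorem sub (h : Ctl B w d x y) (h' : Ctl B' w d x' y') : Ctl (B + B') w d (x - x') (y - y') := by
  simpa only [sub_eq_add_neg] using h.add h'.neg

/-- Only one factor carries the weight, so a product keeps exactly one power of it. The factor 2
accounts for the two terms of x (x' - y') + (x - y) y'. -/
theorem mul (h : Ctl B w d x y) (h' : Ctl B' 1 d x' y') :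
    Ctl (2 * B * B') w d (x * x') (y * y') := by
  obtain ⟨h1, h2, h3⟩ := h
  obtain ⟨h1', h2', h3'⟩ := h'
  have p1 := (abs_nonneg _).trans h1
  have p1' := (abs_nonneg _).trans h1'
  have p3 := (abs_nonneg _).trans h3
  have p3' := (abs_nonneg _).trans h3'
  have hxx : |x| * |x'| ≤ B * w * (B' * 1) := mul_le_mul h1 h1' (abs_nonneg _) p1
  have hyy : |y| * |y'| ≤ B * w * (B' * 1) := mul_le_mul h2 h2' (abs_nonneg _) p1
  have q := mul_nonneg p1 p1'
  refine ⟨?_, ?_, ?_⟩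
  · rw [abs_mul]; linarith
  · rw [abs_mul]; linarith
  · have e : x * x' - y * y' = x * (x' - y') + (x - y) * y' := by ring
    have k1 : |x| * |x' - y'| ≤ B * w * (B' * 1 * d) := mul_le_mul h1 h3' (abs_nonneg _) p1
    have k2 : |x - y| * |y'| ≤ B * w * d * (B' * 1) := mul_le_mul h3 h2' (abs_nonneg _) p3
    have := abs_add_le (x * (x' - y')) ((x - y) * y')
    rw [abs_mul, abs_mul] at this
    rw [e]; linarith

theorem mul' (h : Ctl B 1 d x y) (h' : Ctl B' w d x' y') :
    Ctl (2 * B' * B) w d (x * x') (y * y') := by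
  simpa only [mul_comm x, mul_comm y] using h'.mul h

theorem inv {c : ℝ} (hc : 0 < c) (h : Ctl B 1 d x y) (hx : c ≤ x) (hy : c ≤ y) :
    Ctl (c⁻¹ + B * c⁻¹ ^ 2) 1 d x⁻¹ y⁻¹ := by
  obtain ⟨h1, h2, h3⟩ := h
  have x0 := hc.trans_le hx
  have y0 := hc.trans_le hy
  have c0 := inv_pos.2 hc
  have hxi : x⁻¹ ≤ c⁻¹ := inv_anti₀ hc hx
  have hyi : y⁻¹ ≤ c⁻¹ := inv_anti₀ hc hy
  have hB : 0 ≤ B := by linarith [abs_nonneg x]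
  have hBd := (abs_nonneg _).trans h3
  have hb : 0 ≤ B * c⁻¹ ^ 2 := by positivity
  refine ⟨?_, ?_, ?_⟩
  · rw [abs_of_pos (inv_pos.2 x0)]; linarith
  · rw [abs_of_pos (inv_pos.2 y0)]; linarith
  · have e : x⁻¹ - y⁻¹ = -((x - y) * (x⁻¹ * y⁻¹)) := by field_simp; ring
    rw [e, abs_neg, abs_mul, abs_mul, abs_of_pos (inv_pos.2 x0), abs_of_pos (inv_pos.2 y0)]
    have k : x⁻¹ * y⁻¹ ≤ c⁻¹ * c⁻¹ := mul_le_mul hxi hyi (inv_pos.2 y0).le c0.le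
    have := mul_le_mul h3 k (by positivity) hBd
    -- The sign of d is recovered from 0 ≤ B d, since B ≥ |x| ≥ c > 0.
    have hd : 0 ≤ c⁻¹ * d := by
      rcases eq_or_lt_of_le hB with hB0 | hB0
      · exfalso; rw [← hB0] at h1; simp at h1; linarith
      · have : 0 ≤ d := by
          by_contra hd
          push Not at hd
          nlinarith
        positivity
    calc _ ≤ _ := this
      _ = B * c⁻¹ ^ 2 * 1 * d := by ring
      _ ≤ _ := by linarith

theorem sqrt {c : ℝ} (hc : 0 < c) (h : Ctl B 1 d x y) (hx : c ≤ x) (hy : c ≤ y) :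
    Ctl (1 + B + B * (√c)⁻¹) 1 d (√x) (√y) := by
  obtain ⟨h1, h2, h3⟩ := h
  have x0 := hc.trans_le hx
  have y0 := hc.trans_le hy
  have sc := Real.sqrt_pos.2 hc
  have hB : 0 < B := by linarith [abs_pos.2 x0.ne']
  have hd : 0 ≤ d := by
    have := (abs_nonneg _).trans h3
    by_contra hd
    push Not at hd
    nlinarith
  have hb : 0 ≤ B * (√c)⁻¹ := by positivity
  have sle : ∀ z, c ≤ z → |z| ≤ B * 1 → |√z| ≤ (1 + B + B * (√c)⁻¹) * 1 := by
    intro z hz hzB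
    rw [abs_of_nonneg (Real.sqrt_nonneg _)]
    have : √z ≤ 1 + z := by
      rw [Real.sqrt_le_left (by linarith)]; nlinarith
    have := le_abs_self z
    linarith
  refine ⟨sle x hx h1, sle y hy h2, ?_⟩
  have hsx : √c ≤ √x := Real.sqrt_le_sqrt hx
  have hsy : 0 ≤ √y := Real.sqrt_nonneg y
  have hs : 0 < √x + √y := by linarith
  have e : √x - √y = (x - y) * (√x + √y)⁻¹ := by
    rw [eq_mul_inv_iff_mul_eq₀ hs.ne']
    nlinarith [Real.mul_self_sqrt x0.le, Real.mul_self_sqrt y0.le]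
  rw [e, abs_mul, abs_of_pos (inv_pos.2 hs)]
  have k : (√x + √y)⁻¹ ≤ (√c)⁻¹ := inv_anti₀ sc (by linarith)
  have := mul_le_mul h3 k (by positivity) (by positivity)
  have h5 : 0 ≤ (1 + B) * d := by positivity
  linarith

theorem exp (h : Ctl B 1 d x y) (hd : 0 ≤ d) :
    Ctl (Real.exp B * (1 + B)) 1 d (Real.exp x) (Real.exp y) := by
  obtain ⟨h1, h2, h3⟩ := h
  rw [mul_one] at h1 h2
  have hB : 0 ≤ B := (abs_nonneg _).trans h1
  have h0 : ∀ z, |z| ≤ B → Real.exp z ≤ Real.exp B := fun z hz =>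
    Real.exp_le_exp.2 ((le_abs_self z).trans hz)
  have h4 : ∀ z, |z| ≤ B → |Real.exp z| ≤ Real.exp B * (1 + B) * 1 := fun z hz => by
    rw [Real.abs_exp]
    nlinarith [h0 z hz, Real.exp_pos B]
  have key : ∀ a b, |a| ≤ B → |b| ≤ B → Real.exp a - Real.exp b ≤ Real.exp B * |a - b| := by
    intro a b ha hb
    have e1 : Real.exp b = Real.exp a * Real.exp (b - a) := by rw [← Real.exp_add]; ring_nf
    have e2 := Real.add_one_le_exp (b - a)
    have e3 := Real.exp_pos a
    have : Real.exp a - Real.exp b ≤ Real.exp a * (a - b) := by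
      rw [e1]; nlinarith
    refine this.trans ?_
    refine (mul_le_mul_of_nonneg_left (le_abs_self _) e3.le).trans ?_
    exact mul_le_mul_of_nonneg_right (h0 a ha) (abs_nonneg _)
  refine ⟨h4 x h1, h4 y h2, ?_⟩
  have hm : |Real.exp x - Real.exp y| ≤ Real.exp B * |x - y| := by
    rw [abs_le']
    refine ⟨key x y h1 h2, ?_⟩
    have := key y x h2 h1
    rw [abs_sub_comm] at this
    linarith
  have := mul_le_mul_of_nonneg_left h3 (Real.exp_pos B).le
  have : 0 ≤ Real.exp B * d := by positivity
  linarith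

theorem mono (h : Ctl B w d x y) (hB : B ≤ B') (hw : 0 ≤ w) (hd : 0 ≤ d) : Ctl B' w d x y := by
  obtain ⟨h1, h2, h3⟩ := h
  have := mul_le_mul_of_nonneg_right hB hw
  exact ⟨h1.trans this, h2.trans this, h3.trans (mul_le_mul_of_nonneg_right this hd)⟩

theorem unweight (h : Ctl B w d x y) (hB : 0 ≤ B) (hw : w ≤ 1) (hd : 0 ≤ d) : Ctl B 1 d x y := by
  obtain ⟨h1, h2, h3⟩ := h
  have := mul_le_mul_of_nonneg_left hw hB
  exact ⟨h1.trans this, h2.trans this, h3.trans (mul_le_mul_of_nonneg_right this hd)⟩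

end Ctl

/-! ### The weight of moderate decrease -/

theorem modDec_eq_mul (K γ x : ℝ) : modDec K γ x = K * modDec 1 γ x := by
  simp [modDec, div_eq_mul_inv]

theorem modDec_pos {K : ℝ} (hK : 0 < K) (γ x : ℝ) : 0 < modDec K γ x := by
  unfold modDec; positivity

theorem modDec_one_le_one {γ : ℝ} (hγ : 0 < γ) (x : ℝ) : modDec 1 γ x ≤ 1 := by
  unfold modDec
  have : (1 : ℝ) ≤ (1 + |x|) ^ (1 + γ) :=
    Real.one_le_rpow (by linarith [abs_nonneg x]) (by linarith)
  rw [div_le_one (by linarith)]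
  exact this

theorem modDec_neg (K γ x : ℝ) : modDec K γ (-x) = modDec K γ x := by
  simp [modDec]

theorem continuous_modDec (K γ : ℝ) : Continuous (modDec K γ) := by
  unfold modDec
  refine continuous_const.div ?_ fun x => by positivity
  exact (continuous_const.add continuous_abs).rpow_const fun x =>
    Or.inl (by positivity : (0 : ℝ) < 1 + |x|).ne'

theorem tendsto_modDec {γ : ℝ} (hγ : 0 < γ) (K : ℝ) : Tendsto (modDec K γ) atTop (𝓝 0) := by
  unfold modDec
  refine Tendsto.const_div_atTop ?_ K
  refine (tendsto_rpow_atTop (by linarith)).comp ?_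
  exact tendsto_atTop_add_const_left _ _ tendsto_abs_atTop_atTop

theorem exists_abs_integral_modDec_le {γ : ℝ} (hγ : 0 < γ) :
    ∃ I : ℝ, 0 < I ∧ ∀ a b, |∫ s in a..b, modDec 1 γ s| ≤ I := by
  have hint : Integrable (modDec 1 γ) := by
    have := integrable_one_add_norm (E := ℝ) (μ := volume) (r := 1 + γ) (by simpa using hγ)
    refine this.congr (Eventually.of_forall fun x => ?_)
    change (1 + |x|) ^ (-(1 + γ)) = modDec 1 γ x
    rw [modDec, one_div, Real.rpow_neg (by positivity)]
  have h0 : ∀ s, 0 ≤ modDec 1 γ s := fun s => (modDec_pos one_pos γ s).le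
  refine ⟨(∫ s, modDec 1 γ s) + 1, ?_, fun a b => ?_⟩
  · have : 0 ≤ ∫ s, modDec 1 γ s := integral_nonneg fun s => h0 s
    positivity
  · rw [intervalIntegral.abs_integral_eq_abs_integral_uIoc,
      abs_of_nonneg (integral_nonneg fun s => h0 s)]
    have := setIntegral_le_integral (s := uIoc a b) hint (Eventually.of_forall h0)
    linarith

/-! ### The constitutive functions in terms of the product of the Riemann invariants -/

/-- The functions `e` and `q` of `τ = R S`, where `R` and `S` are the Riemann invariants: the
rectangular derivatives of the solution are `Ψ = R e` and `Ψbar = S e`, and the null directions are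
given by `R² q` and `S² q`. -/
structure Profile (δ K : ℝ) where
  e : ℝ → ℝ
  q : ℝ → ℝ
  q' : ℝ → ℝ
  hasDerivAt_e : ∀ t, |t| ≤ δ → HasDerivAt e (q t * e t / (1 - q t * t)) t
  hasDerivAt_q : ∀ t, |t| ≤ δ → HasDerivAt q (q' t) t
  ctl_e : ∀ s t, |s| ≤ δ → |t| ≤ δ → Ctl K 1 |s - t| (e s) (e t)
  ctl_q : ∀ s t, |s| ≤ δ → |t| ≤ δ → Ctl K 1 |s - t| (q s) (q t)
  ctl_q' : ∀ s t, |s| ≤ δ → |t| ≤ δ → Ctl K 1 |s - t| (q' s) (q' t)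
  abs_q_mul_le : ∀ t, |t| ≤ δ → |q t * t| ≤ 1 / 2
  e_zero : e 0 = 1

/-- The relation of the constitutive functions with the nonlinearity `f`. -/
def Profile.Fits {δ K : ℝ} (c : Profile δ K) (f : ℝ → ℝ) : Prop :=
  ∀ t, |t| ≤ δ →
    deriv f (-(t * c.e t ^ 2)) * c.e t ^ 2 * (1 + c.q t * t) ^ 2 = 2 * c.q t

/-- `E` is the factor that takes `(Ψ, Ψbar)` to the Riemann invariants, as a function of `σ`. -/
structure Profile.Inverts {δ K : ℝ} (c : Profile δ K) (E E' : ℝ → ℝ) : Prop where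
  hasDerivAt : ∀ s, |s| ≤ δ → HasDerivAt E (E' s) s
  ctl : ∀ s t, |s| ≤ δ → |t| ≤ δ → Ctl K 1 |s - t| (E s) (E t)
  ctl' : ∀ s t, |s| ≤ δ → |t| ≤ δ → Ctl K 1 |s - t| (E' s) (E' t)
  mul_e : ∀ s, |s| ≤ δ → E s * c.e (-(s * E s ^ 2)) = 1
  zero : E 0 = 1

/-! ### Construction of the constitutive functions -/

theorem Ctl.of_hasDerivAt {m B : ℝ} {g g' : ℝ → ℝ} (h : ∀ s, |s| ≤ m → HasDerivAt g (g' s) s)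
    (hg : ∀ s, |s| ≤ m → |g s| ≤ B) (hg' : ∀ s, |s| ≤ m → |g' s| ≤ B) {s t : ℝ} (hs : |s| ≤ m)
    (ht : |t| ≤ m) : Ctl B 1 |s - t| (g s) (g t) := by
  refine ⟨by simpa using hg s hs, by simpa using hg t ht, ?_⟩
  rw [mul_one]
  exact Convex.norm_image_sub_le_of_norm_hasDerivWithin_le (s := Icc (-m) m)
    (fun x hx => (h x (abs_le.2 hx)).hasDerivWithinAt) (fun x hx => hg' x (abs_le.2 hx))
    (convex_Icc _ _) (abs_le.1 ht) (abs_le.1 hs)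

/-! ### Bounds and Lipschitz constants uniform in the nonlinearity. -/

/-- A function of `σ` built from `f` is bounded and Lipschitz on `|σ| ≤ m`, uniformly in `f`. -/
def UCtl (M m : ℝ) (F : (ℝ → ℝ) → ℝ → ℝ) : Prop :=
  ∃ B, ∀ f, ContDiff ℝ 3 f → NonlinearityBounds f M m → ∀ s t, |s| ≤ m → |t| ≤ m →
    Ctl B 1 |s - t| (F f s) (F f t)

namespace UCtl

variable {M m : ℝ} {F F' : (ℝ → ℝ) → ℝ → ℝ}

theorem const (c : ℝ) : UCtl M m fun _ _ => c :=
  ⟨_, fun _ _ _ _ _ _ _ => Ctl.const c (abs_nonneg _)⟩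

theorem add (h : UCtl M m F) (h' : UCtl M m F') : UCtl M m fun f s => F f s + F' f s := by
  obtain ⟨B, h⟩ := h
  obtain ⟨B', h'⟩ := h'
  exact ⟨_, fun f hf hb s t hs ht => (h f hf hb s t hs ht).add (h' f hf hb s t hs ht)⟩

theorem neg (h : UCtl M m F) : UCtl M m fun f s => -F f s := by
  obtain ⟨B, h⟩ := h
  exact ⟨_, fun f hf hb s t hs ht => (h f hf hb s t hs ht).neg⟩

theorem sub (h : UCtl M m F) (h' : UCtl M m F') : UCtl M m fun f s => F f s - F' f s := by
  simpa only [sub_eq_add_neg] using h.add h'.neg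

theorem mul (h : UCtl M m F) (h' : UCtl M m F') : UCtl M m fun f s => F f s * F' f s := by
  obtain ⟨B, h⟩ := h
  obtain ⟨B', h'⟩ := h'
  exact ⟨_, fun f hf hb s t hs ht => (h f hf hb s t hs ht).mul (h' f hf hb s t hs ht)⟩

theorem inv {c : ℝ} (hc : 0 < c) (h : UCtl M m F)
    (hF : ∀ f, ContDiff ℝ 3 f → NonlinearityBounds f M m → ∀ s, |s| ≤ m → c ≤ F f s) :
    UCtl M m fun f s => (F f s)⁻¹ := by
  obtain ⟨B, h⟩ := h
  exact ⟨_, fun f hf hb s t hs ht =>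
    (h f hf hb s t hs ht).inv hc (hF f hf hb s hs) (hF f hf hb t ht)⟩

theorem id (hm : 0 < m) : UCtl M m fun _ s => s :=
  ⟨m + 1, fun _ _ _ _ _ hs ht => Ctl.of_hasDerivAt (g' := fun _ => 1)
    (fun s _ => hasDerivAt_id' s) (fun s hs => hs.trans (by linarith))
    (fun s _ => by simpa using hm.le) hs ht⟩

end UCtl

section Constitutive

variable {f : ℝ → ℝ} {M m : ℝ}

theorem contDiff_deriv (hf : ContDiff ℝ 3 f) : ContDiff ℝ 2 (deriv f) :=
  ContDiff.deriv' (n := 2) hf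

theorem hasDerivAt_deriv (hf : ContDiff ℝ 3 f) (s : ℝ) :
    HasDerivAt (deriv f) (deriv (deriv f) s) s :=
  ((contDiff_deriv hf).differentiable (by norm_num) s).hasDerivAt

/-- The square of the sound speed, `1 + 2 f'(σ) σ`. -/
def rho (f : ℝ → ℝ) (s : ℝ) : ℝ := 1 + 2 * deriv f s * s

theorem hasDerivAt_rho (hf : ContDiff ℝ 3 f) (s : ℝ) :
    HasDerivAt (rho f) (2 * (deriv (deriv f) s * s + deriv f s)) s := by
  have := (((hasDerivAt_deriv hf s).const_mul 2).mul (hasDerivAt_id' s)).const_add 1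
  refine this.congr_deriv ?_
  ring

theorem contDiff_rho (hf : ContDiff ℝ 3 f) : ContDiff ℝ 2 (rho f) := by
  have := contDiff_deriv hf
  unfold rho
  fun_prop

theorem NonlinearityBounds.one_le (hb : NonlinearityBounds f M m) (hm : 0 < m) : 1 ≤ M := by
  obtain ⟨-, -, -, -, -, -, h, -⟩ := hb 0 (by simpa using hm.le)
  simpa using h

/-- The interval |σ| ≤ m contains 0, where `rho` is 1, and `rho` has no zero on it; the intermediate
value theorem fixes the sign. -/
theorem NonlinearityBounds.rho_pos (hb : NonlinearityBounds f M m) (hf : ContDiff ℝ 3 f)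
    {s : ℝ} (hs : |s| ≤ m) : 0 < rho f s := by
  by_contra! h
  have hc : ContinuousOn (rho f) (uIcc 0 s) := (contDiff_rho hf).continuous.continuousOn
  have h0 : rho f 0 = 1 := by simp [rho]
  have : (0 : ℝ) ∈ uIcc (rho f 0) (rho f s) := by
    rw [h0, uIcc_of_ge (by linarith)]
    exact ⟨h, zero_le_one⟩
  obtain ⟨x, hx, hx0⟩ := intermediate_value_uIcc hc this
  refine (hb x ?_).1 hx0
  have := abs_sub_left_of_mem_uIcc hx
  simp only [sub_zero] at this
  linarith

theorem NonlinearityBounds.inv_le_rho (hb : NonlinearityBounds f M m) (hf : ContDiff ℝ 3 f)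
    {s : ℝ} (hs : |s| ≤ m) : M⁻¹ ≤ rho f s := by
  have h0 := hb.rho_pos hf hs
  obtain ⟨-, -, -, -, -, -, -, h, -⟩ := hb s hs
  change |rho f s|⁻¹ ≤ M at h
  rw [abs_of_pos h0] at h
  exact inv_le_of_inv_le₀ h0 h

theorem uctl_deriv : UCtl M m fun f s => deriv f s := by
  refine ⟨M, fun f hf hb s t hs ht => Ctl.of_hasDerivAt (fun s _ => hasDerivAt_deriv hf s)
    (fun s hs => ?_) (fun s hs => ?_) hs ht⟩
  · exact (hb s hs).2.2.2.1
  · exact (hb s hs).2.2.2.2.2.2.2.2.1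

theorem uctl_rho (hm : 0 < m) : UCtl M m fun f s => rho f s :=
  (UCtl.const 1).add (((UCtl.const 2).mul uctl_deriv).mul (UCtl.id hm))

theorem contDiffAt_H (hf : ContDiff ℝ 3 f) {s : ℝ} (hs : rho f s ≠ 0) :
    ContDiffAt ℝ 2 (H f) s := by
  have h1 : ContDiff ℝ 2 fun s => 2 * deriv f s := contDiff_const.mul (contDiff_deriv hf)
  exact (h1.contDiffAt.div (contDiff_rho hf).contDiffAt hs).neg

theorem deriv_H (hf : ContDiff ℝ 3 f) {s : ℝ} (hs : rho f s ≠ 0) :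
    deriv (H f) s = -(2 * deriv (deriv f) s - 4 * deriv f s ^ 2) / rho f s ^ 2 := by
  have h1 : HasDerivAt (fun s => 2 * deriv f s) (2 * deriv (deriv f) s) s :=
    (hasDerivAt_deriv hf s).const_mul 2
  have := (h1.div (hasDerivAt_rho hf s) hs).neg
  have e : deriv (H f) s = _ := this.deriv
  rw [e, neg_div, rho]
  congr 2
  ring

theorem uctl_deriv_H : UCtl M m fun f s => deriv (H f) s := by
  refine ⟨M, fun f hf hb s t hs ht => Ctl.of_hasDerivAt (g' := deriv (deriv (H f)))
    (fun s hs => ?_) (fun s hs => ?_) (fun s hs => ?_) hs ht⟩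
  · have := contDiffAt_H hf (hb.rho_pos hf hs).ne'
    have h1 : ContDiffAt ℝ 1 (deriv (H f)) s :=
      (this.fderiv_right (m := 1) (by norm_num)).clm_apply contDiffAt_const
    exact (h1.differentiableAt (by norm_num)).hasDerivAt
  · exact (hb s hs).2.2.2.2.2.1
  · exact (hb s hs).2.2.2.2.2.2.2.2.2

theorem UCtl.congr {F F' : (ℝ → ℝ) → ℝ → ℝ} (h : UCtl M m F)
    (e : ∀ f, ContDiff ℝ 3 f → NonlinearityBounds f M m → ∀ s, |s| ≤ m → F' f s = F f s) :
    UCtl M m F' := by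
  obtain ⟨B, h⟩ := h
  refine ⟨B, fun f hf hb s t hs ht => ?_⟩
  rw [e f hf hb s hs, e f hf hb t ht]
  exact h f hf hb s t hs ht

/-- No bound on f''' is assumed. Solving H' = -(2 f'' - 4 f'²)/ρ² for f'' gives f'' = 2 f'² - ½ H'
ρ², and H' is Lipschitz because H'' is bounded. -/
theorem uctl_deriv_deriv (hm : 0 < m) : UCtl M m fun f s => deriv (deriv f) s := by
  have h2 := (UCtl.const (M := M) (m := m) 2).mul (uctl_deriv.mul uctl_deriv)
  have h3 := (UCtl.const (1 / 2)).mul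
    (uctl_deriv_H.mul ((uctl_rho (M := M) hm).mul (uctl_rho hm)))
  refine (h2.sub h3).congr fun f hf hb s hs => ?_
  have h0 := (hb.rho_pos hf hs).ne'
  rw [deriv_H hf h0]
  field_simp
  ring

/-! ### The sound speed, the factor E and the null directions as functions of σ. -/

/-- The sound speed `√(1 + 2 f'(σ) σ)`. -/
def sound (f : ℝ → ℝ) (s : ℝ) : ℝ := √(rho f s)

theorem sound_sq (hf : ContDiff ℝ 3 f) (hb : NonlinearityBounds f M m) {s : ℝ} (hs : |s| ≤ m) :
    sound f s ^ 2 = 1 + 2 * deriv f s * s :=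
  Real.sq_sqrt (hb.rho_pos hf hs).le

theorem sound_lower (hf : ContDiff ℝ 3 f) (hb : NonlinearityBounds f M m) {s : ℝ}
    (hs : |s| ≤ m) : √M⁻¹ ≤ sound f s :=
  Real.sqrt_le_sqrt (hb.inv_le_rho hf hs)

theorem sound_pos (hf : ContDiff ℝ 3 f) (hb : NonlinearityBounds f M m) {s : ℝ}
    (hs : |s| ≤ m) : 0 < sound f s :=
  Real.sqrt_pos.2 (hb.rho_pos hf hs)

theorem continuous_sound (hf : ContDiff ℝ 3 f) : Continuous (sound f) :=
  (contDiff_rho hf).continuous.sqrt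

theorem uctl_sound (hM : 0 < M) (hm : 0 < m) : UCtl M m fun f s => sound f s := by
  obtain ⟨B, h⟩ := uctl_rho (M := M) hm
  exact ⟨_, fun f hf hb s t hs ht => (h f hf hb s t hs ht).sqrt (inv_pos.2 hM)
    (hb.inv_le_rho hf hs) (hb.inv_le_rho hf ht)⟩

/-- The logarithmic derivative of `E`. -/
def logDerivE (f : ℝ → ℝ) (s : ℝ) : ℝ := deriv f s * (1 + sound f s)⁻¹

theorem continuous_logDerivE (hf : ContDiff ℝ 3 f) : Continuous (logDerivE f) := by
  have h1 := (contDiff_deriv hf).continuous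
  have h2 := continuous_sound hf
  refine h1.mul ((continuous_const.add h2).inv₀ fun x => ?_)
  have : 0 ≤ sound f x := Real.sqrt_nonneg _
  exact (by linarith : (0 : ℝ) < 1 + sound f x).ne'

theorem uctl_inv_one_add_sound (hM : 0 < M) (hm : 0 < m) :
    UCtl M m fun f s => (1 + sound f s)⁻¹ :=
  ((UCtl.const 1).add (uctl_sound hM hm)).inv one_pos fun f _ _ s _ => by
    have : 0 ≤ sound f s := Real.sqrt_nonneg _
    linarith

theorem uctl_logDerivE (hM : 0 < M) (hm : 0 < m) : UCtl M m fun f s => logDerivE f s :=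
  uctl_deriv.mul (uctl_inv_one_add_sound hM hm)

theorem abs_logDerivE_le (hb : NonlinearityBounds f M m) {s : ℝ} (hs : |s| ≤ m) :
    |logDerivE f s| ≤ M := by
  have h0 : 0 ≤ sound f s := Real.sqrt_nonneg _
  rw [logDerivE, abs_mul, abs_of_pos (by positivity : 0 < (1 + sound f s)⁻¹)]
  have h1 : (1 + sound f s)⁻¹ ≤ 1 := inv_le_one_of_one_le₀ (by linarith)
  have h2 := (hb s hs).2.2.2.1
  exact (mul_le_of_le_one_right (abs_nonneg _) h1).trans h2

/-- The logarithm of the factor between the rectangular derivatives and the Riemann invariants. -/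
def logE (f : ℝ → ℝ) (s : ℝ) : ℝ := ∫ t in (0 : ℝ)..s, logDerivE f t

theorem hasDerivAt_logE (hf : ContDiff ℝ 3 f) (s : ℝ) :
    HasDerivAt (logE f) (logDerivE f s) s :=
  ((continuous_logDerivE hf).integral_hasStrictDerivAt 0 s).hasDerivAt

theorem abs_logE_le (hM : 0 ≤ M) (hb : NonlinearityBounds f M m) {s : ℝ} (hs : |s| ≤ m) :
    |logE f s| ≤ M * m := by
  have := intervalIntegral.norm_integral_le_of_norm_le_const (a := 0) (b := s) (C := M)
    (f := logDerivE f) fun x hx => by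
      refine abs_logDerivE_le hb ?_
      have := abs_sub_left_of_mem_uIcc (uIoc_subset_uIcc hx)
      simp only [sub_zero] at this
      linarith
  rw [sub_zero] at this
  exact this.trans (mul_le_mul_of_nonneg_left hs hM)

theorem uctl_logE (hM : 0 ≤ M) (hm : 0 < m) : UCtl M m fun f s => logE f s :=
  ⟨M * m + M, fun f hf hb s t hs ht => Ctl.of_hasDerivAt (fun s _ => hasDerivAt_logE hf s)
    (fun s hs => (abs_logE_le hM hb hs).trans (by linarith))
    (fun s hs => (abs_logDerivE_le hb hs).trans (by nlinarith)) hs ht⟩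

/-- The factor between the rectangular derivatives and the Riemann invariants. -/
def factorE (f : ℝ → ℝ) (s : ℝ) : ℝ := Real.exp (logE f s)

theorem factorE_pos (f : ℝ → ℝ) (s : ℝ) : 0 < factorE f s := Real.exp_pos _

theorem factorE_zero (f : ℝ → ℝ) : factorE f 0 = 1 := by simp [factorE, logE]

theorem hasDerivAt_factorE (hf : ContDiff ℝ 3 f) (s : ℝ) :
    HasDerivAt (factorE f) (factorE f s * logDerivE f s) s :=
  (hasDerivAt_logE hf s).exp

theorem uctl_factorE (hM : 0 ≤ M) (hm : 0 < m) : UCtl M m fun f s => factorE f s := by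
  obtain ⟨B, h⟩ := uctl_logE hM hm
  exact ⟨_, fun f hf hb s t hs ht => (h f hf hb s t hs ht).exp (abs_nonneg _)⟩

theorem uctl_inv_factorE (hM : 0 ≤ M) (hm : 0 < m) : UCtl M m fun f s => (factorE f s)⁻¹ := by
  obtain ⟨B, h⟩ := (uctl_logE hM hm).neg
  refine UCtl.congr (F := fun f s => Real.exp (-logE f s))
    ⟨_, fun f hf hb s t hs ht => (h f hf hb s t hs ht).exp (abs_nonneg _)⟩ fun f _ _ s _ => ?_
  rw [Real.exp_neg, factorE]

theorem factorE_lower (hM : 0 ≤ M) (hb : NonlinearityBounds f M m) {s : ℝ} (hs : |s| ≤ m) :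
    Real.exp (-(M * m)) ≤ factorE f s :=
  Real.exp_le_exp.2 (abs_le.1 (abs_logE_le hM hb hs)).1

/-- The coefficient `k` of the null directions `Lbar - k Ψbar² L` and `L - k Ψ² Lbar`. -/
def nullCoeff (f : ℝ → ℝ) (s : ℝ) : ℝ := 2 * deriv f s * (1 + sound f s)⁻¹ ^ 2

/-- The derivative of `nullCoeff`. -/
def nullCoeff' (f : ℝ → ℝ) (s : ℝ) : ℝ :=
  2 * deriv (deriv f) s * ((1 + sound f s)⁻¹ * (1 + sound f s)⁻¹) -
    4 * deriv f s * ((deriv (deriv f) s * s + deriv f s) * (sound f s)⁻¹) *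
      ((1 + sound f s)⁻¹ * ((1 + sound f s)⁻¹ * (1 + sound f s)⁻¹))

theorem hasDerivAt_sound (hf : ContDiff ℝ 3 f) (hb : NonlinearityBounds f M m) {s : ℝ}
    (hs : |s| ≤ m) :
    HasDerivAt (sound f) ((deriv (deriv f) s * s + deriv f s) * (sound f s)⁻¹) s := by
  have := (hasDerivAt_rho hf s).sqrt (hb.rho_pos hf hs).ne'
  have h0 := sound_pos hf hb hs
  refine this.congr_deriv ?_
  rw [← sound]
  field_simp

theorem hasDerivAt_nullCoeff (hf : ContDiff ℝ 3 f) (hb : NonlinearityBounds f M m) {s : ℝ}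
    (hs : |s| ≤ m) : HasDerivAt (nullCoeff f) (nullCoeff' f s) s := by
  have h0 := sound_pos hf hb hs
  have h1 := ((hasDerivAt_sound hf hb hs).const_add 1).inv (by positivity)
  have := ((hasDerivAt_deriv hf s).const_mul 2).mul (h1.pow 2)
  refine this.congr_deriv ?_
  simp only [nullCoeff', Pi.inv_apply, Pi.pow_apply, Nat.add_one_sub_one, pow_one]
  field_simp
  ring

theorem uctl_inv_sound (hM : 0 < M) (hm : 0 < m) : UCtl M m fun f s => (sound f s)⁻¹ :=
  (uctl_sound hM hm).inv (Real.sqrt_pos.2 (inv_pos.2 hM)) fun _ hf hb _ hs => sound_lower hf hb hs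

theorem uctl_nullCoeff (hM : 0 < M) (hm : 0 < m) : UCtl M m fun f s => nullCoeff f s := by
  have h := uctl_inv_one_add_sound hM hm
  simpa only [nullCoeff, sq] using ((UCtl.const 2).mul uctl_deriv).mul (h.mul h)

theorem uctl_nullCoeff' (hM : 0 < M) (hm : 0 < m) : UCtl M m fun f s => nullCoeff' f s := by
  have h := uctl_inv_one_add_sound hM hm
  have h2 := uctl_deriv_deriv (M := M) hm
  exact (((UCtl.const 2).mul h2).mul (h.mul h)).sub ((((UCtl.const 4).mul uctl_deriv).mul
    (((h2.mul (UCtl.id hm)).add uctl_deriv).mul (uctl_inv_sound hM hm))).mul (h.mul (h.mul h)))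

/-! ### Inversion of the relation between σ and τ. -/

/-- Minus the product `τ` of the Riemann invariants as a function of `σ`. -/
def prodInv (f : ℝ → ℝ) (s : ℝ) : ℝ := s * factorE f s ^ 2

/-- Since 2 f' σ = c² - 1 with c the sound speed, the factor 1 + 2σ f'/(1 + c) collapses to c. Its
positivity makes σ a function of τ. -/
theorem hasDerivAt_prodInv (hf : ContDiff ℝ 3 f) (hb : NonlinearityBounds f M m) {s : ℝ}
    (hs : |s| ≤ m) : HasDerivAt (prodInv f) (factorE f s ^ 2 * sound f s) s := by
  have := (hasDerivAt_id' s).mul ((hasDerivAt_factorE hf s).pow 2)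
  have h0 := sound_pos hf hb hs
  have h1 := sound_sq hf hb hs
  refine this.congr_deriv ?_
  simp only [logDerivE, Pi.pow_apply]
  field_simp
  push_cast
  linear_combination -(factorE f s) ^ 2 * h1

/-- A lower bound for the derivative of `prodInv`. -/
def prodInvLower (M m : ℝ) : ℝ := Real.exp (-(M * m)) ^ 2 * √M⁻¹

theorem prodInvLower_pos (hM : 0 < M) : 0 < prodInvLower M m := by
  have := Real.sqrt_pos.2 (inv_pos.2 hM)
  unfold prodInvLower
  positivity

theorem prodInv_mono (hM : 0 < M) (hf : ContDiff ℝ 3 f) (hb : NonlinearityBounds f M m)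
    {s t : ℝ} (hs : |s| ≤ m) (ht : |t| ≤ m) (hst : s ≤ t) :
    prodInvLower M m * (t - s) ≤ prodInv f t - prodInv f s := by
  have hd : ∀ x ∈ Icc (-m) m, HasDerivAt (prodInv f) (factorE f x ^ 2 * sound f x) x :=
    fun x hx => hasDerivAt_prodInv hf hb (abs_le.2 hx)
  refine Convex.mul_sub_le_image_sub_of_le_deriv (convex_Icc (-m) m)
    (fun x hx => (hd x hx).continuousAt.continuousWithinAt)
    (fun x hx => (hd x (interior_subset hx)).differentiableAt.differentiableWithinAt)
    (fun x hx => ?_) s (abs_le.1 hs) t (abs_le.1 ht) hst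
  have hx' : |x| ≤ m := abs_le.2 (interior_subset (s := Icc (-m) m) hx)
  rw [(hd x (interior_subset hx)).deriv, prodInvLower]
  have h1 := factorE_lower hM.le hb hx'
  have h2 := sound_lower hf hb hx'
  gcongr

theorem abs_sub_le_prodInv (hM : 0 < M) (hf : ContDiff ℝ 3 f) (hb : NonlinearityBounds f M m)
    {s t : ℝ} (hs : |s| ≤ m) (ht : |t| ≤ m) :
    prodInvLower M m * |s - t| ≤ |prodInv f s - prodInv f t| := by
  rcases le_total s t with h | h
  · rw [abs_sub_comm, abs_of_nonneg (sub_nonneg.2 h), abs_sub_comm (prodInv f s)]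
    exact (prodInv_mono hM hf hb hs ht h).trans (le_abs_self _)
  · rw [abs_of_nonneg (sub_nonneg.2 h)]
    exact (prodInv_mono hM hf hb ht hs h).trans (le_abs_self _)

theorem exists_prodInv_eq (hM : 0 < M) (hm : 0 < m) (hf : ContDiff ℝ 3 f)
    (hb : NonlinearityBounds f M m) {y : ℝ} (hy : |y| ≤ prodInvLower M m * m) :
    ∃ s, |s| ≤ m ∧ prodInv f s = y := by
  have hc : ContinuousOn (prodInv f) (Icc (-m) m) := fun x hx =>
    (hasDerivAt_prodInv hf hb (abs_le.2 hx)).continuousAt.continuousWithinAt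
  have h0 : prodInv f 0 = 0 := by simp [prodInv]
  have m0 : |(0 : ℝ)| ≤ m := by simpa using hm.le
  have m1 : |m| ≤ m := (abs_of_pos hm).le
  have m2 : |-m| ≤ m := by rw [abs_neg]; exact m1
  have h1 := prodInv_mono hM hf hb m0 m1 hm.le
  have h2 := prodInv_mono hM hf hb m2 m0 (by linarith)
  rw [abs_le] at hy
  obtain ⟨s, hs, hsy⟩ := intermediate_value_Icc (by linarith : -m ≤ m) hc
    (show y ∈ Icc (prodInv f (-m)) (prodInv f m) from
      ⟨by linarith [hy.1], by linarith [hy.2]⟩)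
  exact ⟨s, abs_le.2 hs, hsy⟩

open Classical in
/-- `σ` as a function of minus the product of the Riemann invariants. -/
def sigmaOf (f : ℝ → ℝ) (m y : ℝ) : ℝ :=
  -- For |y| ≤ `prodInvLower M m * m` a preimage exists, so the default 0 does not occur there.
  if h : ∃ s, |s| ≤ m ∧ prodInv f s = y then h.choose else 0

theorem sigmaOf_spec (hM : 0 < M) (hm : 0 < m) (hf : ContDiff ℝ 3 f)
    (hb : NonlinearityBounds f M m) {y : ℝ} (hy : |y| ≤ prodInvLower M m * m) :
    |sigmaOf f m y| ≤ m ∧ prodInv f (sigmaOf f m y) = y := by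
  have h := exists_prodInv_eq hM hm hf hb hy
  rw [sigmaOf, dif_pos h]
  exact h.choose_spec

theorem sigmaOf_prodInv (hM : 0 < M) (hf : ContDiff ℝ 3 f)
    (hb : NonlinearityBounds f M m) {s : ℝ} (hs : |s| ≤ m) : sigmaOf f m (prodInv f s) = s := by
  have h : ∃ t, |t| ≤ m ∧ prodInv f t = prodInv f s := ⟨s, hs, rfl⟩
  have hh := h.choose_spec
  rw [sigmaOf, dif_pos h]
  have := abs_sub_le_prodInv hM hf hb hh.1 hs
  rw [hh.2, sub_self, abs_zero] at this
  have h3 := prodInvLower_pos (m := m) hM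
  have : |h.choose - s| ≤ 0 := by
    by_contra! h4
    nlinarith
  linarith [abs_le.1 this]

theorem abs_sigmaOf_sub_le (hM : 0 < M) (hm : 0 < m) (hf : ContDiff ℝ 3 f)
    (hb : NonlinearityBounds f M m) {y z : ℝ} (hy : |y| ≤ prodInvLower M m * m)
    (hz : |z| ≤ prodInvLower M m * m) :
    |sigmaOf f m y - sigmaOf f m z| ≤ (prodInvLower M m)⁻¹ * |y - z| := by
  obtain ⟨h1, h2⟩ := sigmaOf_spec hM hm hf hb hy
  obtain ⟨h3, h4⟩ := sigmaOf_spec hM hm hf hb hz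
  have := abs_sub_le_prodInv hM hf hb h1 h3
  rw [h2, h4] at this
  rwa [le_inv_mul_iff₀ (prodInvLower_pos hM)]

/-- The derivative of an inverse function. The strict inequality keeps a neighbourhood of y in the
range where `sigmaOf` inverts `prodInv`; continuity at y comes from the Lipschitz bound. -/
theorem hasDerivAt_sigmaOf (hM : 0 < M) (hm : 0 < m) (hf : ContDiff ℝ 3 f)
    (hb : NonlinearityBounds f M m) {y : ℝ} (hy : |y| < prodInvLower M m * m) :
    HasDerivAt (sigmaOf f m)
      (factorE f (sigmaOf f m y) ^ 2 * sound f (sigmaOf f m y))⁻¹ y := by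
  have hn : ∀ᶠ z in 𝓝 y, |z| ≤ prodInvLower M m * m :=
    (continuous_abs.continuousAt.eventually_lt continuousAt_const hy).mono fun z hz => hz.le
  obtain ⟨h1, h2⟩ := sigmaOf_spec hM hm hf hb hy.le
  have hs := sound_pos hf hb h1
  have hE := factorE_pos f (sigmaOf f m y)
  refine HasDerivAt.of_local_left_inverse ?_ (hasDerivAt_prodInv hf hb h1) (by positivity)
    (hn.mono fun z hz => (sigmaOf_spec hM hm hf hb hz).2)
  have hlim : Tendsto (fun z => (prodInvLower M m)⁻¹ * |z - y|) (𝓝 y) (𝓝 0) := by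
    have : Continuous fun z => (prodInvLower M m)⁻¹ * |z - y| := by fun_prop
    simpa using this.tendsto y
  rw [ContinuousAt, tendsto_iff_norm_sub_tendsto_zero]
  exact squeeze_zero' (Eventually.of_forall fun z => norm_nonneg _)
    (hn.mono fun z hz => abs_sigmaOf_sub_le hM hm hf hb hz hy.le) hlim

/-- The derivative of `q` as a function of `σ`. -/
def derivQ (f : ℝ → ℝ) (s : ℝ) : ℝ :=
  -((nullCoeff' f s - 2 * (nullCoeff f s * logDerivE f s)) *
    ((factorE f s)⁻¹ * (factorE f s)⁻¹ * ((factorE f s)⁻¹ * (factorE f s)⁻¹)) * (sound f s)⁻¹)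

theorem uctl_derivQ (hM : 0 < M) (hm : 0 < m) : UCtl M m fun f s => derivQ f s := by
  have h := uctl_inv_factorE hM.le hm
  exact ((((uctl_nullCoeff' hM hm).sub ((UCtl.const 2).mul ((uctl_nullCoeff hM hm).mul
    (uctl_logDerivE hM hm)))).mul ((h.mul h).mul (h.mul h))).mul (uctl_inv_sound hM hm)).neg

theorem UCtl.comp_sigmaOf {F : (ℝ → ℝ) → ℝ → ℝ} (hM : 0 < M) (hm : 0 < m) (h : UCtl M m F) :
    ∃ B, ∀ f, ContDiff ℝ 3 f → NonlinearityBounds f M m → ∀ s t, |s| ≤ prodInvLower M m * m →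
      |t| ≤ prodInvLower M m * m →
      Ctl B 1 |s - t| (F f (sigmaOf f m (-s))) (F f (sigmaOf f m (-t))) := by
  obtain ⟨B, h⟩ := h
  refine ⟨B * (1 + (prodInvLower M m)⁻¹), fun f hf hb s t hs ht => ?_⟩
  rw [← abs_neg] at hs ht
  obtain ⟨h1, h2, h3⟩ := h f hf hb _ _ (sigmaOf_spec hM hm hf hb hs).1
    (sigmaOf_spec hM hm hf hb ht).1
  have hl := abs_sigmaOf_sub_le hM hm hf hb hs ht
  have hB : 0 ≤ B := by simpa using (abs_nonneg _).trans h1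
  have hp := inv_pos.2 (prodInvLower_pos (m := m) hM)
  have hBp : 0 ≤ B * (prodInvLower M m)⁻¹ := by positivity
  rw [show -s - -t = -(s - t) by ring, abs_neg] at hl
  refine ⟨by linarith, by linarith, h3.trans ?_⟩
  have := mul_le_mul_of_nonneg_left hl hB
  have := mul_nonneg hB (abs_nonneg (s - t))
  linarith

/-- The functions are e = 1/E and q = k/E², with k = `nullCoeff`, evaluated at σ = `sigmaOf f m
(-τ)`. With c the sound speed, all identities reduce to 1 - qτ = 2c/(1 + c) and 1 + qτ = 2/(1 + c),
both consequences of c² = 1 + 2 f' σ. -/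
theorem exists_profile (M m : ℝ) (hm : 0 < m) :
    ∃ δ K : ℝ, 0 < δ ∧ 1 ≤ K ∧ ∀ f : ℝ → ℝ, ContDiff ℝ 3 f → NonlinearityBounds f M m →
      ∃ c : Profile δ K, c.Fits f ∧ ∃ E E' : ℝ → ℝ, c.Inverts E E' := by
  by_cases hM1 : 1 ≤ M
  swap
  -- For M < 1 no f satisfies the bounds, because at σ = 0 they contain 1 ≤ M.
  · exact ⟨1, 1, one_pos, le_rfl, fun f _ hb => absurd (hb.one_le hm) hM1⟩
  have hM : 0 < M := by linarith
  have hEi := uctl_inv_factorE hM.le hm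
  obtain ⟨Be, he⟩ := hEi.comp_sigmaOf hM hm
  obtain ⟨Bq, hq⟩ := ((uctl_nullCoeff hM hm).mul (hEi.mul hEi)).comp_sigmaOf hM hm
  obtain ⟨Bq', hq'⟩ := (uctl_derivQ hM hm).comp_sigmaOf hM hm
  obtain ⟨BE, hE⟩ := uctl_factorE hM.le hm
  obtain ⟨BE', hE'⟩ := (uctl_factorE hM.le hm).mul (uctl_logDerivE hM hm)
  set K := 1 + |Be| + |Bq| + |Bq'| + |BE| + |BE'| with hK
  have hle : ∀ B, |B| ≤ |Be| + |Bq| + |Bq'| + |BE| + |BE'| → ∀ {d x y : ℝ}, 0 ≤ d →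
      Ctl B 1 d x y → Ctl K 1 d x y := fun B hB d x y hd h =>
    h.mono (by rw [hK]; linarith [le_abs_self B]) zero_le_one hd
  have n1 := abs_nonneg Be
  have n2 := abs_nonneg Bq
  have n3 := abs_nonneg Bq'
  have n4 := abs_nonneg BE
  have n5 := abs_nonneg BE'
  have hK1 : 1 ≤ K := by rw [hK]; linarith
  have hp := prodInvLower_pos (m := m) hM
  -- The three entries keep τ strictly inside the range where `sigmaOf` is differentiable, keep |σ|
  -- ≤ m for the bounds on E, and give |q τ| ≤ K δ ≤ 1/2.
  set δ := min (min (prodInvLower M m * m / 2) m) (1 / (2 * K)) with hδ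
  have hδ0 : 0 < δ := by rw [hδ]; positivity
  have hδ1 : δ < prodInvLower M m * m := by
    have : δ ≤ prodInvLower M m * m / 2 := (min_le_left _ _).trans (min_le_left _ _)
    have : 0 < prodInvLower M m * m := by positivity
    linarith
  have hδ2 : δ ≤ m := (min_le_left _ _).trans (min_le_right _ _)
  have hδ3 : K * δ ≤ 1 / 2 := by
    have : δ ≤ 1 / (2 * K) := min_le_right _ _
    calc K * δ ≤ K * (1 / (2 * K)) := by gcongr
      _ = 1 / 2 := by field_simp
  refine ⟨δ, K, hδ0, hK1, fun f hf hb => ?_⟩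
  have hspec : ∀ t, |t| ≤ δ → |sigmaOf f m (-t)| ≤ m ∧ prodInv f (sigmaOf f m (-t)) = -t :=
    fun t ht => sigmaOf_spec hM hm hf hb (by rw [abs_neg]; linarith)
  have hder : ∀ t, |t| ≤ δ → HasDerivAt (fun t => sigmaOf f m (-t))
      (-(factorE f (sigmaOf f m (-t)) ^ 2 * sound f (sigmaOf f m (-t)))⁻¹) t := fun t ht => by
    have h1 := hasDerivAt_sigmaOf hM hm hf hb (y := -t) (by rw [abs_neg]; linarith)
    exact (h1.comp t (hasDerivAt_neg t)).congr_deriv (by ring)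
  have hctl_q : ∀ s t, |s| ≤ δ → |t| ≤ δ → Ctl K 1 |s - t|
      (nullCoeff f (sigmaOf f m (-s)) * ((factorE f (sigmaOf f m (-s)))⁻¹ *
        (factorE f (sigmaOf f m (-s)))⁻¹))
      (nullCoeff f (sigmaOf f m (-t)) * ((factorE f (sigmaOf f m (-t)))⁻¹ *
        (factorE f (sigmaOf f m (-t)))⁻¹)) := fun s t hs ht =>
    hle Bq (by linarith) (abs_nonneg _) (hq f hf hb s t (by linarith) (by linarith))
  have hinv : ∀ s, |s| ≤ δ → sigmaOf f m (-(-(s * factorE f s ^ 2))) = s := fun s hs => by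
    rw [neg_neg]; exact sigmaOf_prodInv hM hf hb (hs.trans hδ2)
  refine ⟨{ e := fun t => (factorE f (sigmaOf f m (-t)))⁻¹
            q := fun t => nullCoeff f (sigmaOf f m (-t)) * ((factorE f (sigmaOf f m (-t)))⁻¹ *
              (factorE f (sigmaOf f m (-t)))⁻¹)
            q' := fun t => derivQ f (sigmaOf f m (-t))
            hasDerivAt_e := fun t ht => ?_
            hasDerivAt_q := fun t ht => ?_
            ctl_e := fun s t hs ht => hle Be (by linarith) (abs_nonneg _)
              (he f hf hb s t (by linarith) (by linarith))
            ctl_q := hctl_q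
            ctl_q' := fun s t hs ht => hle Bq' (by linarith) (abs_nonneg _)
              (hq' f hf hb s t (by linarith) (by linarith))
            abs_q_mul_le := fun t ht => ?_
            e_zero := ?_ }, fun t ht => ?_, factorE f, fun s => factorE f s * logDerivE f s,
          { hasDerivAt := fun s _ => hasDerivAt_factorE hf s
            ctl := fun s t hs ht => hle BE (by linarith) (abs_nonneg _)
              (hE f hf hb s t (by linarith) (by linarith))
            ctl' := fun s t hs ht => hle BE' (by linarith) (abs_nonneg _)
              (hE' f hf hb s t (by linarith) (by linarith))
            mul_e := fun s hs => ?_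
            zero := factorE_zero f }⟩
  · obtain ⟨h1, h2⟩ := hspec t ht
    have h3 := (((hasDerivAt_factorE hf _).comp t (hder t ht)).inv (factorE_pos f _).ne')
    refine h3.congr_deriv ?_
    simp only [Function.comp, prodInv, nullCoeff, logDerivE] at h2 ⊢
    have hr := sound_pos hf hb h1
    have hr2 := sound_sq hf hb h1
    have hE0 := factorE_pos f (sigmaOf f m (-t))
    generalize sigmaOf f m (-t) = s at *
    have ht' : t = -(s * factorE f s ^ 2) := by linarith
    have e1 : 1 - 2 * deriv f s * (1 + sound f s)⁻¹ ^ 2 * ((factorE f s)⁻¹ * (factorE f s)⁻¹) * t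
        = 2 * sound f s * (1 + sound f s)⁻¹ := by
      rw [ht']
      field_simp
      linear_combination -hr2
    rw [e1]
    field_simp
  · obtain ⟨h1, h2⟩ := hspec t ht
    have hE0 := factorE_pos f (sigmaOf f m (-t))
    have hr := sound_pos hf hb h1
    have h3 := ((hasDerivAt_factorE hf _).comp t (hder t ht)).inv hE0.ne'
    have h4 := ((hasDerivAt_nullCoeff hf hb h1).comp t (hder t ht)).mul (h3.mul h3)
    refine h4.congr_deriv ?_
    simp only [Function.comp, derivQ, Pi.mul_apply, Pi.inv_apply]
    field_simp
    ring
  · have h1 := (hctl_q t t ht ht).1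
    rw [abs_mul]
    refine le_trans (mul_le_mul h1 ht (abs_nonneg _) (by positivity)) ?_
    linarith
  · have := hinv 0 (by simpa using hδ0.le)
    simp only [zero_mul, neg_zero] at this ⊢
    rw [this, factorE_zero, inv_one]
  · obtain ⟨h1, h2⟩ := hspec t ht
    simp only [prodInv, nullCoeff] at h2 ⊢
    have hr := sound_pos hf hb h1
    have hr2 := sound_sq hf hb h1
    have hE0 := factorE_pos f (sigmaOf f m (-t))
    generalize sigmaOf f m (-t) = s at *
    have ht' : t = -(s * factorE f s ^ 2) := by linarith
    have e1 : 1 + 2 * deriv f s * (1 + sound f s)⁻¹ ^ 2 * ((factorE f s)⁻¹ * (factorE f s)⁻¹) * t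
        = 2 * (1 + sound f s)⁻¹ := by
      rw [ht']
      field_simp
      linear_combination hr2
    have e2 : -(t * (factorE f s)⁻¹ ^ 2) = s := by
      rw [ht']
      field_simp
    rw [e1, e2]
    field_simp
  · simp only
    rw [hinv s hs]
    exact mul_inv_cancel₀ (factorE_pos f s).ne'

end Constitutive

/-! ### Functions on the plane with prescribed partial derivatives -/

/-- The linear form `a dx + b dy` on the plane. -/
def lin (a b : ℝ) : ℝ × ℝ →L[ℝ] ℝ :=
  a • ContinuousLinearMap.fst ℝ ℝ ℝ + b • ContinuousLinearMap.snd ℝ ℝ ℝ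

@[simp]
theorem lin_apply (a b : ℝ) (x : ℝ × ℝ) : lin a b x = a * x.1 + b * x.2 := rfl

theorem continuous_lin : Continuous fun x : ℝ × ℝ => lin x.1 x.2 := by
  unfold lin
  fun_prop

theorem hasFDerivAt_of_partials {F P Q : ℝ × ℝ → ℝ} (hP : Continuous P) (hQ : Continuous Q)
    (h1 : ∀ u b, HasDerivAt (fun s => F (s, b)) (P (u, b)) u)
    (h2 : ∀ u b, HasDerivAt (fun s => F (u, s)) (Q (u, b)) b) (p : ℝ × ℝ) :
    HasFDerivAt F (lin (P p) (Q p)) p := by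
  have key := hasStrictFDerivAt_uncurry_coprod (𝕜 := ℝ) (u := p) (f := fun u b => F (u, b))
    (f₁ := fun u b => (1 : ℝ →L[ℝ] ℝ).smulRight (P (u, b)))
    (f₂ := fun u b => (1 : ℝ →L[ℝ] ℝ).smulRight (Q (u, b)))
    (Eventually.of_forall fun v => (h1 v.1 v.2).hasFDerivAt)
    (Eventually.of_forall fun v => (h2 v.1 v.2).hasFDerivAt)
    (by
      have : Continuous fun x : ℝ × ℝ => (1 : ℝ →L[ℝ] ℝ).smulRight (P x) :=
        (ContinuousLinearMap.smulRightL ℝ ℝ ℝ (1 : ℝ →L[ℝ] ℝ)).continuous.comp hP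
      exact this.continuousAt)
    (by
      have : Continuous fun x : ℝ × ℝ => (1 : ℝ →L[ℝ] ℝ).smulRight (Q x) :=
        (ContinuousLinearMap.smulRightL ℝ ℝ ℝ (1 : ℝ →L[ℝ] ℝ)).continuous.comp hQ
      exact this.continuousAt)
  refine (key.hasFDerivAt.congr_fderiv ?_ : HasFDerivAt F _ p)
  ext <;> simp [Function.HasUncurry.uncurry]

theorem contDiff_one_of_lin {F P Q : ℝ × ℝ → ℝ} (hP : Continuous P) (hQ : Continuous Q)
    (h : ∀ p, HasFDerivAt F (lin (P p) (Q p)) p) : ContDiff ℝ 1 F :=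
  contDiff_one_iff_hasFDerivAt.2
    ⟨fun p => lin (P p) (Q p), continuous_lin.comp (hP.prodMk hQ), h⟩

theorem HasFDerivAt.partial_snd {F : ℝ × ℝ → ℝ} {P Q u b : ℝ}
    (h : HasFDerivAt F (lin P Q) (u, b)) : HasDerivAt (fun s => F (u, s)) Q b := by
  have := h.comp_hasDerivAt b ((hasDerivAt_const b u).prodMk (hasDerivAt_id' b))
  exact this.congr_deriv (by simp)

theorem HasFDerivAt.antidiagonal {F : ℝ × ℝ → ℝ} {P Q u : ℝ}
    (h : HasFDerivAt F (lin P Q) (u, -u)) : HasDerivAt (fun s => F (s, -s)) (P - Q) u := by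
  have := h.comp_hasDerivAt u ((hasDerivAt_id' u).prodMk (hasDerivAt_neg u))
  exact this.congr_deriv (by simp; ring)

theorem hasDerivAt_parametric_integral {Q m : ℝ × ℝ → ℝ} (hQ : Continuous Q) (hm : Continuous m)
    (h : ∀ u b, HasDerivAt (fun s => Q (s, b)) (m (u, b)) u) (u b : ℝ) :
    HasDerivAt (fun u => ∫ s in (0 : ℝ)..b, Q (u, s)) (∫ s in (0 : ℝ)..b, m (u, s)) u := by
  obtain ⟨C, hC⟩ := ((isCompact_Icc (a := u - 1) (b := u + 1)).prod
    (isCompact_uIcc (a := (0 : ℝ)) (b := b))).exists_bound_of_continuousOn hm.continuousOn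
  have c1 : ∀ u, Continuous fun s => Q (u, s) := fun u => by fun_prop
  have c2 : Continuous fun s => m (u, s) := by fun_prop
  refine (intervalIntegral.hasDerivAt_integral_of_dominated_loc_of_deriv_le
    (F := fun u s => Q (u, s)) (F' := fun u s => m (u, s)) (bound := fun _ => C)
    (s := Icc (u - 1) (u + 1)) (Icc_mem_nhds (by linarith) (by linarith))
    (Eventually.of_forall fun x => (c1 x).aestronglyMeasurable)
    ((c1 u).intervalIntegrable _ _) c2.aestronglyMeasurable
    (Eventually.of_forall fun t ht x hx => ?_) (by simp)
    (Eventually.of_forall fun t _ x _ => h x t)).2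
  exact hC (x, t) ⟨hx, uIoc_subset_uIcc ht⟩

/-- A one-form `P du + Q db` with `∂_b P = ∂_u Q` has a primitive, even if the other two partial
derivatives do not exist. It may be prescribed on the antidiagonal if this is compatible. -/
theorem exists_primitive {P Q m : ℝ × ℝ → ℝ} {g g' : ℝ → ℝ} (hP : Continuous P)
    (hQ : Continuous Q) (hm : Continuous m)
    (h1 : ∀ u b, HasDerivAt (fun s => P (u, s)) (m (u, b)) b)
    (h2 : ∀ u b, HasDerivAt (fun s => Q (s, b)) (m (u, b)) u)
    (hg : ∀ u, HasDerivAt g (g' u) u) (hg' : ∀ u, P (u, -u) - Q (u, -u) = g' u) :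
    ∃ F : ℝ × ℝ → ℝ, (∀ p, HasFDerivAt F (lin (P p) (Q p)) p) ∧ ∀ u, F (u, -u) = g u := by
  -- Integration along the axis b = 0 and then vertically. The u-derivative of the second integral
  -- is ∫ m = P(u, b) - P(u, 0), which completes P(u, 0) to P(u, b).
  set F₀ : ℝ × ℝ → ℝ := fun p => (∫ s in (0 : ℝ)..p.1, P (s, 0)) + ∫ s in (0 : ℝ)..p.2, Q (p.1, s)
    with hF₀
  have d0 : ∀ p, HasFDerivAt F₀ (lin (P p) (Q p)) p := by
    refine hasFDerivAt_of_partials hP hQ (fun u b => ?_) fun u b => ?_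
    · have e1 : HasDerivAt (fun u => ∫ s in (0 : ℝ)..u, P (s, 0)) (P (u, 0)) u :=
        (Continuous.integral_hasStrictDerivAt (f := fun s => P (s, 0)) (by fun_prop)
          0 u).hasDerivAt
      refine (e1.add (hasDerivAt_parametric_integral hQ hm h2 u b)).congr_deriv ?_
      rw [intervalIntegral.integral_eq_sub_of_hasDerivAt (fun x _ => h1 u x)
        (Continuous.intervalIntegrable (by fun_prop) _ _)]
      ring
    · have e2 : HasDerivAt (fun b => ∫ s in (0 : ℝ)..b, Q (u, s)) (Q (u, b)) b :=
        (Continuous.integral_hasStrictDerivAt (f := fun s => Q (u, s)) (by fun_prop)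
          0 b).hasDerivAt
      exact e2.const_add (∫ s in (0 : ℝ)..u, P (s, 0))
  -- On the antidiagonal F₀ - g has derivative P - Q - g' = 0, so subtracting a constant adjusts the
  -- prescribed values.
  have hc : ∀ u, F₀ (u, -u) - g u = F₀ (0, -0) - g 0 := by
    have hd : ∀ u, HasDerivAt (fun u => F₀ (u, -u) - g u) 0 u := fun u =>
      ((HasFDerivAt.antidiagonal (d0 (u, -u))).sub (hg u)).congr_deriv (by rw [hg']; ring)
    intro u
    exact is_const_of_deriv_eq_zero (fun u => (hd u).differentiableAt) (fun u => (hd u).deriv) u 0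
  refine ⟨fun p => F₀ p - (F₀ (0, -0) - g 0), fun p => (d0 p).sub_const _, fun u => ?_⟩
  have := hc u
  simp only
  linarith

/-! ### A linear hyperbolic system with integrable coefficients -/

/-- Coefficients and data of the system `∂_b V = a W + b V`, `∂_u W = c V + d W`, with `V` and `W`
given on the antidiagonal. -/
structure Coeffs where
  a : ℝ × ℝ → ℝ
  b : ℝ × ℝ → ℝ
  c : ℝ × ℝ → ℝ
  d : ℝ × ℝ → ℝ
  V₀ : ℝ → ℝ
  W₀ : ℝ → ℝ

namespace Coeffs

/-- The integral form of the system: a fixed point is a solution. -/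
def step (k : Coeffs) (X : ℝ × ℝ → ℝ × ℝ) (p : ℝ × ℝ) : ℝ × ℝ :=
  (k.V₀ p.1 + ∫ s in -p.1..p.2, (k.a (p.1, s) * (X (p.1, s)).2 + k.b (p.1, s) * (X (p.1, s)).1),
    k.W₀ p.2 + ∫ s in -p.2..p.1, (k.c (s, p.2) * (X (s, p.2)).1 + k.d (s, p.2) * (X (s, p.2)).2))

/-- Continuity and weighted bounds of the coefficients and the data. -/
structure Bounded (k : Coeffs) (ω : ℝ → ℝ) (θ B : ℝ) : Prop where
  continuous_a : Continuous k.a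
  continuous_b : Continuous k.b
  continuous_c : Continuous k.c
  continuous_d : Continuous k.d
  continuous_V₀ : Continuous k.V₀
  continuous_W₀ : Continuous k.W₀
  abs_a_le : ∀ p, |k.a p| ≤ θ * ω p.2
  abs_b_le : ∀ p, |k.b p| ≤ θ * ω p.2
  abs_c_le : ∀ p, |k.c p| ≤ θ * ω p.1
  abs_d_le : ∀ p, |k.d p| ≤ θ * ω p.1
  abs_V₀_le : ∀ u, |k.V₀ u| ≤ B
  abs_W₀_le : ∀ u, |k.W₀ u| ≤ B

/-- Weighted difference of two systems. -/
structure Close (k l : Coeffs) (ω : ℝ → ℝ) (η : ℝ) : Prop where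
  a : ∀ p, |k.a p - l.a p| ≤ η * ω p.2
  b : ∀ p, |k.b p - l.b p| ≤ η * ω p.2
  c : ∀ p, |k.c p - l.c p| ≤ η * ω p.1
  d : ∀ p, |k.d p - l.d p| ≤ η * ω p.1
  V₀ : ∀ u, |k.V₀ u - l.V₀ u| ≤ η
  W₀ : ∀ u, |k.W₀ u - l.W₀ u| ≤ η

variable {k l : Coeffs} {ω : ℝ → ℝ} {θ B θ' B' η I : ℝ}

theorem continuous_step (hk : k.Bounded ω θ B) {X : ℝ × ℝ → ℝ × ℝ} (hX : Continuous X) :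
    Continuous (k.step X) := by
  obtain ⟨h1, h2, h3, h4, h5, h6, -⟩ := hk
  -- Both endpoints move with the point, so the integral is split at 0.
  have aux : ∀ {F : ℝ × ℝ → ℝ → ℝ} {s t : ℝ × ℝ → ℝ}, Continuous (Function.uncurry F) →
      Continuous s → Continuous t → Continuous fun p => ∫ x in s p..t p, F p x := by
    intro F s t hF hs ht
    have e : (fun p => ∫ x in s p..t p, F p x) =
        fun p => (∫ x in (0 : ℝ)..t p, F p x) - ∫ x in (0 : ℝ)..s p, F p x := by
      ext p
      have hFp : Continuous (F p) := by
        have : F p = Function.uncurry F ∘ fun x => (p, x) := rfl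
        rw [this]; fun_prop
      rw [intervalIntegral.integral_interval_sub_left] <;>
        exact hFp.intervalIntegrable _ _
    rw [e]
    exact (intervalIntegral.continuous_parametric_intervalIntegral_of_continuous hF ht).sub
      (intervalIntegral.continuous_parametric_intervalIntegral_of_continuous hF hs)
  unfold step
  refine Continuous.prodMk ?_ ?_
  · refine (h5.comp continuous_fst).add (aux ?_ (by fun_prop) (by fun_prop))
    simp only [Function.uncurry_def]
    fun_prop
  · refine (h6.comp continuous_snd).add (aux ?_ (by fun_prop) (by fun_prop))
    simp only [Function.uncurry_def]
    fun_prop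

theorem abs_integral_le_of_weight (hω : Continuous ω) (hI : ∀ a b, |∫ s in a..b, ω s| ≤ I)
    {F : ℝ → ℝ} {C : ℝ} (hC : 0 ≤ C) (hF : ∀ s, |F s| ≤ C * ω s) (a b : ℝ) :
    |∫ s in a..b, F s| ≤ C * I := by
  have h1 := intervalIntegral.norm_integral_le_abs_of_norm_le (a := a) (b := b) (f := F)
    (g := fun s => C * ω s) (μ := volume) (Eventually.of_forall fun s => hF s)
    ((hω.const_mul C).intervalIntegrable _ _)
  rw [Real.norm_eq_abs, intervalIntegral.integral_const_mul, abs_mul, abs_of_nonneg hC] at h1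
  exact h1.trans (mul_le_mul_of_nonneg_left (hI a b) hC)

theorem abs_integral_sub_le (hω : Continuous ω) (hω0 : ∀ s, 0 ≤ ω s)
    (hI : ∀ a b, |∫ s in a..b, ω s| ≤ I)
    {f g x y f' g' x' y' : ℝ → ℝ} {M N : ℝ} (hθ : 0 ≤ θ) (hη : 0 ≤ η) (hM : 0 ≤ M) (hN : 0 ≤ N)
    (cf : Continuous f) (cg : Continuous g) (cx : Continuous x) (cy : Continuous y)
    (cf' : Continuous f') (cg' : Continuous g') (cx' : Continuous x') (cy' : Continuous y')
    (hf : ∀ s, |f s| ≤ θ * ω s) (hg : ∀ s, |g s| ≤ θ * ω s)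
    (hx : ∀ s, |x s - x' s| ≤ M) (hy : ∀ s, |y s - y' s| ≤ M)
    (hx' : ∀ s, |x' s| ≤ N) (hy' : ∀ s, |y' s| ≤ N)
    (hff : ∀ s, |f s - f' s| ≤ η * ω s) (hgg : ∀ s, |g s - g' s| ≤ η * ω s) (a b : ℝ) :
    |(∫ s in a..b, (f s * x s + g s * y s)) - ∫ s in a..b, (f' s * x' s + g' s * y' s)| ≤
      (2 * (θ * M) + 2 * (η * N)) * I := by
  rw [← intervalIntegral.integral_sub ((by fun_prop : Continuous _).intervalIntegrable _ _)
    ((by fun_prop : Continuous _).intervalIntegrable _ _)]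
  refine abs_integral_le_of_weight hω hI (by positivity) (fun s => ?_) a b
  have e : f s * x s + g s * y s - (f' s * x' s + g' s * y' s) =
      f s * (x s - x' s) + (f s - f' s) * x' s + (g s * (y s - y' s) + (g s - g' s) * y' s) := by
    ring
  have w := hω0 s
  have p1 := mul_le_mul (hf s) (hx s) (abs_nonneg _) (by positivity)
  have p2 := mul_le_mul (hff s) (hx' s) (abs_nonneg _) (by positivity)
  have p3 := mul_le_mul (hg s) (hy s) (abs_nonneg _) (by positivity)
  have p4 := mul_le_mul (hgg s) (hy' s) (abs_nonneg _) (by positivity)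
  rw [← abs_mul] at p1 p2 p3 p4
  rw [e]
  have t1 := abs_add_le (f s * (x s - x' s) + (f s - f' s) * x' s)
    (g s * (y s - y' s) + (g s - g' s) * y' s)
  have t2 := abs_add_le (f s * (x s - x' s)) ((f s - f' s) * x' s)
  have t3 := abs_add_le (g s * (y s - y' s)) ((g s - g' s) * y' s)
  linarith

/-- One estimate with two uses: for k = l and η = 0 it is the contraction property, and for two
fixed points it gives Lipschitz dependence on coefficients and data. -/
theorem norm_step_sub_le (hω : Continuous ω) (hω0 : ∀ s, 0 ≤ ω s)
    (hI : ∀ a b, |∫ s in a..b, ω s| ≤ I) (hθ : 0 ≤ θ) (hη : 0 ≤ η)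
    (hk : k.Bounded ω θ B) (hl : l.Bounded ω θ' B') (hkl : k.Close l ω η)
    {X Y : ℝ × ℝ → ℝ × ℝ} {M N : ℝ} (hX : Continuous X) (hY : Continuous Y) (hM : 0 ≤ M)
    (hN : 0 ≤ N) (hXY : ∀ p, ‖X p - Y p‖ ≤ M) (hYN : ∀ p, ‖Y p‖ ≤ N) (p : ℝ × ℝ) :
    ‖k.step X p - l.step Y p‖ ≤ η + (2 * (θ * M) + 2 * (η * N)) * I := by
  have d1 : ∀ p, |(X p).1 - (Y p).1| ≤ M := fun p => (norm_fst_le (X p - Y p)).trans (hXY p)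
  have d2 : ∀ p, |(X p).2 - (Y p).2| ≤ M := fun p => (norm_snd_le (X p - Y p)).trans (hXY p)
  have e1 : ∀ p, |(Y p).1| ≤ N := fun p => (norm_fst_le (Y p)).trans (hYN p)
  have e2 : ∀ p, |(Y p).2| ≤ N := fun p => (norm_snd_le (Y p)).trans (hYN p)
  have := hk.continuous_a
  have := hk.continuous_b
  have := hk.continuous_c
  have := hk.continuous_d
  have := hl.continuous_a
  have := hl.continuous_b
  have := hl.continuous_c
  have := hl.continuous_d
  rw [norm_prod_le_iff]
  constructor
  · have key := abs_integral_sub_le hω hω0 hI hθ hη hM hN (f := fun s => k.a (p.1, s))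
      (g := fun s => k.b (p.1, s)) (x := fun s => (X (p.1, s)).2) (y := fun s => (X (p.1, s)).1)
      (f' := fun s => l.a (p.1, s)) (g' := fun s => l.b (p.1, s)) (x' := fun s => (Y (p.1, s)).2)
      (y' := fun s => (Y (p.1, s)).1) (by fun_prop) (by fun_prop) (by fun_prop) (by fun_prop)
      (by fun_prop) (by fun_prop) (by fun_prop) (by fun_prop) (fun s => hk.abs_a_le _)
      (fun s => hk.abs_b_le _) (fun s => d2 _) (fun s => d1 _) (fun s => e2 _) (fun s => e1 _)
      (fun s => hkl.a _) (fun s => hkl.b _) (-p.1) p.2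
    have h0 := hkl.V₀ p.1
    simp only [step, Prod.fst_sub, Real.norm_eq_abs, add_sub_add_comm]
    exact (abs_add_le _ _).trans (add_le_add h0 key)
  · have key := abs_integral_sub_le hω hω0 hI hθ hη hM hN (f := fun s => k.c (s, p.2))
      (g := fun s => k.d (s, p.2)) (x := fun s => (X (s, p.2)).1) (y := fun s => (X (s, p.2)).2)
      (f' := fun s => l.c (s, p.2)) (g' := fun s => l.d (s, p.2)) (x' := fun s => (Y (s, p.2)).1)
      (y' := fun s => (Y (s, p.2)).2) (by fun_prop) (by fun_prop) (by fun_prop) (by fun_prop)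
      (by fun_prop) (by fun_prop) (by fun_prop) (by fun_prop) (fun s => hk.abs_c_le _)
      (fun s => hk.abs_d_le _) (fun s => d1 _) (fun s => d2 _) (fun s => e1 _) (fun s => e2 _)
      (fun s => hkl.c _) (fun s => hkl.d _) (-p.2) p.1
    have h0 := hkl.W₀ p.2
    simp only [step, Prod.snd_sub, Real.norm_eq_abs, add_sub_add_comm]
    exact (abs_add_le _ _).trans (add_le_add h0 key)

theorem close_self (k : Coeffs) (ω : ℝ → ℝ) : k.Close k ω 0 := by
  constructor <;> simp

/-- The drift of a solution from its values on the antidiagonal is of the order of the coefficients,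
uniformly on the plane. Positive lower bounds on the data therefore persist globally. -/
theorem norm_step_sub_data_le (hω : Continuous ω) (hω0 : ∀ s, 0 ≤ ω s)
    (hI : ∀ a b, |∫ s in a..b, ω s| ≤ I) (hθ : 0 ≤ θ) (hk : k.Bounded ω θ B)
    {X : ℝ × ℝ → ℝ × ℝ} {N : ℝ} (hN : 0 ≤ N) (hX : ∀ p, ‖X p‖ ≤ N) (p : ℝ × ℝ) :
    ‖k.step X p - (k.V₀ p.1, k.W₀ p.2)‖ ≤ 2 * (θ * N) * I := by
  have e1 : ∀ p, |(X p).1| ≤ N := fun p => (norm_fst_le (X p)).trans (hX p)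
  have e2 : ∀ p, |(X p).2| ≤ N := fun p => (norm_snd_le (X p)).trans (hX p)
  have aux : ∀ {α β x y w : ℝ}, 0 ≤ w → |α| ≤ θ * w → |β| ≤ θ * w → |x| ≤ N → |y| ≤ N →
      |α * x + β * y| ≤ 2 * (θ * N) * w := by
    intro α β x y w hw h1 h2 h3 h4
    have p1 := mul_le_mul h1 h3 (abs_nonneg _) (by positivity)
    have p2 := mul_le_mul h2 h4 (abs_nonneg _) (by positivity)
    rw [← abs_mul] at p1 p2
    linarith [abs_add_le (α * x) (β * y)]
  rw [norm_prod_le_iff]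
  constructor
  · simp only [step, Prod.fst_sub, Real.norm_eq_abs, add_sub_cancel_left]
    exact abs_integral_le_of_weight hω hI (by positivity)
      (fun s => aux (hω0 s) (hk.abs_a_le (p.1, s)) (hk.abs_b_le (p.1, s)) (e2 _) (e1 _)) _ _
  · simp only [step, Prod.snd_sub, Real.norm_eq_abs, add_sub_cancel_left]
    exact abs_integral_le_of_weight hω hI (by positivity)
      (fun s => aux (hω0 s) (hk.abs_c_le (s, p.2)) (hk.abs_d_le (s, p.2)) (e1 _) (e2 _)) _ _

theorem norm_step_le (hω : Continuous ω) (hω0 : ∀ s, 0 ≤ ω s)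
    (hI : ∀ a b, |∫ s in a..b, ω s| ≤ I) (hθ : 0 ≤ θ) (hk : k.Bounded ω θ B)
    {X : ℝ × ℝ → ℝ × ℝ} {N : ℝ} (hN : 0 ≤ N) (hX : ∀ p, ‖X p‖ ≤ N) (p : ℝ × ℝ) :
    ‖k.step X p‖ ≤ B + 2 * (θ * N) * I := by
  have h2 := norm_step_sub_data_le hω hω0 hI hθ hk hN hX p
  have h3 : ‖(k.V₀ p.1, k.W₀ p.2)‖ ≤ B :=
    norm_prod_le_iff.2 ⟨hk.abs_V₀_le _, hk.abs_W₀_le _⟩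
  have := norm_le_norm_add_norm_sub' (k.step X p) (k.V₀ p.1, k.W₀ p.2)
  linarith

/-- The weight has integral at most I over every interval, so the contraction works on the whole
plane at once, without a continuation in time. Its ratio is at most 2 θ I ≤ 1/4. -/
theorem exists_solution (hω : Continuous ω) (hω0 : ∀ s, 0 ≤ ω s)
    (hI : ∀ a b, |∫ s in a..b, ω s| ≤ I) (hθ : 0 ≤ θ) (hθI : θ * I ≤ 1 / 8)
    (hk : k.Bounded ω θ B) :
    ∃ X : BoundedContinuousFunction (ℝ × ℝ) (ℝ × ℝ), ∀ p, X p = k.step X p := by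
  have hI0 : 0 ≤ I := (abs_nonneg _).trans (hI 0 0)
  let T : BoundedContinuousFunction (ℝ × ℝ) (ℝ × ℝ) → BoundedContinuousFunction (ℝ × ℝ) (ℝ × ℝ) :=
    fun X => BoundedContinuousFunction.ofNormedAddCommGroup (k.step X)
      (continuous_step hk X.continuous) _
      (norm_step_le hω hω0 hI hθ hk (norm_nonneg X) X.norm_coe_le_norm)
  have hT : ContractingWith (1 / 2) T := by
    refine ⟨by rw [← NNReal.coe_lt_coe]; norm_num, LipschitzWith.of_dist_le_mul fun X Y => ?_⟩
    rw [BoundedContinuousFunction.dist_le (by positivity)]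
    intro p
    have := norm_step_sub_le hω hω0 hI hθ le_rfl hk hk (close_self k ω) X.continuous Y.continuous
      (dist_nonneg (x := X) (y := Y)) (norm_nonneg Y)
      (fun p => by rw [← dist_eq_norm]; exact BoundedContinuousFunction.dist_coe_le_dist p)
      (fun p => Y.norm_coe_le_norm p) p
    rw [dist_eq_norm]
    refine this.trans ?_
    have h2 := mul_le_mul_of_nonneg_right hθI (dist_nonneg (x := X) (y := Y))
    have h3 := dist_nonneg (x := X) (y := Y)
    have e : ((1 / 2 : NNReal) : ℝ) = 1 / 2 := by norm_num
    rw [e]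
    nlinarith
  refine ⟨ContractingWith.fixedPoint T hT, fun p => ?_⟩
  have h := hT.fixedPoint_isFixedPt
  have := congrArg (fun X : BoundedContinuousFunction (ℝ × ℝ) (ℝ × ℝ) => X p) h.symm
  exact this

/-- The term 2 θ I ‖X - Y‖ ≤ ¼ ‖X - Y‖ is absorbed on the left, which costs at most the factor 2. -/
theorem norm_solution_sub_le (hω : Continuous ω) (hω0 : ∀ s, 0 ≤ ω s)
    (hI : ∀ a b, |∫ s in a..b, ω s| ≤ I) (hθ : 0 ≤ θ) (hθI : θ * I ≤ 1 / 8) (hη : 0 ≤ η)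
    (hk : k.Bounded ω θ B) (hl : l.Bounded ω θ' B') (hkl : k.Close l ω η)
    {X Y : BoundedContinuousFunction (ℝ × ℝ) (ℝ × ℝ)} (hX : ∀ p, X p = k.step X p)
    (hY : ∀ p, Y p = l.step Y p) : ‖X - Y‖ ≤ 2 * (η + 2 * (η * ‖Y‖) * I) := by
  have hI0 : 0 ≤ I := (abs_nonneg _).trans (hI 0 0)
  have h1 : ‖X - Y‖ ≤ η + (2 * (θ * ‖X - Y‖) + 2 * (η * ‖Y‖)) * I := by
    rw [BoundedContinuousFunction.norm_le (by positivity)]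
    intro p
    rw [BoundedContinuousFunction.sub_apply, hX, hY]
    exact norm_step_sub_le hω hω0 hI hθ hη hk hl hkl X.continuous Y.continuous (norm_nonneg _)
      (norm_nonneg _) (fun p => (X - Y).norm_coe_le_norm p) (fun p => Y.norm_coe_le_norm p) p
  have h2 := mul_le_mul_of_nonneg_right hθI (norm_nonneg (X - Y))
  have h3 := norm_nonneg (X - Y)
  have h4 : 0 ≤ (η * ‖Y‖) * I := by positivity
  nlinarith

theorem norm_solution_sub_data_le (hω : Continuous ω) (hω0 : ∀ s, 0 ≤ ω s)
    (hI : ∀ a b, |∫ s in a..b, ω s| ≤ I) (hθ : 0 ≤ θ) (hk : k.Bounded ω θ B)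
    {X : BoundedContinuousFunction (ℝ × ℝ) (ℝ × ℝ)} (hX : ∀ p, X p = k.step X p) (p : ℝ × ℝ) :
    ‖X p - (k.V₀ p.1, k.W₀ p.2)‖ ≤ 2 * (θ * ‖X‖) * I := by
  have := norm_step_sub_data_le hω hω0 hI hθ hk (norm_nonneg X) X.norm_coe_le_norm p
  rwa [← hX] at this

theorem norm_solution_le (hω : Continuous ω) (hω0 : ∀ s, 0 ≤ ω s)
    (hI : ∀ a b, |∫ s in a..b, ω s| ≤ I) (hθ : 0 ≤ θ) (hθI : θ * I ≤ 1 / 8)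
    (hk : k.Bounded ω θ B) {X : BoundedContinuousFunction (ℝ × ℝ) (ℝ × ℝ)}
    (hX : ∀ p, X p = k.step X p) : ‖X‖ ≤ 2 * B := by
  have hB : 0 ≤ B := (abs_nonneg _).trans (hk.abs_V₀_le 0)
  have hI0 : 0 ≤ I := (abs_nonneg _).trans (hI 0 0)
  have h1 : ‖X‖ ≤ B + 2 * (θ * ‖X‖) * I := by
    rw [BoundedContinuousFunction.norm_le (by positivity)]
    intro p
    rw [hX]
    exact norm_step_le hω hω0 hI hθ hk (norm_nonneg X) X.norm_coe_le_norm p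
  have h2 := mul_le_mul_of_nonneg_right hθI (norm_nonneg X)
  have h3 := norm_nonneg X
  nlinarith

/-- V is differentiated in b only, and W below in u only: the coefficients are merely continuous, so
the other partial derivatives need not exist. -/
theorem hasDerivAt_solution_fst (hk : k.Bounded ω θ B)
    {X : BoundedContinuousFunction (ℝ × ℝ) (ℝ × ℝ)} (hX : ∀ p, X p = k.step X p) (u b : ℝ) :
    HasDerivAt (fun s => (X (u, s)).1) (k.a (u, b) * (X (u, b)).2 + k.b (u, b) * (X (u, b)).1)
      b := by
  have := hk.continuous_a
  have := hk.continuous_b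
  have h1 : Continuous fun s => k.a (u, s) * (X (u, s)).2 + k.b (u, s) * (X (u, s)).1 := by
    fun_prop
  have h2 := (h1.integral_hasStrictDerivAt (-u) b).hasDerivAt.const_add (k.V₀ u)
  refine h2.congr_of_eventuallyEq (Eventually.of_forall fun s => ?_)
  simp only
  rw [hX]
  rfl

theorem hasDerivAt_solution_snd (hk : k.Bounded ω θ B)
    {X : BoundedContinuousFunction (ℝ × ℝ) (ℝ × ℝ)} (hX : ∀ p, X p = k.step X p) (u b : ℝ) :
    HasDerivAt (fun s => (X (s, b)).2) (k.c (u, b) * (X (u, b)).1 + k.d (u, b) * (X (u, b)).2)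
      u := by
  have := hk.continuous_c
  have := hk.continuous_d
  have h1 : Continuous fun s => k.c (s, b) * (X (s, b)).1 + k.d (s, b) * (X (s, b)).2 := by
    fun_prop
  have h2 := (h1.integral_hasStrictDerivAt (-b) u).hasDerivAt.const_add (k.W₀ b)
  refine h2.congr_of_eventuallyEq (Eventually.of_forall fun s => ?_)
  simp only
  rw [hX]
  rfl

end Coeffs

/-! ### Uniqueness for hyperbolic inequalities -/

theorem abs_le_of_abs_deriv_le_exp {f f' : ℝ → ℝ} {a b C l : ℝ} (hl : 0 < l) (hab : a ≤ b)
    (hC : 0 ≤ C)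
    (hf : ∀ s, HasDerivAt f (f' s) s) (h0 : f a = 0)
    (hf' : ∀ s, a ≤ s → s ≤ b → |f' s| ≤ C * Real.exp (l * (s - a))) :
    |f b| ≤ C / l * Real.exp (l * (b - a)) := by
  have hB : ∀ s, HasDerivAt (fun s => C / l * Real.exp (l * (s - a)))
      (C * Real.exp (l * (s - a))) s := fun s => by
    have := ((((hasDerivAt_id' s).sub_const a).const_mul l).exp).const_mul (C / l)
    refine this.congr_deriv ?_
    field_simp
  refine image_norm_le_of_norm_deriv_right_le_deriv_boundary (a := a) (b := b) (f' := f')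
    (fun x _ => (hf x).continuousAt.continuousWithinAt) (fun x _ => (hf x).hasDerivWithinAt)
    ?_ hB (fun x hx => hf' x hx.1 hx.2.le) ⟨hab, le_rfl⟩
  rw [h0, norm_zero]
  positivity

theorem abs_le_of_abs_deriv_le_exp_abs {f f' : ℝ → ℝ} {a b C l A : ℝ} (hl : 0 < l) (hC : 0 ≤ C)
    (hf : ∀ s, HasDerivAt f (f' s) s) (h0 : f a = 0) (ha : |a| ≤ A) (hb : |b| ≤ A)
    (hf' : ∀ s, |s| ≤ A → |f' s| ≤ C * Real.exp (l * |s - a|)) :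
    |f b| ≤ C / l * Real.exp (l * |b - a|) := by
  rw [abs_le] at ha hb
  rcases le_total a b with h | h
  · rw [abs_of_nonneg (sub_nonneg.2 h)]
    refine abs_le_of_abs_deriv_le_exp hl h hC hf h0 fun s h1 h2 => ?_
    have := hf' s (abs_le.2 ⟨by linarith, by linarith⟩)
    rwa [abs_of_nonneg (sub_nonneg.2 h1)] at this
  · have hg : ∀ s, HasDerivAt (fun s => f (-s)) (-f' (-s)) s := fun s =>
      ((hf (-s)).comp s (hasDerivAt_neg s)).congr_deriv (by ring)
    have := abs_le_of_abs_deriv_le_exp hl (neg_le_neg h) hC hg (by simpa using h0)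
      fun s h1 h2 => by
        have := hf' (-s) (abs_le.2 ⟨by linarith, by linarith⟩)
        rw [abs_of_nonpos (a := -s - a) (by linarith)] at this
        rw [abs_neg]
        refine this.trans_eq ?_
        congr 3; ring
    rw [neg_neg] at this
    rw [abs_of_nonpos (a := b - a) (by linarith)]
    refine this.trans_eq ?_
    congr 3; ring

/-- A Gronwall argument on the square |u|, |b| ≤ A. The number |u + b| is the distance to the
antidiagonal along both coordinate directions, and the connecting segments stay in the square. At a
maximum of (|y| + |z|) exp(-l |u + b|) with l = 4K, integration of either inequality gains a factor
1/4, so the maximum is at most half of itself. -/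
theorem eq_zero_of_hyperbolic_inequality {y z y' z' : ℝ × ℝ → ℝ} (hy : Continuous y)
    (hz : Continuous z) (dy : ∀ u b, HasDerivAt (fun s => y (u, s)) (y' (u, b)) b)
    (dz : ∀ u b, HasDerivAt (fun s => z (s, b)) (z' (u, b)) u)
    (y0 : ∀ u, y (u, -u) = 0) (z0 : ∀ u, z (u, -u) = 0)
    (hK : ∀ A, ∃ K, ∀ u b, |u| ≤ A → |b| ≤ A →
      |y' (u, b)| ≤ K * (|y (u, b)| + |z (u, b)|) ∧ |z' (u, b)| ≤ K * (|y (u, b)| + |z (u, b)|))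
    (p : ℝ × ℝ) : y p = 0 ∧ z p = 0 := by
  set A := max |p.1| |p.2|
  obtain ⟨K₀, hK₀⟩ := hK A
  set K := |K₀| + 1
  have hKpos : 0 < K := by positivity
  have hK1 : ∀ x, 0 ≤ x → K₀ * x ≤ K * x := fun x hx => by
    have := le_abs_self K₀
    exact mul_le_mul_of_nonneg_right (by simp only [K]; linarith) hx
  set l := 4 * K
  have hl : 0 < l := by positivity
  set S : Set (ℝ × ℝ) := Icc (-A) A ×ˢ Icc (-A) A
  have hS : IsCompact S := isCompact_Icc.prod isCompact_Icc
  have hpS : p ∈ S := ⟨abs_le.1 (le_max_left _ _), abs_le.1 (le_max_right _ _)⟩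
  set h : ℝ × ℝ → ℝ := fun q => (|y q| + |z q|) * Real.exp (-(l * |q.1 + q.2|))
  obtain ⟨q, hqS, hq⟩ := hS.exists_isMaxOn ⟨p, hpS⟩
    (f := h) (by have : Continuous h := by simp only [h]; fun_prop
                 exact this.continuousOn)
  have hb : ∀ x ∈ S, |y x| + |z x| ≤ h q * Real.exp (l * |x.1 + x.2|) := fun x hx => by
    have h1 : h x ≤ h q := hq hx
    have h2 := mul_le_mul_of_nonneg_right h1 (Real.exp_pos (l * |x.1 + x.2|)).le
    have h3 : h x * Real.exp (l * |x.1 + x.2|) = |y x| + |z x| := by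
      simp only [h]
      rw [mul_assoc, ← Real.exp_add, neg_add_cancel, Real.exp_zero, mul_one]
    linarith
  have hN : 0 ≤ h q := by positivity
  have bd : ∀ u b, |u| ≤ A → |b| ≤ A →
      |y' (u, b)| ≤ K * h q * Real.exp (l * |u + b|) ∧
        |z' (u, b)| ≤ K * h q * Real.exp (l * |u + b|) := fun u b hu hb' => by
    obtain ⟨h1, h2⟩ := hK₀ u b hu hb'
    have h3 := mul_le_mul_of_nonneg_left (hb (u, b) ⟨abs_le.1 hu, abs_le.1 hb'⟩) hKpos.le
    have h4 := hK1 (|y (u, b)| + |z (u, b)|) (by positivity)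
    simp only at h3
    constructor <;> linarith
  obtain ⟨q1, q2⟩ := q
  have q1A : |q1| ≤ A := abs_le.2 hqS.1
  have q2A : |q2| ≤ A := abs_le.2 hqS.2
  have ey : |y (q1, q2)| ≤ K * h (q1, q2) / l * Real.exp (l * |q1 + q2|) := by
    have := abs_le_of_abs_deriv_le_exp_abs hl (by positivity : 0 ≤ K * h (q1, q2)) (dy q1)
      (y0 q1) (by rwa [abs_neg]) q2A fun s hs => by
        have := (bd q1 s q1A hs).1
        rwa [show s - -q1 = q1 + s by ring]
    rwa [show q2 - -q1 = q1 + q2 by ring] at this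
  have ez : |z (q1, q2)| ≤ K * h (q1, q2) / l * Real.exp (l * |q1 + q2|) := by
    have z0' : z (-q2, q2) = 0 := by simpa using z0 (-q2)
    have := abs_le_of_abs_deriv_le_exp_abs hl (by positivity : 0 ≤ K * h (q1, q2))
      (fun u => dz u q2) z0' (by rwa [abs_neg]) q1A fun s hs => by
        have := (bd s q2 hs q2A).2
        rwa [show s - -q2 = s + q2 by ring]
    rwa [show q1 - -q2 = q1 + q2 by ring] at this
  have hfin : h (q1, q2) ≤ h (q1, q2) / 2 := by
    have h1 : K * h (q1, q2) / l = h (q1, q2) / 4 := by simp only [l]; field_simp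
    rw [h1] at ey ez
    have h2 := mul_le_mul_of_nonneg_right (add_le_add ey ez)
      (Real.exp_pos (-(l * |q1 + q2|))).le
    have h3 : Real.exp (l * |q1 + q2|) * Real.exp (-(l * |q1 + q2|)) = 1 := by
      rw [← Real.exp_add, add_neg_cancel, Real.exp_zero]
    calc h (q1, q2) ≤ _ := h2
      _ = h (q1, q2) / 2 * (Real.exp (l * |q1 + q2|) * Real.exp (-(l * |q1 + q2|))) := by ring
      _ = _ := by rw [h3, mul_one]
  have h0 : h (q1, q2) = 0 := by linarith
  have hp := hb p hpS
  rw [h0, zero_mul] at hp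
  have n1 := abs_nonneg (y p)
  have n2 := abs_nonneg (z p)
  exact ⟨abs_eq_zero.1 (by linarith), abs_eq_zero.1 (by linarith)⟩

/-! ### Diffeomorphisms of the plane -/

/-- Every equation Φ = y is solved by the contraction x ↦ x - D (Φ(j x) - y) with a constant
diagonal matrix D and a rescaling j. Of the off-diagonal entries only P has to be small; Q may be as
large as the diagonal. -/
theorem bijective_of_diagonally_dominant {v w V Q P W : ℝ × ℝ → ℝ} {c B η : ℝ} (hc : 0 < c)
    (hcB : c ≤ B) (hη : 4 * B * η ≤ c ^ 2)
    (hv : ∀ p, HasFDerivAt v (lin (V p) (Q p)) p) (hw : ∀ p, HasFDerivAt w (lin (P p) (W p)) p)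
    (hV : ∀ p, c ≤ V p) (hVB : ∀ p, V p ≤ B) (hW : ∀ p, c ≤ W p) (hWB : ∀ p, W p ≤ B)
    (hQ : ∀ p, |Q p| ≤ B) (hP : ∀ p, |P p| ≤ η) :
    Function.Bijective fun p => (v p, w p) := by
  have hB : 0 < B := hc.trans_le hcB
  -- Shrinking the second variable by N makes the entry of Q in the first row at most c/(2B), half
  -- of the gain c/B from the diagonal. The entry of P grows to at most Nη/B = 2η/c, which 4Bη ≤ c²
  -- again bounds by c/(2B).
  set N := 2 * B / c with hN
  have hN0 : 0 < N := by positivity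
  set j : ℝ × ℝ → ℝ × ℝ := fun x => (x.1, N⁻¹ * x.2)
  set J : (ℝ × ℝ) →L[ℝ] (ℝ × ℝ) :=
    (ContinuousLinearMap.fst ℝ ℝ ℝ).prod (N⁻¹ • ContinuousLinearMap.snd ℝ ℝ ℝ)
  have hj : ∀ x, HasFDerivAt j J x := fun x => J.hasFDerivAt
  set g : ℝ × ℝ → ℝ × ℝ → ℝ × ℝ := fun y x =>
    (x.1 - B⁻¹ * (v (j x) - y.1), x.2 - B⁻¹ * N * (w (j x) - y.2))
  set k : NNReal := ⟨1 - c / (2 * B), by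
    rw [sub_nonneg, div_le_one (by positivity)]; linarith⟩
  have hk : k < 1 := by
    rw [← NNReal.coe_lt_coe]
    change 1 - c / (2 * B) < 1
    have : 0 < c / (2 * B) := by positivity
    linarith
  have hg : ∀ y, ContractingWith k (g y) := fun y => by
    refine ⟨hk, LipschitzWith.of_dist_le_mul fun x x' => ?_⟩
    rw [dist_eq_norm, dist_eq_norm]
    have hd : ∀ x, HasFDerivAt (g y)
        (((ContinuousLinearMap.fst ℝ ℝ ℝ) - B⁻¹ • ((lin (V (j x)) (Q (j x))).comp J)).prod
          ((ContinuousLinearMap.snd ℝ ℝ ℝ) - (B⁻¹ * N) • ((lin (P (j x)) (W (j x))).comp J)))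
        x := fun x => by
      have h1 := (((hv (j x)).comp x (hj x)).sub_const y.1).const_mul B⁻¹
      have h2 := (((hw (j x)).comp x (hj x)).sub_const y.2).const_mul (B⁻¹ * N)
      exact (hasFDerivAt_fst.sub h1).prodMk (hasFDerivAt_snd.sub h2)
    refine convex_univ.norm_image_sub_le_of_norm_hasFDerivWithin_le
      (fun x _ => (hd x).hasFDerivWithinAt) (fun x _ => ?_) (mem_univ x') (mem_univ x)
    refine ContinuousLinearMap.opNorm_le_bound _ k.2 fun ξ => ?_
    change _ ≤ (1 - c / (2 * B)) * ‖ξ‖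
    have n1 : |ξ.1| ≤ ‖ξ‖ := norm_fst_le ξ
    have n2 : |ξ.2| ≤ ‖ξ‖ := norm_snd_le ξ
    generalize hq : j x = q
    have b1 := hV q
    have b2 := hVB q
    have b3 := hW q
    have b4 := hWB q
    have b5 := hQ q
    have b6 := hP q
    have Bi : 0 < B⁻¹ := by positivity
    have BB : B⁻¹ * B = 1 := inv_mul_cancel₀ hB.ne'
    have bound : ∀ {α β : ℝ}, |α| + |β| ≤ 1 - c / (2 * B) →
        |α * ξ.1 + β * ξ.2| ≤ (1 - c / (2 * B)) * ‖ξ‖ := fun {α β} h => by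
      have t := abs_add_le (α * ξ.1) (β * ξ.2)
      rw [abs_mul, abs_mul] at t
      have t1 := mul_le_mul_of_nonneg_left n1 (abs_nonneg α)
      have t2 := mul_le_mul_of_nonneg_left n2 (abs_nonneg β)
      have t3 := mul_le_mul_of_nonneg_right h (norm_nonneg ξ)
      linarith
    have hBc : c / (2 * B) = B⁻¹ * c / 2 := by field_simp
    rw [norm_prod_le_iff]
    constructor
    · have e : (1 - B⁻¹ * V q) * ξ.1 + (-(B⁻¹ * N⁻¹ * Q q)) * ξ.2 =
          ξ.1 - B⁻¹ * (V q * ξ.1 + Q q * (N⁻¹ * ξ.2)) := by ring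
      have := bound (α := 1 - B⁻¹ * V q) (β := -(B⁻¹ * N⁻¹ * Q q)) (by
        rw [abs_neg, abs_mul, abs_of_pos (by positivity : 0 < B⁻¹ * N⁻¹), abs_of_nonneg]
        · have h1 := mul_le_mul_of_nonneg_left b1 Bi.le
          have h2 := mul_le_mul_of_nonneg_left b5 (by positivity : 0 ≤ B⁻¹ * N⁻¹)
          have h3 : B⁻¹ * N⁻¹ * B = B⁻¹ * c / 2 := by rw [hN]; field_simp
          linarith
        · have h1 := mul_le_mul_of_nonneg_left b2 Bi.le
          linarith)
      rw [e] at this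
      exact this
    · have e : (-(B⁻¹ * N * P q)) * ξ.1 + (1 - B⁻¹ * W q) * ξ.2 =
          ξ.2 - B⁻¹ * N * (P q * ξ.1 + W q * (N⁻¹ * ξ.2)) := by field_simp; ring
      have := bound (α := -(B⁻¹ * N * P q)) (β := 1 - B⁻¹ * W q) (by
        rw [abs_neg, abs_mul, abs_of_pos (by positivity : 0 < B⁻¹ * N),
          abs_of_nonneg (a := 1 - B⁻¹ * W q)]
        · have h1 := mul_le_mul_of_nonneg_left b3 Bi.le
          have h2 := mul_le_mul_of_nonneg_left b6 (by positivity : 0 ≤ B⁻¹ * N)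
          have h3 : B⁻¹ * N * η ≤ B⁻¹ * c / 2 := by
            rw [hN]
            have : B⁻¹ * (2 * B / c) * η = B⁻¹ * (4 * B * η) / (2 * c) := by field_simp; ring
            rw [this, div_le_iff₀ (by positivity)]
            have := mul_le_mul_of_nonneg_left hη Bi.le
            linarith
          linarith
        · have h1 := mul_le_mul_of_nonneg_left b4 Bi.le
          linarith)
      rw [e] at this
      exact this
  have hfix : ∀ y x, Function.IsFixedPt (g y) x ↔ (v (j x), w (j x)) = y := fun y x => by
    have Bi : B⁻¹ ≠ 0 := by positivity
    have BN : B⁻¹ * N ≠ 0 := by positivity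
    simp only [Function.IsFixedPt, g, Prod.ext_iff, sub_eq_self, mul_eq_zero, Bi, BN,
      false_or, sub_eq_zero]
  have hjs : ∀ q, j (q.1, N * q.2) = q := fun q => by
    simp only [j]
    rw [inv_mul_cancel_left₀ hN0.ne']
  constructor
  · intro q q' h
    have h1 := (hg (v q, w q)).fixedPoint_unique' ((hfix _ (q.1, N * q.2)).2 (by rw [hjs]))
      ((hfix _ (q'.1, N * q'.2)).2 (by rw [hjs]; exact h.symm))
    rw [← hjs q, h1, hjs]
  · intro y
    exact ⟨j ((hg y).fixedPoint (g y)), (hfix y _).1 (hg y).fixedPoint_isFixedPt⟩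

theorem exists_diffeomorphism {Φ : ℝ × ℝ → ℝ × ℝ} (hΦ : ContDiff ℝ 1 Φ)
    (hbij : Function.Bijective Φ) {Φ' : ℝ × ℝ → ((ℝ × ℝ) ≃L[ℝ] (ℝ × ℝ))}
    (hd : ∀ p, HasFDerivAt Φ (Φ' p : (ℝ × ℝ) →L[ℝ] (ℝ × ℝ)) p) :
    ∃ Θ : ℝ × ℝ ≃ ℝ × ℝ, (∀ p, Θ p = Φ p) ∧ ContDiff ℝ 1 Θ.symm := by
  have hopen : IsOpenMap Φ := isOpenMap_of_hasStrictFDerivAt_equiv (f' := Φ') fun p => by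
    have := (hΦ.contDiffAt (x := p)).hasStrictFDerivAt' (hd p) (by norm_num)
    exact this
  let Θ := (Equiv.ofBijective Φ hbij).toHomeomorphOfContinuousOpen hΦ.continuous hopen
  exact ⟨Θ.toEquiv, fun p => rfl, Θ.contDiff_symm (f₀' := Φ') hd hΦ⟩

theorem continuous_comp_of_ctl {X : Type*} [TopologicalSpace X] {K δ : ℝ} {g : ℝ → ℝ}
    (hg : ∀ s t, |s| ≤ δ → |t| ≤ δ → Ctl K 1 |s - t| (g s) (g t)) {s : X → ℝ}
    (hs : Continuous s) (h : ∀ x, |s x| ≤ δ) : Continuous fun x => g (s x) := by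
  have h1 : ContinuousOn g (Icc (-δ) δ) := by
    refine (LipschitzOnWith.of_dist_le_mul (K := K.toNNReal) fun x hx y hy => ?_).continuousOn
    have h := hg x y (abs_le.2 hx) (abs_le.2 hy)
    have hK : 0 ≤ K := by simpa using (abs_nonneg _).trans h.1
    rw [Real.coe_toNNReal _ hK, Real.dist_eq, Real.dist_eq]
    simpa using h.2.2
  exact h1.comp_continuous hs fun x => abs_le.1 (h x)

/-- An invertible linear map of the plane given by its coefficients. -/
def linEquiv (a b c d : ℝ) (h : a * d - b * c ≠ 0) : (ℝ × ℝ) ≃L[ℝ] (ℝ × ℝ) :=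
  ContinuousLinearEquiv.equivOfInverse ((lin a b).prod (lin c d))
    ((lin (d * (a * d - b * c)⁻¹) (-b * (a * d - b * c)⁻¹)).prod
      (lin (-c * (a * d - b * c)⁻¹) (a * (a * d - b * c)⁻¹)))
    (fun x => by
      have hi := mul_inv_cancel₀ h
      simp only [ContinuousLinearMap.prod_apply, lin_apply]
      generalize (a * d - b * c)⁻¹ = i at hi
      ext
      · linear_combination x.1 * hi
      · linear_combination x.2 * hi)
    (fun x => by
      have hi := mul_inv_cancel₀ h
      simp only [ContinuousLinearMap.prod_apply, lin_apply]
      generalize (a * d - b * c)⁻¹ = i at hi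
      ext
      · linear_combination x.1 * hi
      · linear_combination x.2 * hi)

/-- The passage from `(t + x, t - x)` to `(t, x)`. -/
def rotate : ℝ × ℝ ≃ ℝ × ℝ where
  toFun p := ((p.1 + p.2) / 2, (p.1 - p.2) / 2)
  invFun p := (p.1 + p.2, p.1 - p.2)
  left_inv p := by ext <;> simp <;> ring
  right_inv p := by ext <;> simp

/-! ### The hodograph system -/

/-- Riemann invariants `R(u)` and `S(ubar)`, as functions of the null coordinates: `R` is small of
size `θ`, and `κ` bounds from below the timelike character of the initial line. -/
structure RiemannData {δ K : ℝ} (c : Profile δ K) (ω : ℝ → ℝ) (B θ κ : ℝ) where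
  R : ℝ → ℝ
  R' : ℝ → ℝ
  S : ℝ → ℝ
  S' : ℝ → ℝ
  hasDerivAt_R : ∀ u, HasDerivAt R (R' u) u
  hasDerivAt_S : ∀ b, HasDerivAt S (S' b) b
  continuous_R' : Continuous R'
  continuous_S' : Continuous S'
  abs_R_le : ∀ u, |R u| ≤ θ * ω u
  abs_R'_le : ∀ u, |R' u| ≤ θ * ω u
  abs_S_le : ∀ b, |S b| ≤ B * ω b
  abs_S'_le : ∀ b, |S' b| ≤ B * ω b
  abs_mul_le : ∀ u b, |R u * S b| ≤ δ
  le_one_sub : ∀ u b, κ ≤ 1 - S b * S b * c.q (R u * S b)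

/-- The standing assumptions on the weight and on the constants. The constant `θ`, which measures
the distance to a simple wave, is small in terms of the others. -/
structure Setting (K B I κ θ : ℝ) (ω : ℝ → ℝ) : Prop where
  continuous_weight : Continuous ω
  weight_pos : ∀ s, 0 < ω s
  weight_le_one : ∀ s, ω s ≤ 1
  abs_integral_le : ∀ a b, |∫ s in a..b, ω s| ≤ I
  one_le_K : 1 ≤ K
  one_le_B : 1 ≤ B
  κ_pos : 0 < κ
  θ_nonneg : 0 ≤ θ
  θ_le_one : θ ≤ 1
  -- In the smallness conditions 2 B³ K² θ bounds the coefficients of the hodograph system and 4 (1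
  -- + B² K) bounds its solution. In turn they give the contraction, the drift of V and W from their
  -- data, the smallness of R² q, and diagonal dominance.
  small_integral : 2 * B ^ 3 * K ^ 2 * θ * I ≤ 1 / 8
  small_drift : 2 * (2 * B ^ 3 * K ^ 2 * θ * (4 * (1 + B ^ 2 * K))) * I ≤ min (κ / 2) (1 / 4)
  small_K : θ * K ≤ 1 / 4
  small_bij : 4 * (B ^ 2 * K * (4 * (1 + B ^ 2 * K))) * (θ * K * (4 * (1 + B ^ 2 * K))) ≤
    min (κ / 2) (1 / 2) ^ 2

namespace RiemannData

variable {δ K B θ κ I : ℝ} {c : Profile δ K} {ω : ℝ → ℝ}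

section Basic

variable (D : RiemannData c ω B θ κ)

/-- The product of the Riemann invariants. -/
def τ (p : ℝ × ℝ) : ℝ := D.R p.1 * D.S p.2

/-- `q(τ)` on the null plane. -/
def qτ (p : ℝ × ℝ) : ℝ := c.q (D.τ p)

/-- `e(τ)` on the null plane. -/
def eτ (p : ℝ × ℝ) : ℝ := c.e (D.τ p)

/-- The inverse of `1 - q² τ²` on the null plane. -/
def Δi (p : ℝ × ℝ) : ℝ := (1 - D.qτ p * D.τ p * (D.qτ p * D.τ p))⁻¹

/-- The system for `V = ∂_u v` and `W = ∂_b w`, where `v = t + x`, `w = t - x`. -/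
def coeffs : Coeffs where
  -- The mixed derivatives give ∂_b V = -∂_u(S² q W) and ∂_u W = -∂_b(R² q V). Each right side
  -- contains the other left side; eliminating it produces `Δi`. The leading factor of every
  -- coefficient is the one that carries the weight.
  a p := -(D.S p.2 * (D.S p.2 * D.S p.2 * D.R' p.1 * c.q' (D.τ p) * D.Δi p))
  b p := D.S p.2 *
    (D.R p.1 * D.R p.1 * D.R p.1 * D.S p.2 * D.S' p.2 * D.qτ p * c.q' (D.τ p) * D.Δi p)
  c p := -(D.R p.1 * (D.R p.1 * D.R p.1 * D.S' p.2 * c.q' (D.τ p) * D.Δi p))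
  d p := D.R p.1 *
    (D.S p.2 * D.S p.2 * D.S p.2 * D.R p.1 * D.R' p.1 * D.qτ p * c.q' (D.τ p) * D.Δi p)
  -- The conditions v(u, -u) = u and w(u, -u) = -u amount to V + S² q W = 1 and W + R² q V = 1 on
  -- the antidiagonal, solved here for V and W.
  V₀ u := (1 - D.S (-u) * D.S (-u) * D.qτ (u, -u)) * D.Δi (u, -u)
  W₀ b := (1 - D.R (-b) * D.R (-b) * D.qτ (-b, b)) * D.Δi (-b, b)

theorem continuous_R : Continuous D.R :=
  continuous_iff_continuousAt.2 fun u => (D.hasDerivAt_R u).continuousAt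

theorem continuous_S : Continuous D.S :=
  continuous_iff_continuousAt.2 fun u => (D.hasDerivAt_S u).continuousAt

theorem abs_τ_le (p : ℝ × ℝ) : |D.τ p| ≤ δ := D.abs_mul_le p.1 p.2

theorem continuous_τ : Continuous D.τ :=
  (D.continuous_R.comp continuous_fst).mul (D.continuous_S.comp continuous_snd)

theorem continuous_comp_τ {g : ℝ → ℝ}
    (hg : ∀ s t, |s| ≤ δ → |t| ≤ δ → Ctl K 1 |s - t| (g s) (g t)) :
    Continuous fun p => g (D.τ p) :=
  continuous_comp_of_ctl hg D.continuous_τ D.abs_τ_le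

theorem continuous_qτ : Continuous D.qτ := D.continuous_comp_τ c.ctl_q

theorem continuous_q'τ : Continuous fun p => c.q' (D.τ p) := D.continuous_comp_τ c.ctl_q'

theorem continuous_eτ : Continuous D.eτ := D.continuous_comp_τ c.ctl_e

theorem abs_qτ_mul_le (p : ℝ × ℝ) : |D.qτ p * D.τ p| ≤ 1 / 2 :=
  c.abs_q_mul_le _ (D.abs_τ_le p)

theorem denom_bounds (p : ℝ × ℝ) :
    1 / 2 ≤ 1 - D.qτ p * D.τ p * (D.qτ p * D.τ p) ∧
      1 - D.qτ p * D.τ p * (D.qτ p * D.τ p) ≤ 1 := by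
  have h := abs_le.1 (D.abs_qτ_mul_le p)
  constructor <;> nlinarith

theorem one_add_pos (p : ℝ × ℝ) : 0 < 1 + D.qτ p * D.τ p := by
  have h := abs_le.1 (D.abs_qτ_mul_le p)
  linarith

theorem one_sub_pos (p : ℝ × ℝ) : 0 < 1 - D.qτ p * D.τ p := by
  have h := abs_le.1 (D.abs_qτ_mul_le p)
  linarith

theorem Δi_mul (p : ℝ × ℝ) : D.Δi p * (1 - D.qτ p * D.τ p * (D.qτ p * D.τ p)) = 1 :=
  inv_mul_cancel₀ (by linarith [(D.denom_bounds p).1])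

theorem one_le_Δi (p : ℝ × ℝ) : 1 ≤ D.Δi p :=
  (one_le_inv₀ (by linarith [(D.denom_bounds p).1])).2 (D.denom_bounds p).2

theorem Δi_le (p : ℝ × ℝ) : D.Δi p ≤ 2 := by
  have := inv_anti₀ (by norm_num) (D.denom_bounds p).1
  rw [Δi]
  norm_num at this ⊢
  exact this

theorem continuous_Δi : Continuous D.Δi := by
  have := D.continuous_qτ
  have := D.continuous_τ
  refine Continuous.inv₀ (by fun_prop) fun p => ?_
  linarith [(D.denom_bounds p).1]

theorem hasDerivAt_comp_τ_fst {g g' : ℝ → ℝ} (hg : ∀ t, |t| ≤ δ → HasDerivAt g (g' t) t)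
    (u b : ℝ) : HasDerivAt (fun s => g (D.τ (s, b))) (g' (D.τ (u, b)) * (D.R' u * D.S b)) u :=
  (hg _ (D.abs_τ_le (u, b))).comp u ((D.hasDerivAt_R u).mul_const (D.S b))

theorem hasDerivAt_comp_τ_snd {g g' : ℝ → ℝ} (hg : ∀ t, |t| ≤ δ → HasDerivAt g (g' t) t)
    (u b : ℝ) : HasDerivAt (fun s => g (D.τ (u, s))) (g' (D.τ (u, b)) * (D.R u * D.S' b)) b :=
  (hg _ (D.abs_τ_le (u, b))).comp b ((D.hasDerivAt_S b).const_mul (D.R u))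

theorem abs_qτ_le (p : ℝ × ℝ) : |D.qτ p| ≤ K := by
  have h := (c.ctl_q _ _ (D.abs_τ_le p) (D.abs_τ_le p)).1
  rwa [mul_one] at h

theorem abs_q'τ_le (p : ℝ × ℝ) : |c.q' (D.τ p)| ≤ K := by
  have h := (c.ctl_q' _ _ (D.abs_τ_le p) (D.abs_τ_le p)).1
  rwa [mul_one] at h

theorem abs_Δi_le (p : ℝ × ℝ) : |D.Δi p| ≤ 2 := by
  rw [abs_of_nonneg (by linarith [D.one_le_Δi p])]
  exact D.Δi_le p

end Basic

section Bounds

variable (D : RiemannData c ω B θ κ) (h : Setting K B I κ θ ω)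
include D h

theorem abs_R_le' (u : ℝ) : |D.R u| ≤ θ :=
  (D.abs_R_le u).trans (mul_le_of_le_one_right h.θ_nonneg (h.weight_le_one u))

theorem abs_R'_le' (u : ℝ) : |D.R' u| ≤ θ :=
  (D.abs_R'_le u).trans (mul_le_of_le_one_right h.θ_nonneg (h.weight_le_one u))

theorem abs_S_le' (b : ℝ) : |D.S b| ≤ B :=
  (D.abs_S_le b).trans (mul_le_of_le_one_right (by linarith [h.one_le_B]) (h.weight_le_one b))

theorem abs_S'_le' (b : ℝ) : |D.S' b| ≤ B :=
  (D.abs_S'_le b).trans (mul_le_of_le_one_right (by linarith [h.one_le_B]) (h.weight_le_one b))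

/-- Each coefficient contains one factor decaying in the variable of integration, namely S(b) for a
and b, R(u) for c and d, and at least one factor R or R', which supplies θ. -/
theorem bounded_coeffs :
    D.coeffs.Bounded ω (2 * B ^ 3 * K ^ 2 * θ) (2 * (1 + B ^ 2 * K)) := by
  have cR := D.continuous_R
  have cS := D.continuous_S
  have cR' := D.continuous_R'
  have cS' := D.continuous_S'
  have cq := D.continuous_qτ
  have cq' := D.continuous_q'τ
  have cΔ := D.continuous_Δi
  have hB1 := h.one_le_B
  have hK1 := h.one_le_K
  have hθ0 := h.θ_nonneg
  have hθ1 := h.θ_le_one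
  have hB0 : 0 < B := by linarith
  have hK0 : 0 < K := by linarith
  have hKK : K ≤ K ^ 2 := by nlinarith
  have hBB : B ≤ B ^ 3 := by
    have : 1 ≤ B ^ 2 := one_le_pow₀ hB1
    nlinarith
  have one_R : ∀ u, |D.R u| ≤ 1 := fun u => (D.abs_R_le' h u).trans hθ1
  have one_R' : ∀ u, |D.R' u| ≤ 1 := fun u => (D.abs_R'_le' h u).trans hθ1
  have hw := h.weight_pos
  constructor
  · simp only [coeffs]; fun_prop
  · simp only [coeffs]; fun_prop
  · simp only [coeffs]; fun_prop
  · simp only [coeffs]; fun_prop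
  · simp only [coeffs]; fun_prop
  · simp only [coeffs]; fun_prop
  · intro p
    have := hw p.2
    have b1 := D.abs_S_le p.2
    have b2 := D.abs_S_le' h p.2
    have b3 := D.abs_R'_le' h p.1
    have b4 := D.abs_q'τ_le p
    have b5 := D.abs_Δi_le p
    simp only [coeffs, abs_neg, abs_mul]
    calc _ ≤ B * ω p.2 * (B * B * θ * K * 2) := by gcongr
      _ = 2 * B ^ 3 * K * θ * ω p.2 := by ring
      _ ≤ _ := by gcongr
  · intro p
    have := hw p.2
    have b1 := D.abs_S_le p.2
    have b2 := D.abs_S_le' h p.2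
    have b3 := D.abs_R_le' h p.1
    have b3' := one_R p.1
    have b4 := D.abs_q'τ_le p
    have b5 := D.abs_Δi_le p
    have b6 := D.abs_S'_le' h p.2
    have b7 := D.abs_qτ_le p
    simp only [coeffs, abs_mul]
    calc _ ≤ B * ω p.2 * (θ * 1 * 1 * B * B * K * K * 2) := by gcongr
      _ = _ := by ring
  · intro p
    have := hw p.1
    have b1 := D.abs_R_le p.1
    have b2 := one_R p.1
    have b3 := D.abs_S'_le' h p.2
    have b4 := D.abs_q'τ_le p
    have b5 := D.abs_Δi_le p
    simp only [coeffs, abs_neg, abs_mul]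
    calc _ ≤ θ * ω p.1 * (1 * 1 * B * K * 2) := by gcongr
      _ = 2 * B * K * θ * ω p.1 := by ring
      _ ≤ _ := by gcongr
  · intro p
    have := hw p.1
    have b1 := D.abs_R_le p.1
    have b2 := D.abs_S_le' h p.2
    have b3 := one_R p.1
    have b3' := one_R' p.1
    have b4 := D.abs_q'τ_le p
    have b5 := D.abs_Δi_le p
    have b7 := D.abs_qτ_le p
    simp only [coeffs, abs_mul]
    calc _ ≤ θ * ω p.1 * (B * B * B * 1 * 1 * K * K * 2) := by gcongr
      _ = _ := by ring
  · intro u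
    have b2 := D.abs_S_le' h (-u)
    have b5 := D.abs_Δi_le (u, -u)
    have b7 := D.abs_qτ_le (u, -u)
    have t := abs_sub (1 : ℝ) (D.S (-u) * D.S (-u) * D.qτ (u, -u))
    have t2 : |D.S (-u) * D.S (-u) * D.qτ (u, -u)| ≤ B * B * K := by
      rw [abs_mul, abs_mul]; gcongr
    rw [abs_one] at t
    simp only [coeffs]
    rw [abs_mul]
    calc _ ≤ (1 + B * B * K) * 2 := by gcongr; linarith
      _ = _ := by ring
  · intro b
    have b2 := one_R (-b)
    have b5 := D.abs_Δi_le (-b, b)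
    have b7 := D.abs_qτ_le (-b, b)
    have t := abs_sub (1 : ℝ) (D.R (-b) * D.R (-b) * D.qτ (-b, b))
    have t2 : |D.R (-b) * D.R (-b) * D.qτ (-b, b)| ≤ B * B * K := by
      rw [abs_mul, abs_mul]
      have b3 := b2.trans hB1
      gcongr
    rw [abs_one] at t
    simp only [coeffs]
    rw [abs_mul]
    calc _ ≤ (1 + B * B * K) * 2 := by gcongr; linarith
      _ = _ := by ring

theorem abs_RRq_le (p : ℝ × ℝ) : |D.R p.1 * D.R p.1 * D.qτ p| ≤ θ * K := by
  have b2 := D.abs_R_le' h p.1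
  have b3 := b2.trans h.θ_le_one
  have b7 := D.abs_qτ_le p
  have := h.θ_nonneg
  rw [abs_mul, abs_mul]
  calc _ ≤ θ * 1 * K := by gcongr
    _ = _ := by ring

theorem abs_SSq_le (p : ℝ × ℝ) : |D.S p.2 * D.S p.2 * D.qτ p| ≤ B ^ 2 * K := by
  have b2 := D.abs_S_le' h p.2
  have b7 := D.abs_qτ_le p
  have := h.one_le_B
  rw [abs_mul, abs_mul]
  calc _ ≤ B * B * K := by gcongr
    _ = _ := by ring

/-- This is where the nondegeneracy of the initial line, κ ≤ 1 - S² q, enters; `Δi` ≥ 1 does no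
harm. -/
theorem le_V₀ (u : ℝ) : κ ≤ D.coeffs.V₀ u := by
  have h1 := D.le_one_sub u (-u)
  have h2 := D.one_le_Δi (u, -u)
  have h3 := h.κ_pos
  change κ ≤ (1 - D.S (-u) * D.S (-u) * c.q (D.R u * D.S (-u))) * D.Δi (u, -u)
  nlinarith

theorem le_W₀ (b : ℝ) : 3 / 4 ≤ D.coeffs.W₀ b := by
  have h1 := (abs_le.1 (D.abs_RRq_le h (-b, b))).2
  have h2 := D.one_le_Δi (-b, b)
  have h3 := h.small_K
  simp only [coeffs] at h1 ⊢
  nlinarith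

end Bounds

/-- A solution of the wave equation in null coordinates: the derivatives `V = ∂_u (t + x)` and
`W = ∂_b (t - x)`, the coordinates `v = t + x` and `w = t - x`, and the solution `A` itself, which
equals `g` on the initial line, as functions of the null coordinates `(u, b)`. -/
structure NullSolution (D : RiemannData c ω B θ κ) (g : ℝ → ℝ) where
  X : BoundedContinuousFunction (ℝ × ℝ) (ℝ × ℝ)
  v : ℝ × ℝ → ℝ
  w : ℝ × ℝ → ℝ
  A : ℝ × ℝ → ℝ
  Θ : ℝ × ℝ ≃ ℝ × ℝ
  eq_step : ∀ p, X p = D.coeffs.step X p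
  V_pos : ∀ p, 0 < (X p).1
  W_pos : ∀ p, 0 < (X p).2
  hasFDerivAt_v : ∀ p, HasFDerivAt v (lin (X p).1 (-(D.S p.2 * D.S p.2 * D.qτ p * (X p).2))) p
  hasFDerivAt_w : ∀ p, HasFDerivAt w (lin (-(D.R p.1 * D.R p.1 * D.qτ p * (X p).1)) (X p).2) p
  hasFDerivAt_A : ∀ p, HasFDerivAt A
    (lin (1 / 2 * (D.R p.1 * D.eτ p * (1 - D.qτ p * D.τ p) * (X p).1))
      (1 / 2 * (D.S p.2 * D.eτ p * (1 - D.qτ p * D.τ p) * (X p).2))) p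
  v_antidiagonal : ∀ u, v (u, -u) = u
  w_antidiagonal : ∀ u, w (u, -u) = -u
  A_antidiagonal : ∀ u, A (u, -u) = g u
  Θ_apply : ∀ p, Θ p = ((v p + w p) / 2, (v p - w p) / 2)
  contDiff_Θ : ContDiff ℝ 1 Θ
  contDiff_Θ_symm : ContDiff ℝ 1 Θ.symm

section Existence

variable (D : RiemannData c ω B θ κ) (h : Setting K B I κ θ ω)
  {X : BoundedContinuousFunction (ℝ × ℝ) (ℝ × ℝ)} (hX : ∀ p, X p = D.coeffs.step X p)
include h hX

theorem norm_solution_le : ‖X‖ ≤ 4 * (1 + B ^ 2 * K) := by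
  have hB := h.one_le_B
  have hK := h.one_le_K
  have hθ := h.θ_nonneg
  have := Coeffs.norm_solution_le h.continuous_weight (fun s => (h.weight_pos s).le)
    h.abs_integral_le (by positivity) h.small_integral (D.bounded_coeffs h) hX
  linarith

theorem abs_V_le (p : ℝ × ℝ) : |(X p).1| ≤ 4 * (1 + B ^ 2 * K) :=
  (norm_fst_le _).trans ((X.norm_coe_le_norm p).trans (D.norm_solution_le h hX))

theorem abs_W_le (p : ℝ × ℝ) : |(X p).2| ≤ 4 * (1 + B ^ 2 * K) :=
  (norm_snd_le _).trans ((X.norm_coe_le_norm p).trans (D.norm_solution_le h hX))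

theorem norm_sub_data_le (p : ℝ × ℝ) :
    ‖X p - (D.coeffs.V₀ p.1, D.coeffs.W₀ p.2)‖ ≤ min (κ / 2) (1 / 4) := by
  have hB := h.one_le_B
  have hK := h.one_le_K
  have hθ := h.θ_nonneg
  have hI : 0 ≤ I := (abs_nonneg _).trans (h.abs_integral_le 0 0)
  have := Coeffs.norm_solution_sub_data_le h.continuous_weight (fun s => (h.weight_pos s).le)
    h.abs_integral_le (by positivity) (D.bounded_coeffs h) hX p
  refine this.trans (le_trans ?_ h.small_drift)
  have := D.norm_solution_le h hX
  gcongr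

theorem le_V (p : ℝ × ℝ) : κ / 2 ≤ (X p).1 := by
  have h1 := (norm_fst_le _).trans ((D.norm_sub_data_le h hX p).trans (min_le_left _ _))
  have h2 := D.le_V₀ h p.1
  have := (abs_le.1 h1).1
  simp only [Prod.fst_sub] at this
  linarith

theorem le_W (p : ℝ × ℝ) : 1 / 2 ≤ (X p).2 := by
  have h1 := (norm_snd_le _).trans ((D.norm_sub_data_le h hX p).trans (min_le_right _ _))
  have h2 := D.le_W₀ h p.2
  have := (abs_le.1 h1).1
  simp only [Prod.snd_sub] at this
  linarith

/-- The one-forms dv, dw and dA are closed and compatible with the prescribed values on the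
antidiagonal, so `exists_primitive` integrates them; a diagonally dominant differential then makes
(v, w) a diffeomorphism. The formula for g' is the initial relation ∂_x φ = ½ (Ψ - Ψbar). -/
theorem nonempty_nullSolution_of_eq_step {g g' : ℝ → ℝ} (hg : ∀ u, HasDerivAt g (g' u) u)
    (hg' : ∀ u, g' u = 1 / 2 * (D.eτ (u, -u) * (D.R u - D.S (-u)))) :
    Nonempty (D.NullSolution g) := by
  have cR := D.continuous_R
  have cS := D.continuous_S
  have cR' := D.continuous_R'
  have cS' := D.continuous_S'
  have cq := D.continuous_qτ
  have cq' := D.continuous_q'τ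
  have cΔ := D.continuous_Δi
  have ce := D.continuous_eτ
  have ct := D.continuous_τ
  have hbd := D.bounded_coeffs h
  have ca := hbd.continuous_a
  have cb := hbd.continuous_b
  have cc := hbd.continuous_c
  have cd := hbd.continuous_d
  have dV := Coeffs.hasDerivAt_solution_fst hbd hX
  have dW := Coeffs.hasDerivAt_solution_snd hbd hX
  have dq1 : ∀ u b, HasDerivAt (fun s => D.qτ (s, b)) _ u :=
    D.hasDerivAt_comp_τ_fst c.hasDerivAt_q
  have dq2 : ∀ u b, HasDerivAt (fun s => D.qτ (u, s)) _ b :=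
    D.hasDerivAt_comp_τ_snd c.hasDerivAt_q
  have de1 : ∀ u b, HasDerivAt (fun s => D.eτ (s, b)) _ u :=
    D.hasDerivAt_comp_τ_fst c.hasDerivAt_e
  have de2 : ∀ u b, HasDerivAt (fun s => D.eτ (u, s)) _ b :=
    D.hasDerivAt_comp_τ_snd c.hasDerivAt_e
  have dt1 : ∀ u b, HasDerivAt (fun s => D.τ (s, b)) (D.R' u * D.S b) u := fun u b =>
    (D.hasDerivAt_R u).mul_const (D.S b)
  have dt2 : ∀ u b, HasDerivAt (fun s => D.τ (u, s)) (D.R u * D.S' b) b := fun u b =>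
    (D.hasDerivAt_S b).const_mul (D.R u)
  have XV : ∀ u, (X (u, -u)).1 = D.coeffs.V₀ u := fun u => by
    rw [hX]; simp [Coeffs.step]
  have XW : ∀ u, (X (u, -u)).2 = D.coeffs.W₀ (-u) := fun u => by
    rw [hX]; simp [Coeffs.step]
  -- Closedness of dv = V du - S² q W db is the first equation of the system with the elimination
  -- undone, hence the use of `Δi_mul`.
  obtain ⟨v, hv, hv0⟩ := exists_primitive (P := fun p => (X p).1)
    (Q := fun p => -(D.S p.2 * D.S p.2 * D.qτ p * (X p).2))
    (m := fun p => D.coeffs.a p * (X p).2 + D.coeffs.b p * (X p).1)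
    (g := fun u => u) (g' := fun _ => 1) (by fun_prop) (by fun_prop) (by fun_prop)
    dV (fun u b => by
      refine ((((dq1 u b).const_mul (D.S b * D.S b)).mul (dW u b)).neg).congr_deriv ?_
      have hi := D.Δi_mul (u, b)
      simp only [coeffs, qτ, τ] at hi ⊢
      linear_combination (D.S b ^ 3 * D.R' u * c.q' (D.R u * D.S b) * (X (u, b)).2) * hi)
    (fun u => hasDerivAt_id' u) (fun u => by
      have hi := D.Δi_mul (u, -u)
      simp only [XV, XW, coeffs, neg_neg]
      simp only [τ] at hi
      linear_combination hi)
  obtain ⟨w, hw, hw0⟩ := exists_primitive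
    (P := fun p => -(D.R p.1 * D.R p.1 * D.qτ p * (X p).1)) (Q := fun p => (X p).2)
    (m := fun p => D.coeffs.c p * (X p).1 + D.coeffs.d p * (X p).2)
    (g := fun u => -u) (g' := fun _ => -1) (by fun_prop) (by fun_prop) (by fun_prop)
    (fun u b => by
      refine ((((dq2 u b).const_mul (D.R u * D.R u)).mul (dV u b)).neg).congr_deriv ?_
      have hi := D.Δi_mul (u, b)
      simp only [coeffs, qτ, τ] at hi ⊢
      linear_combination (D.R u ^ 3 * D.S' b * c.q' (D.R u * D.S b) * (X (u, b)).1) * hi)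
    dW (fun u => hasDerivAt_neg u) (fun u => by
      have hi := D.Δi_mul (u, -u)
      simp only [XV, XW, coeffs, neg_neg]
      simp only [τ] at hi
      linear_combination -hi)
  -- The coefficients are V/2 (Ψ - R² q Ψbar) and W/2 (Ψbar - S² q Ψ) with Ψ = R e and Ψbar = S e.
  -- Closedness rests on the differential equation e' (1 - qτ) = q e.
  obtain ⟨A, hA, hA0⟩ := exists_primitive
    (P := fun p => 1 / 2 * (D.R p.1 * D.eτ p * (1 - D.qτ p * D.τ p) * (X p).1))
    (Q := fun p => 1 / 2 * (D.S p.2 * D.eτ p * (1 - D.qτ p * D.τ p) * (X p).2))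
    (m := fun p => 1 / 2 * (D.R p.1 * (-(D.eτ p * c.q' (D.τ p) * D.τ p) *
      (D.R p.1 * D.S' p.2) * (X p).1 + D.eτ p * (1 - D.qτ p * D.τ p) *
        (D.coeffs.a p * (X p).2 + D.coeffs.b p * (X p).1))))
    (g := g) (g' := g') (by fun_prop) (by fun_prop) (by fun_prop)
    (fun u b => by
      have hd := ((((de2 u b).const_mul (D.R u)).mul
        (((dq2 u b).mul (dt2 u b)).const_sub 1)).mul (dV u b)).const_mul (1 / 2)
      refine hd.congr_deriv ?_
      have h1 := div_mul_cancel₀ (c.q (D.τ (u, b)) * c.e (D.τ (u, b)))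
        (D.one_sub_pos (u, b)).ne'
      simp only [Pi.mul_apply, qτ, τ, eτ] at h1 ⊢
      linear_combination (1 / 2 * D.R u * D.R u * D.S' b * (X (u, b)).1) * h1)
    (fun u b => by
      have hd := ((((de1 u b).const_mul (D.S b)).mul
        (((dq1 u b).mul (dt1 u b)).const_sub 1)).mul (dW u b)).const_mul (1 / 2)
      refine hd.congr_deriv ?_
      have h1 := div_mul_cancel₀ (c.q (D.τ (u, b)) * c.e (D.τ (u, b)))
        (D.one_sub_pos (u, b)).ne'
      have hi := D.Δi_mul (u, b)
      simp only [Pi.mul_apply, qτ, τ, eτ, coeffs] at h1 hi ⊢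
      linear_combination (1 / 2 * D.S b ^ 2 * D.R' u * (X (u, b)).2) * h1 +
        (1 / 2 * c.e (D.R u * D.S b) * c.q' (D.R u * D.S b) * (D.R u * D.S b) *
          (D.S b ^ 2 * D.R' u * (X (u, b)).2 - D.R u ^ 2 * D.S' b * (X (u, b)).1)) * hi)
    hg (fun u => by
      have hi := D.Δi_mul (u, -u)
      rw [hg']
      simp only [XV, XW, coeffs, neg_neg]
      simp only [τ] at hi ⊢
      linear_combination (1 / 2 * D.eτ (u, -u) * (D.R u - D.S (-u))) * hi)
  have hV := D.le_V h hX
  have hW := D.le_W h hX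
  have hκ := h.κ_pos
  have hB := h.one_le_B
  have hK := h.one_le_K
  have V_pos : ∀ p, 0 < (X p).1 := fun p => by linarith [hV p]
  have W_pos : ∀ p, 0 < (X p).2 := fun p => by linarith [hW p]
  have hBK : 1 ≤ B ^ 2 * K := one_le_mul_of_one_le_of_one_le (one_le_pow₀ hB) hK
  have hVN : ∀ p, (X p).1 ≤ B ^ 2 * K * (4 * (1 + B ^ 2 * K)) := fun p => by
    have := (le_abs_self _).trans (D.abs_V_le h hX p)
    nlinarith
  have hWN : ∀ p, (X p).2 ≤ B ^ 2 * K * (4 * (1 + B ^ 2 * K)) := fun p => by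
    have := (le_abs_self _).trans (D.abs_W_le h hX p)
    nlinarith
  have hbij := bijective_of_diagonally_dominant (c := min (κ / 2) (1 / 2))
    (B := B ^ 2 * K * (4 * (1 + B ^ 2 * K))) (η := θ * K * (4 * (1 + B ^ 2 * K)))
    (by positivity) (by have := min_le_right (κ / 2) (1 / 2); nlinarith) h.small_bij hv hw
    (fun p => (min_le_left _ _).trans (hV p)) hVN (fun p => (min_le_right _ _).trans (hW p)) hWN
    (fun p => by
      rw [abs_neg, abs_mul]
      exact mul_le_mul (D.abs_SSq_le h p) (D.abs_W_le h hX p) (abs_nonneg _) (by positivity))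
    (fun p => by
      have := h.θ_nonneg
      rw [abs_neg, abs_mul]
      exact mul_le_mul (D.abs_RRq_le h p) (D.abs_V_le h hX p) (abs_nonneg _) (by positivity))
  -- The Jacobian determinant factors as V W (1 - q² τ²), and |q τ| ≤ 1/2.
  have hdet : ∀ p, (X p).1 * (X p).2 - -(D.S p.2 * D.S p.2 * D.qτ p * (X p).2) *
      -(D.R p.1 * D.R p.1 * D.qτ p * (X p).1) ≠ 0 := fun p => by
    have h1 := (D.denom_bounds p).1
    have e : (X p).1 * (X p).2 - -(D.S p.2 * D.S p.2 * D.qτ p * (X p).2) *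
      -(D.R p.1 * D.R p.1 * D.qτ p * (X p).1) =
        (X p).1 * (X p).2 * (1 - D.qτ p * D.τ p * (D.qτ p * D.τ p)) := by
      simp only [τ]; ring
    rw [e]
    exact (mul_pos (mul_pos (V_pos p) (W_pos p)) (by linarith)).ne'
  have hvc : ContDiff ℝ 1 v := contDiff_one_of_lin (by fun_prop) (by fun_prop) hv
  have hwc : ContDiff ℝ 1 w := contDiff_one_of_lin (by fun_prop) (by fun_prop) hw
  obtain ⟨Θ, hΘ, hΘs⟩ := exists_diffeomorphism (hvc.prodMk hwc) hbij
    (Φ' := fun p => linEquiv _ _ _ _ (hdet p)) fun p => (hv p).prodMk (hw p)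
  have hΘc : ContDiff ℝ 1 Θ := by
    rw [show (Θ : ℝ × ℝ → ℝ × ℝ) = fun p => (v p, w p) from funext hΘ]
    exact hvc.prodMk hwc
  have hrot : ContDiff ℝ 1 rotate := by
    change ContDiff ℝ 1 fun p : ℝ × ℝ => ((p.1 + p.2) / 2, (p.1 - p.2) / 2)
    fun_prop
  have hrots : ContDiff ℝ 1 rotate.symm := by
    change ContDiff ℝ 1 fun p : ℝ × ℝ => (p.1 + p.2, p.1 - p.2)
    fun_prop
  exact ⟨{ X, v, w, A
           Θ := Θ.trans rotate
           eq_step := hX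
           V_pos, W_pos
           hasFDerivAt_v := hv
           hasFDerivAt_w := hw
           hasFDerivAt_A := hA
           v_antidiagonal := hv0
           w_antidiagonal := hw0
           A_antidiagonal := hA0
           Θ_apply := fun p => by
             rw [Equiv.trans_apply, hΘ]
             rfl
           contDiff_Θ := hrot.comp hΘc
           contDiff_Θ_symm := hΘs.comp hrots }⟩

end Existence

theorem nonempty_nullSolution (D : RiemannData c ω B θ κ) (h : Setting K B I κ θ ω)
    {g g' : ℝ → ℝ} (hg : ∀ u, HasDerivAt g (g' u) u)
    (hg' : ∀ u, g' u = 1 / 2 * (D.eτ (u, -u) * (D.R u - D.S (-u)))) :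
    Nonempty (D.NullSolution g) := by
  have hB := h.one_le_B
  have hK := h.one_le_K
  have hθ := h.θ_nonneg
  obtain ⟨X, hX⟩ := Coeffs.exists_solution h.continuous_weight (fun s => (h.weight_pos s).le)
    h.abs_integral_le (by positivity) h.small_integral (D.bounded_coeffs h)
  exact D.nonempty_nullSolution_of_eq_step h hX hg hg'

end RiemannData

/-! ### The wave equation and the eikonal equation in null frames -/

/-- The derivative along `L = ∂_t + ∂_x`. -/
def dL (F : ℝ × ℝ → ℝ) (p : ℝ × ℝ) : ℝ := fderiv ℝ F p (1, 1)

/-- The derivative along `Lbar = ∂_t - ∂_x`. -/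
def dLb (F : ℝ × ℝ → ℝ) (p : ℝ × ℝ) : ℝ := fderiv ℝ F p (1, -1)

theorem fderiv_apply_eq (F : ℝ × ℝ → ℝ) (p x : ℝ × ℝ) :
    fderiv ℝ F p x = (x.1 + x.2) / 2 * dL F p + (x.1 - x.2) / 2 * dLb F p := by
  have e : x = ((x.1 + x.2) / 2) • ((1 : ℝ), (1 : ℝ)) + ((x.1 - x.2) / 2) • ((1 : ℝ), (-1 : ℝ)) := by
    ext <;> simp <;> ring
  conv_lhs => rw [e]
  rw [map_add, map_smul, map_smul, smul_eq_mul, smul_eq_mul, dL, dLb]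

theorem pd_zero (F : ℝ × ℝ → ℝ) (p : ℝ × ℝ) : pd 0 F p = (dL F p + dLb F p) / 2 := by
  rw [pd, if_pos rfl, fderiv_apply_eq]; ring

theorem pd_one (F : ℝ × ℝ → ℝ) (p : ℝ × ℝ) : pd 1 F p = (dL F p - dLb F p) / 2 := by
  rw [pd, if_neg (by norm_num), fderiv_apply_eq]; ring

theorem psi_eq (φ : ℝ × ℝ → ℝ) (p : ℝ × ℝ) : Psi φ p = dL φ p := by
  rw [Psi, pd_zero, pd_one]; ring

theorem psibar_eq (φ : ℝ × ℝ → ℝ) (p : ℝ × ℝ) : Psibar φ p = dLb φ p := by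
  rw [Psibar, pd_zero, pd_one]; ring

theorem sigma_eq (φ : ℝ × ℝ → ℝ) (p : ℝ × ℝ) : sigma φ p = -(Psi φ p * Psibar φ p) := by
  rw [psi_eq, psibar_eq]
  simp [sigma, η, Fin.sum_univ_two, pd_zero, pd_one]
  ring

section

variable {φ : ℝ × ℝ → ℝ}

theorem contDiff_pd (hφ : ContDiff ℝ 2 φ) (μ : Fin 2) : ContDiff ℝ 1 (pd μ φ) :=
  (hφ.fderiv_right (m := 1) (by norm_num)).clm_apply contDiff_const

theorem contDiff_psi (hφ : ContDiff ℝ 2 φ) : ContDiff ℝ 1 (Psi φ) :=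
  (contDiff_pd hφ 0).add (contDiff_pd hφ 1)

theorem contDiff_psibar (hφ : ContDiff ℝ 2 φ) : ContDiff ℝ 1 (Psibar φ) :=
  (contDiff_pd hφ 0).sub (contDiff_pd hφ 1)

theorem dLb_psi (hφ : ContDiff ℝ 2 φ) (p : ℝ × ℝ) : dLb (Psi φ) p = dL (Psibar φ) p := by
  have h1 : DifferentiableAt ℝ (fderiv ℝ φ) p :=
    (hφ.fderiv_right (m := 1) (by norm_num)).differentiable (by norm_num) p
  have hs : IsSymmSndFDerivAt ℝ φ p := (hφ.contDiffAt (x := p)).isSymmSndFDerivAt (by simp)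
  have e1 : Psi φ = fun p => fderiv ℝ φ p (1, 1) := funext fun p => psi_eq φ p
  have e2 : Psibar φ = fun p => fderiv ℝ φ p (1, -1) := funext fun p => psibar_eq φ p
  have key : ∀ x y : ℝ × ℝ, fderiv ℝ (fun p => fderiv ℝ φ p x) p y =
      fderiv ℝ (fderiv ℝ φ) p y x := fun x y => by
    have := (h1.hasFDerivAt.clm_apply (hasFDerivAt_const x p)).fderiv
    rw [this]
    simp
  rw [dLb, dL, e1, e2, key, key]
  exact hs _ _

theorem pd_mul {F G : ℝ × ℝ → ℝ} {p : ℝ × ℝ} (hF : DifferentiableAt ℝ F p)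
    (hG : DifferentiableAt ℝ G p) (μ : Fin 2) :
    pd μ (fun q => F q * G q) p = F p * pd μ G p + pd μ F p * G p := by
  have := (hF.hasFDerivAt.mul hG.hasFDerivAt).fderiv
  simp only [pd]
  rw [show (fun q => F q * G q) = F * G from rfl, this]
  simp [mul_comm]

theorem pd_comp {g g' : ℝ → ℝ} {F : ℝ × ℝ → ℝ} {p : ℝ × ℝ} (hF : DifferentiableAt ℝ F p)
    (hg : ∀ s, HasDerivAt g (g' s) s) (μ : Fin 2) :
    pd μ (fun q => g (F q)) p = g' (F p) * pd μ F p := by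
  have := ((hg (F p)).comp_hasFDerivAt p hF.hasFDerivAt).fderiv
  simp only [pd]
  rw [show (fun q => g (F q)) = g ∘ F from rfl, this]
  simp

/-- In the null frame σ = -Ψ Ψbar, and `dLb (Psi φ) = dL (Psibar φ)` by symmetry of second
derivatives; only three second derivatives are left. -/
theorem waveOperator_eq {f : ℝ → ℝ} (hf : Differentiable ℝ f) (hφ : ContDiff ℝ 2 φ) (p : ℝ × ℝ) :
    ∑ μ, pd μ (fun q => ∑ ν, Real.exp (f (sigma φ q)) * η μ ν * pd ν φ q) p =
      Real.exp (f (sigma φ p)) *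
        (1 / 2 * deriv f (sigma φ p) * (Psibar φ p ^ 2 * dL (Psi φ) p +
          Psi φ p ^ 2 * dLb (Psibar φ) p) -
          (1 + deriv f (sigma φ p) * sigma φ p) * dL (Psibar φ) p) := by
  have d0 := (contDiff_psi hφ).differentiable (by norm_num) p
  have d1 := (contDiff_psibar hφ).differentiable (by norm_num) p
  have es : sigma φ = fun q => -1 * (Psi φ q * Psibar φ q) := funext fun q => by
    rw [sigma_eq]; ring
  have ds : DifferentiableAt ℝ (sigma φ) p := by
    rw [es]; exact (d0.mul d1).const_mul (-1)
  have dconst : ∀ k : ℝ, DifferentiableAt ℝ (fun _ : ℝ × ℝ => k) p := fun k =>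
    differentiableAt_const k
  have dE : DifferentiableAt ℝ (fun q => Real.exp (f (sigma φ q))) p :=
    ((hf _).comp p ds).exp
  have hE : ∀ s, HasDerivAt (fun s => Real.exp (f s)) (Real.exp (f s) * deriv f s) s :=
    fun s => (hf s).hasDerivAt.exp
  have pdc : ∀ (μ : Fin 2) (k : ℝ), pd μ (fun _ => k) p = 0 := fun μ k => by simp [pd]
  have p0 : (fun q => ∑ ν, Real.exp (f (sigma φ q)) * η 0 ν * pd ν φ q) =
      fun q => Real.exp (f (sigma φ q)) * (-1 / 2 * Psi φ q + -1 / 2 * Psibar φ q) := funext fun q => by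
    simp [η, Fin.sum_univ_two, psi_eq, psibar_eq, pd_zero]
    ring
  have p1 : (fun q => ∑ ν, Real.exp (f (sigma φ q)) * η 1 ν * pd ν φ q) =
      fun q => Real.exp (f (sigma φ q)) * (1 / 2 * Psi φ q + -1 / 2 * Psibar φ q) := funext fun q => by
    simp [η, Fin.sum_univ_two, psi_eq, psibar_eq, pd_one]
    ring
  have pa : ∀ (μ : Fin 2) (k l : ℝ), pd μ (fun q => k * Psi φ q + l * Psibar φ q) p =
      k * pd μ (Psi φ) p + l * pd μ (Psibar φ) p := fun μ k l => by
    have := ((d0.hasFDerivAt.const_mul k).add (d1.hasFDerivAt.const_mul l)).fderiv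
    simp only [pd]
    rw [show (fun q => k * Psi φ q + l * Psibar φ q) =
      (fun q => k * Psi φ q) + fun q => l * Psibar φ q from rfl, this]
    simp
  have psg : ∀ μ : Fin 2, pd μ (sigma φ) p =
      -(Psi φ p * pd μ (Psibar φ) p + pd μ (Psi φ) p * Psibar φ p) := fun μ => by
    rw [es, pd_mul (F := fun _ => -1) (G := fun q => Psi φ q * Psibar φ q) (dconst _) (d0.mul d1),
      pd_mul d0 d1, pdc]
    ring
  have dsum : ∀ k l : ℝ, DifferentiableAt ℝ (fun q => k * Psi φ q + l * Psibar φ q) p :=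
    fun k l => (d0.const_mul k).add (d1.const_mul l)
  rw [Fin.sum_univ_two, p0, p1, pd_mul dE (dsum _ _), pd_mul dE (dsum _ _), pa, pa,
    pd_comp ds hE, pd_comp ds hE, psg, psg]
  simp only [pd_zero, pd_one, dLb_psi hφ, sigma_eq φ p]
  ring

theorem waveEquation_iff {f : ℝ → ℝ} (hf : Differentiable ℝ f) (hφ : ContDiff ℝ 2 φ) :
    WaveEquation f φ ↔ ∀ p, (1 + deriv f (sigma φ p) * sigma φ p) * dL (Psibar φ) p =
      1 / 2 * deriv f (sigma φ p) * (Psibar φ p ^ 2 * dL (Psi φ) p +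
          Psi φ p ^ 2 * dLb (Psibar φ) p) := by
  unfold WaveEquation
  refine forall_congr' fun p => ?_
  rw [waveOperator_eq hf hφ, mul_eq_zero, sub_eq_zero]
  simp only [Real.exp_ne_zero, false_or]
  exact eq_comm

theorem eikonal_sum_eq (f : ℝ → ℝ) (φ w : ℝ × ℝ → ℝ) (p : ℝ × ℝ) :
    ∑ μ, ∑ ν, invMetric f φ p μ ν * pd μ w p * pd ν w p =
      1 / 2 * deriv f (sigma φ p) * (Psi φ p * dLb w p + Psibar φ p * dL w p) ^ 2 -
        dL w p * dLb w p := by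
  simp [invMetric, η, Fin.sum_univ_two, psi_eq, psibar_eq, pd_zero, pd_one]
  ring

end

/-! ### The constructed solution on the physical plane. -/

namespace RiemannData.NullSolution

variable {δ K B θ κ I : ℝ} {c : Profile δ K} {ω : ℝ → ℝ} {D : RiemannData c ω B θ κ} {g : ℝ → ℝ}

section

variable (N : D.NullSolution g)

/-- The solution on the physical plane. -/
def φ : ℝ × ℝ → ℝ := N.A ∘ N.Θ.symm

theorem Θ_antidiagonal (x : ℝ) : N.Θ (x, -x) = (0, x) := by
  rw [N.Θ_apply, N.v_antidiagonal, N.w_antidiagonal]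
  ext <;> simp

theorem Θ_symm_zero (x : ℝ) : N.Θ.symm (0, x) = (x, -x) := by
  rw [Equiv.symm_apply_eq, N.Θ_antidiagonal]

/-- The chain rule: ∂_u = V/2 (L - R² q Lbar) and ∂_b = W/2 (Lbar - S² q L). All statements on the
physical plane are translated through these two vector fields. -/
theorem hasFDerivAt_comp_Θ {F : ℝ × ℝ → ℝ} {q : ℝ × ℝ} (hF : DifferentiableAt ℝ F (N.Θ q)) :
    HasFDerivAt (fun q => F (N.Θ q))
      (lin (1 / 2 * (N.X q).1 * (dL F (N.Θ q) - D.R q.1 * D.R q.1 * D.qτ q * dLb F (N.Θ q)))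
        (1 / 2 * (N.X q).2 * (dLb F (N.Θ q) - D.S q.2 * D.S q.2 * D.qτ q * dL F (N.Θ q)))) q := by
  have hv := N.hasFDerivAt_v q
  have hw := N.hasFDerivAt_w q
  have h1 := ((hv.add hw).const_mul (1 / 2)).prodMk ((hv.sub hw).const_mul (1 / 2))
  have h2 : HasFDerivAt N.Θ _ q := h1.congr_of_eventuallyEq (Eventually.of_forall fun p => by
    rw [N.Θ_apply]
    ext <;> simp <;> ring)
  refine (hF.hasFDerivAt.comp q h2).congr_fderiv ?_
  ext <;> simp [fderiv_apply_eq] <;> ring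

theorem partials_comp_Θ {F : ℝ × ℝ → ℝ} {q : ℝ × ℝ} (hF : DifferentiableAt ℝ F (N.Θ q)) {a b : ℝ}
    (h : HasFDerivAt (fun q => F (N.Θ q)) (lin a b) q) :
    1 / 2 * (N.X q).1 * (dL F (N.Θ q) - D.R q.1 * D.R q.1 * D.qτ q * dLb F (N.Θ q)) = a ∧
      1 / 2 * (N.X q).2 * (dLb F (N.Θ q) - D.S q.2 * D.S q.2 * D.qτ q * dL F (N.Θ q)) = b := by
  have e := (N.hasFDerivAt_comp_Θ hF).unique h
  have e1 := congrArg (fun l : ℝ × ℝ →L[ℝ] ℝ => l (1, 0)) e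
  have e2 := congrArg (fun l : ℝ × ℝ →L[ℝ] ℝ => l (0, 1)) e
  simp only [lin_apply, mul_one, mul_zero, add_zero, zero_add] at e1 e2
  exact ⟨e1, e2⟩

theorem contDiff_A : ContDiff ℝ 1 N.A := by
  have cR := D.continuous_R
  have cS := D.continuous_S
  have cq := D.continuous_qτ
  have ce := D.continuous_eτ
  have ct := D.continuous_τ
  exact contDiff_one_of_lin (by fun_prop) (by fun_prop) N.hasFDerivAt_A

theorem contDiff_one_φ : ContDiff ℝ 1 N.φ := N.contDiff_A.comp N.contDiff_Θ_symm

/-- The partial derivatives of A prescribe two linear combinations of Ψ and Ψbar; the determinant of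
this linear system is 1 - q² τ². -/
theorem psi_Θ_psibar_Θ (q : ℝ × ℝ) :
    Psi N.φ (N.Θ q) = D.R q.1 * D.eτ q ∧ Psibar N.φ (N.Θ q) = D.S q.2 * D.eτ q := by
  have hA : (fun q => N.φ (N.Θ q)) = N.A := by
    ext q; simp [φ]
  obtain ⟨h1, h2⟩ := N.partials_comp_Θ (N.contDiff_one_φ.differentiable (by norm_num) _)
    (by rw [hA]; exact N.hasFDerivAt_A q)
  rw [psi_eq, psibar_eq]
  have hV := (N.V_pos q).ne'
  have hW := (N.W_pos q).ne'
  have k1 : dL N.φ (N.Θ q) - D.R q.1 * D.R q.1 * D.qτ q * dLb N.φ (N.Θ q) =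
      D.R q.1 * D.eτ q * (1 - D.qτ q * D.τ q) := by
    apply mul_left_cancel₀ hV
    linear_combination 2 * h1
  have k2 : dLb N.φ (N.Θ q) - D.S q.2 * D.S q.2 * D.qτ q * dL N.φ (N.Θ q) =
      D.S q.2 * D.eτ q * (1 - D.qτ q * D.τ q) := by
    apply mul_left_cancel₀ hW
    linear_combination 2 * h2
  have hd : 1 - D.qτ q * D.τ q * (D.qτ q * D.τ q) ≠ 0 := by
    linarith [(D.denom_bounds q).1]
  constructor
  · apply mul_left_cancel₀ hd
    simp only [τ] at k1 k2 ⊢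
    linear_combination k1 + D.R q.1 * D.R q.1 * D.qτ q * k2
  · apply mul_left_cancel₀ hd
    simp only [τ] at k1 k2 ⊢
    linear_combination k2 + D.S q.2 * D.S q.2 * D.qτ q * k1

theorem sigma_Θ (q : ℝ × ℝ) : sigma N.φ (N.Θ q) = -(D.τ q * D.eτ q ^ 2) := by
  obtain ⟨h1, h2⟩ := N.psi_Θ_psibar_Θ q
  rw [sigma_eq, h1, h2, τ]
  ring

end

/-- The derivative of `e` at `τ`. -/
def _root_.SimpleWave.RiemannData.e'τ (D : RiemannData c ω B θ κ) (p : ℝ × ℝ) : ℝ :=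
  D.qτ p * D.eτ p / (1 - D.qτ p * D.τ p)

theorem _root_.SimpleWave.RiemannData.e'τ_mul (D : RiemannData c ω B θ κ) (p : ℝ × ℝ) :
    D.e'τ p * (1 - D.qτ p * D.τ p) = D.qτ p * D.eτ p :=
  div_mul_cancel₀ _ (D.one_sub_pos p).ne'

theorem _root_.SimpleWave.RiemannData.continuous_e'τ (D : RiemannData c ω B θ κ) :
    Continuous D.e'τ := by
  have cq := D.continuous_qτ
  have ce := D.continuous_eτ
  have ct := D.continuous_τ
  exact Continuous.div (by fun_prop) (by fun_prop) fun p => (D.one_sub_pos p).ne'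

theorem _root_.SimpleWave.RiemannData.hasFDerivAt_R_mul_e (D : RiemannData c ω B θ κ)
    (p : ℝ × ℝ) : HasFDerivAt (fun p => D.R p.1 * D.eτ p)
      (lin (D.R' p.1 * D.eτ p + D.R p.1 * (D.e'τ p * (D.R' p.1 * D.S p.2)))
        (D.R p.1 * (D.e'τ p * (D.R p.1 * D.S' p.2)))) p := by
  have cR := D.continuous_R
  have cS := D.continuous_S
  have cR' := D.continuous_R'
  have cS' := D.continuous_S'
  have ce := D.continuous_eτ
  have ce' := D.continuous_e'τ
  refine hasFDerivAt_of_partials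
    (P := fun p => D.R' p.1 * D.eτ p + D.R p.1 * (D.e'τ p * (D.R' p.1 * D.S p.2)))
    (Q := fun p => D.R p.1 * (D.e'τ p * (D.R p.1 * D.S' p.2))) (by fun_prop) (by fun_prop)
    (fun u b => ?_) (fun u b => ?_) p
  · exact (D.hasDerivAt_R u).mul (D.hasDerivAt_comp_τ_fst c.hasDerivAt_e u b)
  · exact (D.hasDerivAt_comp_τ_snd c.hasDerivAt_e u b).const_mul (D.R u)

theorem _root_.SimpleWave.RiemannData.hasFDerivAt_S_mul_e (D : RiemannData c ω B θ κ)
    (p : ℝ × ℝ) : HasFDerivAt (fun p => D.S p.2 * D.eτ p)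
      (lin (D.S p.2 * (D.e'τ p * (D.R' p.1 * D.S p.2)))
        (D.S' p.2 * D.eτ p + D.S p.2 * (D.e'τ p * (D.R p.1 * D.S' p.2)))) p := by
  have cR := D.continuous_R
  have cS := D.continuous_S
  have cR' := D.continuous_R'
  have cS' := D.continuous_S'
  have ce := D.continuous_eτ
  have ce' := D.continuous_e'τ
  refine hasFDerivAt_of_partials
    (P := fun p => D.S p.2 * (D.e'τ p * (D.R' p.1 * D.S p.2)))
    (Q := fun p => D.S' p.2 * D.eτ p + D.S p.2 * (D.e'τ p * (D.R p.1 * D.S' p.2)))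
    (by fun_prop) (by fun_prop)
    (fun u b => ?_) (fun u b => ?_) p
  · exact (D.hasDerivAt_comp_τ_fst c.hasDerivAt_e u b).const_mul (D.S b)
  · exact (D.hasDerivAt_S b).mul (D.hasDerivAt_comp_τ_snd c.hasDerivAt_e u b)

section

variable (N : D.NullSolution g)

theorem psi_eq_comp : Psi N.φ = (fun q => D.R q.1 * D.eτ q) ∘ N.Θ.symm := by
  ext p
  have := (N.psi_Θ_psibar_Θ (N.Θ.symm p)).1
  rwa [Equiv.apply_symm_apply] at this

theorem psibar_eq_comp : Psibar N.φ = (fun q => D.S q.2 * D.eτ q) ∘ N.Θ.symm := by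
  ext p
  have := (N.psi_Θ_psibar_Θ (N.Θ.symm p)).2
  rwa [Equiv.apply_symm_apply] at this

theorem contDiff_psi_φ : ContDiff ℝ 1 (Psi N.φ) := by
  have cR := D.continuous_R
  have cS := D.continuous_S
  have cR' := D.continuous_R'
  have cS' := D.continuous_S'
  have ce := D.continuous_eτ
  have ce' := D.continuous_e'τ
  rw [N.psi_eq_comp]
  exact (contDiff_one_of_lin (by fun_prop) (by fun_prop) D.hasFDerivAt_R_mul_e).comp
    N.contDiff_Θ_symm

theorem contDiff_psibar_φ : ContDiff ℝ 1 (Psibar N.φ) := by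
  have cR := D.continuous_R
  have cS := D.continuous_S
  have cR' := D.continuous_R'
  have cS' := D.continuous_S'
  have ce := D.continuous_eτ
  have ce' := D.continuous_e'τ
  rw [N.psibar_eq_comp]
  exact (contDiff_one_of_lin (by fun_prop) (by fun_prop) D.hasFDerivAt_S_mul_e).comp
    N.contDiff_Θ_symm

/-- The null coordinates are only known to be C¹, so A and Θ give no second derivatives of φ. These
exist because Ψ and Ψbar are themselves C¹ functions of the null coordinates. -/
theorem contDiff_φ : ContDiff ℝ 2 N.φ := by
  have h1 := N.contDiff_psi_φ
  have h2 := N.contDiff_psibar_φ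
  rw [show (2 : WithTop ℕ∞) = 1 + 1 by norm_num, contDiff_succ_iff_fderiv]
  refine ⟨N.contDiff_one_φ.differentiable (by norm_num), by simp, ?_⟩
  have e : fderiv ℝ N.φ = fun p => ((Psi N.φ p + Psibar N.φ p) / 2) • ContinuousLinearMap.fst ℝ ℝ ℝ
      + ((Psi N.φ p - Psibar N.φ p) / 2) • ContinuousLinearMap.snd ℝ ℝ ℝ := by
    ext p <;> simp [fderiv_apply_eq, psi_eq, psibar_eq] <;> ring
  rw [e]
  fun_prop

/-- The relation between the nonlinearity and the constitutive functions along the solution. -/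
theorem _root_.SimpleWave.RiemannData.fits_identities {f : ℝ → ℝ} (hfit : c.Fits f)
    (D : RiemannData c ω B θ κ) (q : ℝ × ℝ) :
    1 / 2 * deriv f (-(D.τ q * D.eτ q ^ 2)) * D.eτ q ^ 2 * (1 + D.qτ q * D.τ q) ^ 2 = D.qτ q ∧
      (1 + deriv f (-(D.τ q * D.eτ q ^ 2)) * -(D.τ q * D.eτ q ^ 2)) * (1 + D.qτ q * D.τ q) ^ 2 =
        1 + D.qτ q * D.τ q * (D.qτ q * D.τ q) := by
  have h := hfit (D.τ q) (D.abs_τ_le q)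
  change deriv f (-(D.τ q * D.eτ q ^ 2)) * D.eτ q ^ 2 * (1 + D.qτ q * D.τ q) ^ 2 = 2 * D.qτ q at h
  constructor
  · linear_combination 1 / 2 * h
  · linear_combination -D.τ q * h

theorem waveEquation {f : ℝ → ℝ} (hf : Differentiable ℝ f) (hfit : c.Fits f) :
    WaveEquation f N.φ := by
  rw [waveEquation_iff hf N.contDiff_φ]
  intro p
  obtain ⟨q, rfl⟩ := N.Θ.surjective p
  have d1 := N.contDiff_psi_φ.differentiable (by norm_num) (N.Θ q)
  have d2 := N.contDiff_psibar_φ.differentiable (by norm_num) (N.Θ q)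
  obtain ⟨e1, e2⟩ := N.psi_Θ_psibar_Θ q
  obtain ⟨-, h1⟩ := N.partials_comp_Θ d1 (by
    rw [show (fun q => Psi N.φ (N.Θ q)) = fun q => D.R q.1 * D.eτ q from
      funext fun q => (N.psi_Θ_psibar_Θ q).1]
    exact D.hasFDerivAt_R_mul_e q)
  obtain ⟨-, h2⟩ := N.partials_comp_Θ d2 (by
    rw [show (fun q => Psibar N.φ (N.Θ q)) = fun q => D.S q.2 * D.eτ q from
      funext fun q => (N.psi_Θ_psibar_Θ q).2]
    exact D.hasFDerivAt_S_mul_e q)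
  rw [dLb_psi N.contDiff_φ] at h1
  rw [N.sigma_Θ, e1, e2]
  obtain ⟨i1, i2⟩ := D.fits_identities hfit q
  have he := D.e'τ_mul q
  have h0 : (1 + D.qτ q * D.τ q) ^ 2 ≠ 0 := pow_ne_zero _ (D.one_add_pos q).ne'
  have hW := (N.W_pos q).ne'
  apply mul_left_cancel₀ h0
  apply mul_left_cancel₀ hW
  generalize deriv f (-(D.τ q * D.eτ q ^ 2)) = F at *
  generalize dL (Psi N.φ) (N.Θ q) = LP at *
  generalize dL (Psibar N.φ) (N.Θ q) = m at *
  generalize dLb (Psibar N.φ) (N.Θ q) = LbP at *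
  -- The wave equation after multiplication by (1 + qτ)². Applying ∂_b to Ψ = R e and Ψbar = S e and
  -- taking the first minus R² q times the second leaves a multiple of e' (1 - qτ) - q e, which
  -- vanishes.
  have key : (N.X q).2 * ((1 + D.qτ q * D.τ q * (D.qτ q * D.τ q)) * m -
      D.qτ q * (D.S q.2 ^ 2 * LP + D.R q.1 ^ 2 * LbP)) = 0 := by
    simp only [τ] at he h1 h2 ⊢
    linear_combination 2 * h1 - 2 * D.R q.1 * D.R q.1 * D.qτ q * h2 +
      2 * D.R q.1 * D.R q.1 * D.S' q.2 * he
  linear_combination key + (N.X q).2 * m * i2 -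
    (N.X q).2 * (D.S q.2 ^ 2 * LP + D.R q.1 ^ 2 * LbP) * i1

theorem isGlobalSolution {f φ₁ : ℝ → ℝ} (hf : Differentiable ℝ f) (hfit : c.Fits f)
    (hφ₁ : ∀ x, φ₁ x = 1 / 2 * (D.eτ (x, -x) * (D.R x + D.S (-x)))) :
    IsGlobalSolution f g φ₁ N.φ where
  contDiff := N.contDiff_φ
  equation := N.waveEquation hf hfit
  initial x := by
    rw [φ, Function.comp, N.Θ_symm_zero, N.A_antidiagonal]
  initial_deriv x := by
    obtain ⟨e1, e2⟩ := N.psi_Θ_psibar_Θ (x, -x)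
    rw [N.Θ_antidiagonal, psi_eq] at e1
    rw [N.Θ_antidiagonal, psibar_eq] at e2
    rw [pd_zero, e1, e2, hφ₁]
    ring

/-- Up to the positive factor (1 + qτ)², the quadratic form of the acoustic metric is minus the
product of the two null vector fields applied to F. The eikonal equation says that one of them
annihilates F at each point. -/
theorem eikonal_sum {f : ℝ → ℝ} (hfit : c.Fits f) (F : ℝ × ℝ → ℝ) (q : ℝ × ℝ) :
    (∑ μ, ∑ ν, invMetric f N.φ (N.Θ q) μ ν * pd μ F (N.Θ q) * pd ν F (N.Θ q)) *
        (1 + D.qτ q * D.τ q) ^ 2 =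
      -((dL F (N.Θ q) - D.R q.1 * D.R q.1 * D.qτ q * dLb F (N.Θ q)) *
        (dLb F (N.Θ q) - D.S q.2 * D.S q.2 * D.qτ q * dL F (N.Θ q))) := by
  obtain ⟨e1, e2⟩ := N.psi_Θ_psibar_Θ q
  obtain ⟨i1, i2⟩ := D.fits_identities hfit q
  rw [eikonal_sum_eq, N.sigma_Θ, e1, e2]
  generalize deriv f (-(D.τ q * D.eτ q ^ 2)) = G at *
  simp only [τ] at *
  linear_combination (D.R q.1 * dLb F (N.Θ q) + D.S q.2 * dL F (N.Θ q)) ^ 2 * i1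

theorem isDoubleNull {f : ℝ → ℝ} (h : Setting K B I κ θ ω) (hfit : c.Fits f) :
    IsDoubleNull f N.φ N.Θ.symm where
  contDiff := N.contDiff_Θ_symm
  contDiff_symm := N.contDiff_Θ
  eikonal_u p := by
    obtain ⟨q, rfl⟩ := N.Θ.surjective p
    have hd : DifferentiableAt ℝ (fun p => (N.Θ.symm p).1) (N.Θ q) :=
      (N.contDiff_Θ_symm.fst).differentiable (by norm_num) _
    obtain ⟨-, h2⟩ := N.partials_comp_Θ hd (a := 1) (b := 0) (by
      simp only [Equiv.symm_apply_apply]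
      exact hasFDerivAt_fst.congr_fderiv (by ext <;> simp))
    have h0 : (1 + D.qτ q * D.τ q) ^ 2 ≠ 0 := pow_ne_zero _ (D.one_add_pos q).ne'
    apply mul_right_cancel₀ h0
    rw [N.eikonal_sum hfit]
    have hW := N.W_pos q
    rw [mul_eq_zero, or_iff_right (by positivity)] at h2
    rw [h2]; ring
  eikonal_ubar p := by
    obtain ⟨q, rfl⟩ := N.Θ.surjective p
    have hd : DifferentiableAt ℝ (fun p => (N.Θ.symm p).2) (N.Θ q) :=
      (N.contDiff_Θ_symm.snd).differentiable (by norm_num) _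
    obtain ⟨h1, -⟩ := N.partials_comp_Θ hd (a := 0) (b := 1) (by
      simp only [Equiv.symm_apply_apply]
      exact hasFDerivAt_snd.congr_fderiv (by ext <;> simp))
    have h0 : (1 + D.qτ q * D.τ q) ^ 2 ≠ 0 := pow_ne_zero _ (D.one_add_pos q).ne'
    apply mul_right_cancel₀ h0
    rw [N.eikonal_sum hfit]
    have hV := N.V_pos q
    rw [mul_eq_zero, or_iff_right (by positivity)] at h1
    rw [h1]; ring
  initial x := N.Θ_symm_zero x
  orientation x := by
    rw [← N.Θ_antidiagonal]
    generalize (x, -x) = q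
    have hd : DifferentiableAt ℝ (fun p => (N.Θ.symm p).2) (N.Θ q) :=
      (N.contDiff_Θ_symm.snd).differentiable (by norm_num) _
    obtain ⟨h1, h2⟩ := N.partials_comp_Θ hd (a := 0) (b := 1) (by
      simp only [Equiv.symm_apply_apply]
      exact hasFDerivAt_snd.congr_fderiv (by ext <;> simp))
    rw [pd_zero]
    generalize dL (fun p => (N.Θ.symm p).2) (N.Θ q) = ξ at *
    generalize dLb (fun p => (N.Θ.symm p).2) (N.Θ q) = ξb at *
    have hV := N.V_pos q
    have hW := N.W_pos q
    rw [mul_eq_zero, or_iff_right (by positivity), sub_eq_zero] at h1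
    have hd := (D.denom_bounds q).1
    -- Here L ubar = R² q Lbar ubar. This identity makes Lbar ubar positive, and |R² q| ≤ θK ≤ 1/4
    -- gives the sum ξ + ξb the same sign.
    have k : ξb * (N.X q).2 * (1 - D.qτ q * D.τ q * (D.qτ q * D.τ q)) = 2 := by
      rw [h1] at h2
      simp only [τ]
      linear_combination 2 * h2
    have hξ : 0 < ξb := by
      by_contra! hn
      have : ξb * (N.X q).2 * (1 - D.qτ q * D.τ q * (D.qτ q * D.τ q)) ≤ 0 :=
        mul_nonpos_of_nonpos_of_nonneg (mul_nonpos_of_nonpos_of_nonneg hn hW.le) (by linarith)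
      linarith
    have hR := abs_le.1 (D.abs_RRq_le h q)
    have hs := h.small_K
    rw [h1]
    nlinarith

end

end RiemannData.NullSolution

/-! ### Uniqueness of the solution and of its double null coordinates -/

theorem exists_lipschitz_of_contDiff {E : Type*} [NormedAddCommGroup E] [NormedSpace ℝ E]
    [FiniteDimensional ℝ E] {F : E → ℝ} (hF : ContDiff ℝ 1 F) (M : ℝ) :
    ∃ K, 0 ≤ K ∧ ∀ x y, ‖x‖ ≤ M → ‖y‖ ≤ M → |F x - F y| ≤ K * ‖x - y‖ := by
  have : ProperSpace E := FiniteDimensional.proper ℝ E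
  obtain ⟨C, hC⟩ := (isCompact_closedBall (0 : E) M).exists_bound_of_continuousOn
    (hF.continuous_fderiv (by norm_num)).continuousOn
  refine ⟨|C|, abs_nonneg C, fun x y hx hy => ?_⟩
  exact (convex_closedBall (0 : E) M).norm_image_sub_le_of_norm_fderiv_le
    (fun z _ => hF.differentiable (by norm_num) z)
    (fun z hz => (hC z hz).trans (le_abs_self C)) (by simpa using hy) (by simpa using hx)

namespace RiemannData.NullSolution

variable {δ K B θ κ I : ℝ} {c : Profile δ K} {ω : ℝ → ℝ} {D : RiemannData c ω B θ κ} {g : ℝ → ℝ}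
  (N : D.NullSolution g)

include N in
/-- The wave operator of the constructed solution applied to another solution is controlled by the
difference of the first derivatives. -/
theorem abs_defect_le {f : ℝ → ℝ} (hf : ContDiff ℝ 3 f) (hfit : c.Fits f) {χ : ℝ × ℝ → ℝ}
    (hχ : ContDiff ℝ 2 χ) (hw : WaveEquation f χ) (A : ℝ) :
    ∃ C, 0 ≤ C ∧ ∀ q : ℝ × ℝ, |q.1| ≤ A → |q.2| ≤ A →
      |(1 + D.qτ q * D.τ q * (D.qτ q * D.τ q)) * dL (Psibar χ) (N.Θ q) -
        D.qτ q * (D.S q.2 ^ 2 * dL (Psi χ) (N.Θ q) + D.R q.1 ^ 2 * dLb (Psibar χ) (N.Θ q))| ≤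
        C * (|Psi χ (N.Θ q) - D.R q.1 * D.eτ q| + |Psibar χ (N.Θ q) - D.S q.2 * D.eτ q|) := by
  have hw' := (waveEquation_iff (hf.differentiable (by norm_num)) hχ).1 hw
  have cf := (contDiff_deriv hf).of_le (m := 1) (by norm_num)
  have cR := D.continuous_R
  have cS := D.continuous_S
  have cq := D.continuous_qτ
  have ce := D.continuous_eτ
  have ct := D.continuous_τ
  have cΘ := N.contDiff_Θ.continuous
  have cP := contDiff_psi hχ
  have cPb := contDiff_psibar hχ
  have cLP : Continuous (dL (Psi χ)) := (cP.continuous_fderiv (by norm_num)).clm_apply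
    continuous_const
  have cm : Continuous (dL (Psibar χ)) := (cPb.continuous_fderiv (by norm_num)).clm_apply
    continuous_const
  have cLbP : Continuous (dLb (Psibar χ)) := (cPb.continuous_fderiv (by norm_num)).clm_apply
    continuous_const
  have cPc := cP.continuous
  have cPbc := cPb.continuous
  set T : ℝ × ℝ → ℝ := fun q => |Psi χ (N.Θ q)| + |Psibar χ (N.Θ q)| + |D.R q.1 * D.eτ q| +
    |D.S q.2 * D.eτ q| + |dL (Psi χ) (N.Θ q)| + |dL (Psibar χ) (N.Θ q)| +
    |dLb (Psibar χ) (N.Θ q)| + (1 + D.qτ q * D.τ q) ^ 2 with hT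
  have cT : Continuous T := by simp only [hT]; fun_prop
  obtain ⟨M, hM⟩ := ((isCompact_Icc (a := -A) (b := A)).prod
    (isCompact_Icc (a := -A) (b := A))).exists_bound_of_continuousOn cT.continuousOn
  obtain ⟨K1, hK1, h1⟩ := exists_lipschitz_of_contDiff
    (F := fun x : ℝ × ℝ => 1 + deriv f (-(x.1 * x.2)) * -(x.1 * x.2)) (by fun_prop) M
  obtain ⟨K2, hK2, h2⟩ := exists_lipschitz_of_contDiff
    (F := fun x : ℝ × ℝ => 1 / 2 * deriv f (-(x.1 * x.2)) * x.2 ^ 2) (by fun_prop) M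
  obtain ⟨K3, hK3, h3⟩ := exists_lipschitz_of_contDiff
    (F := fun x : ℝ × ℝ => 1 / 2 * deriv f (-(x.1 * x.2)) * x.1 ^ 2) (by fun_prop) M
  refine ⟨|M| * (K1 * |M| + K2 * |M| + K3 * |M|), by positivity, fun q hq1 hq2 => ?_⟩
  have hMq : T q ≤ |M| := (le_abs_self _).trans
    ((hM q ⟨abs_le.1 hq1, abs_le.1 hq2⟩).trans (le_abs_self _))
  have hMq' : T q ≤ M := (le_abs_self _).trans (hM q ⟨abs_le.1 hq1, abs_le.1 hq2⟩)
  simp only [hT] at hMq hMq'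
  have n1 := abs_nonneg (Psi χ (N.Θ q))
  have n2 := abs_nonneg (Psibar χ (N.Θ q))
  have n3 := abs_nonneg (D.R q.1 * D.eτ q)
  have n4 := abs_nonneg (D.S q.2 * D.eτ q)
  have n5 := abs_nonneg (dL (Psi χ) (N.Θ q))
  have n6 := abs_nonneg (dL (Psibar χ) (N.Θ q))
  have n7 := abs_nonneg (dLb (Psibar χ) (N.Θ q))
  have n8 := sq_nonneg (1 + D.qτ q * D.τ q)
  obtain ⟨i1, i2⟩ := D.fits_identities hfit q
  have hwq := hw' (N.Θ q)
  rw [sigma_eq] at hwq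
  have eσ : -(D.τ q * D.eτ q ^ 2) = -(D.R q.1 * D.eτ q * (D.S q.2 * D.eτ q)) := by
    rw [τ]; ring
  rw [eσ] at i1 i2
  generalize Psi χ (N.Θ q) = P at *
  generalize Psibar χ (N.Θ q) = Pb at *
  generalize dL (Psi χ) (N.Θ q) = LP at *
  generalize dL (Psibar χ) (N.Θ q) = m at *
  generalize dLb (Psibar χ) (N.Θ q) = LbP at *
  have l1 := h1 (D.R q.1 * D.eτ q, D.S q.2 * D.eτ q) (P, Pb)
    (norm_prod_le_iff.2 ⟨by rw [Real.norm_eq_abs]; linarith, by rw [Real.norm_eq_abs]; linarith⟩)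
    (norm_prod_le_iff.2 ⟨by rw [Real.norm_eq_abs]; linarith, by rw [Real.norm_eq_abs]; linarith⟩)
  have l2 := h2 (D.R q.1 * D.eτ q, D.S q.2 * D.eτ q) (P, Pb)
    (norm_prod_le_iff.2 ⟨by rw [Real.norm_eq_abs]; linarith, by rw [Real.norm_eq_abs]; linarith⟩)
    (norm_prod_le_iff.2 ⟨by rw [Real.norm_eq_abs]; linarith, by rw [Real.norm_eq_abs]; linarith⟩)
  have l3 := h3 (D.R q.1 * D.eτ q, D.S q.2 * D.eτ q) (P, Pb)
    (norm_prod_le_iff.2 ⟨by rw [Real.norm_eq_abs]; linarith, by rw [Real.norm_eq_abs]; linarith⟩)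
    (norm_prod_le_iff.2 ⟨by rw [Real.norm_eq_abs]; linarith, by rw [Real.norm_eq_abs]; linarith⟩)
  have hY : ‖((D.R q.1 * D.eτ q, D.S q.2 * D.eτ q) : ℝ × ℝ) - (P, Pb)‖ ≤
      |P - D.R q.1 * D.eτ q| + |Pb - D.S q.2 * D.eτ q| := by
    rw [norm_prod_le_iff]
    have a1 := abs_nonneg (P - D.R q.1 * D.eτ q)
    have a2 := abs_nonneg (Pb - D.S q.2 * D.eτ q)
    simp only [Prod.fst_sub, Prod.snd_sub, Real.norm_eq_abs]
    rw [abs_sub_comm, abs_sub_comm (D.S q.2 * D.eτ q)]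
    constructor <;> linarith
  set Y := |P - D.R q.1 * D.eτ q| + |Pb - D.S q.2 * D.eτ q|
  have hY0 : 0 ≤ Y := by positivity
  replace l1 := l1.trans (mul_le_mul_of_nonneg_left hY hK1)
  replace l2 := l2.trans (mul_le_mul_of_nonneg_left hY hK2)
  replace l3 := l3.trans (mul_le_mul_of_nonneg_left hY hK3)
  simp only at l1 l2 l3
  set α := 1 + deriv f (-(D.R q.1 * D.eτ q * (D.S q.2 * D.eτ q))) *
    -(D.R q.1 * D.eτ q * (D.S q.2 * D.eτ q))
  set β := 1 / 2 * deriv f (-(D.R q.1 * D.eτ q * (D.S q.2 * D.eτ q))) * (D.S q.2 * D.eτ q) ^ 2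
    with hβ
  set βb := 1 / 2 * deriv f (-(D.R q.1 * D.eτ q * (D.S q.2 * D.eτ q))) * (D.R q.1 * D.eτ q) ^ 2
    with hβb
  set α' := 1 + deriv f (-(P * Pb)) * -(P * Pb)
  set β' := 1 / 2 * deriv f (-(P * Pb)) * Pb ^ 2 with hβ'
  set βb' := 1 / 2 * deriv f (-(P * Pb)) * P ^ 2 with hβb'
  -- The equation of χ itself, with its own coefficients α', β', βb', is subtracted; what remains is
  -- multiplied by differences of coefficients, which are Lipschitz in the first derivatives.
  have e : (1 + D.qτ q * D.τ q * (D.qτ q * D.τ q)) * m -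
      D.qτ q * (D.S q.2 ^ 2 * LP + D.R q.1 ^ 2 * LbP) =
      (1 + D.qτ q * D.τ q) ^ 2 * ((α - α') * m - (β - β') * LP - (βb - βb') * LbP) := by
    rw [hβ, hβb, hβ', hβb']
    linear_combination (-m) * i2 + (D.S q.2 ^ 2 * LP + D.R q.1 ^ 2 * LbP) * i1 +
      (1 + D.qτ q * D.τ q) ^ 2 * hwq
  rw [e, abs_mul, abs_of_nonneg n8]
  have b1 : |(α - α') * m| ≤ K1 * Y * |M| := by
    rw [abs_mul]; exact mul_le_mul l1 (by linarith) (abs_nonneg _) (by positivity)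
  have b2 : |(β - β') * LP| ≤ K2 * Y * |M| := by
    rw [abs_mul]; exact mul_le_mul l2 (by linarith) (abs_nonneg _) (by positivity)
  have b3 : |(βb - βb') * LbP| ≤ K3 * Y * |M| := by
    rw [abs_mul]; exact mul_le_mul l3 (by linarith) (abs_nonneg _) (by positivity)
  have b4 : |(α - α') * m - (β - β') * LP - (βb - βb') * LbP| ≤
      K1 * Y * |M| + K2 * Y * |M| + K3 * Y * |M| := by
    have t1 := abs_sub ((α - α') * m - (β - β') * LP) ((βb - βb') * LbP)
    have t2 := abs_sub ((α - α') * m) ((β - β') * LP)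
    linarith
  calc _ ≤ |M| * (K1 * Y * |M| + K2 * Y * |M| + K3 * Y * |M|) :=
        mul_le_mul (by linarith) b4 (abs_nonneg _) (abs_nonneg _)
    _ = _ := by ring

/-- The characteristics are those of the constructed solution, so nothing about χ beyond C² and its
data is needed: its second derivatives enter only through constants on compact squares. -/
theorem psi_eq_of_isGlobalSolution {f φ₁ : ℝ → ℝ} (hf : ContDiff ℝ 3 f) (hfit : c.Fits f)
    (hφ₁ : ∀ x, φ₁ x = 1 / 2 * (D.eτ (x, -x) * (D.R x + D.S (-x)))) {χ : ℝ × ℝ → ℝ}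
    (hχ : IsGlobalSolution f g φ₁ χ) (q : ℝ × ℝ) :
    Psi χ (N.Θ q) = D.R q.1 * D.eτ q ∧ Psibar χ (N.Θ q) = D.S q.2 * D.eτ q := by
  have cR := D.continuous_R
  have cS := D.continuous_S
  have cR' := D.continuous_R'
  have cS' := D.continuous_S'
  have cq := D.continuous_qτ
  have cq' := D.continuous_q'τ
  have ce := D.continuous_eτ
  have ce' := D.continuous_e'τ
  have ct := D.continuous_τ
  have cΔ := D.continuous_Δi
  have cP := contDiff_psi hχ.contDiff
  have cPb := contDiff_psibar hχ.contDiff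
  have cPc := cP.continuous
  have cPbc := cPb.continuous
  have cΘ := N.contDiff_Θ.continuous
  have cX := N.X.continuous
  have hφ := N.isGlobalSolution (hf.differentiable (by norm_num)) hfit hφ₁
  set Y : ℝ × ℝ → ℝ := fun q => Psi χ (N.Θ q) - D.R q.1 * D.eτ q with hY
  set Z : ℝ × ℝ → ℝ := fun q => Psibar χ (N.Θ q) - D.S q.2 * D.eτ q with hZ
  have diag : ∀ u, Y (u, -u) = 0 ∧ Z (u, -u) = 0 := by
    intro u
    obtain ⟨e1, e2⟩ := N.psi_Θ_psibar_Θ (u, -u)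
    simp only [hY, hZ, ← e1, ← e2, N.Θ_antidiagonal]
    have hx : ∀ F : ℝ × ℝ → ℝ, Differentiable ℝ F → (∀ x, F (0, x) = g x) →
        HasDerivAt g (pd 1 F (0, u)) u := fun F hF hFg => by
      have h1 := (hF (0, u)).hasFDerivAt.comp_hasDerivAt u
        ((hasDerivAt_const u (0 : ℝ)).prodMk (hasDerivAt_id' u))
      refine (h1.congr_of_eventuallyEq (Eventually.of_forall fun x => (hFg x).symm)).congr_deriv ?_
      simp [pd]
    have h1 := hx χ (hχ.contDiff.differentiable (by norm_num)) hχ.initial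
    have h2 := hx N.φ (hφ.contDiff.differentiable (by norm_num)) hφ.initial
    have h3 := h1.unique h2
    have h4 : pd 0 χ (0, u) = pd 0 N.φ (0, u) := by rw [hχ.initial_deriv, hφ.initial_deriv]
    simp only [Psi, Psibar]
    rw [h3, h4]
    simp
  have dP : ∀ q, DifferentiableAt ℝ (Psi χ) (N.Θ q) := fun q => cP.differentiable (by norm_num) _
  have dPb : ∀ q, DifferentiableAt ℝ (Psibar χ) (N.Θ q) := fun q =>
    cPb.differentiable (by norm_num) _
  have dq1 : ∀ u b, HasDerivAt (fun s => D.qτ (s, b)) _ u :=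
    D.hasDerivAt_comp_τ_fst c.hasDerivAt_q
  have dq2 : ∀ u b, HasDerivAt (fun s => D.qτ (u, s)) _ b :=
    D.hasDerivAt_comp_τ_snd c.hasDerivAt_q
  set J : ℝ × ℝ → ℝ := fun q => (1 + D.qτ q * D.τ q * (D.qτ q * D.τ q)) * dL (Psibar χ) (N.Θ q) -
        D.qτ q * (D.S q.2 ^ 2 * dL (Psi χ) (N.Θ q) + D.R q.1 ^ 2 * dLb (Psibar χ) (N.Θ q)) with hJ
  -- With Y, Z the differences of Ψ, Ψbar, the combination Y - R² q Z is chosen so that in ∂_b the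
  -- second derivatives of χ form exactly the defect J; symmetrically Z - S² q Y for ∂_u.
  have key := eq_zero_of_hyperbolic_inequality
    (y := fun q => Y q - D.R q.1 * D.R q.1 * D.qτ q * Z q)
    (z := fun q => Z q - D.S q.2 * D.S q.2 * D.qτ q * Y q)
    (y' := fun q => 1 / 2 * (N.X q).2 * J q -
      D.R q.1 * D.R q.1 * (c.q' (D.τ q) * (D.R q.1 * D.S' q.2)) * Z q)
    (z' := fun q => 1 / 2 * (N.X q).1 * J q -
      D.S q.2 * D.S q.2 * (c.q' (D.τ q) * (D.R' q.1 * D.S q.2)) * Y q)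
    (by fun_prop) (by fun_prop)
    (fun u b => by
      have h1 := ((N.hasFDerivAt_comp_Θ (dP (u, b))).sub (D.hasFDerivAt_R_mul_e (u, b)))
      have h2 := ((N.hasFDerivAt_comp_Θ (dPb (u, b))).sub (D.hasFDerivAt_S_mul_e (u, b)))
      have k1 := h1.comp_hasDerivAt b ((hasDerivAt_const b u).prodMk (hasDerivAt_id' b))
      have k2 := h2.comp_hasDerivAt b ((hasDerivAt_const b u).prodMk (hasDerivAt_id' b))
      have he := D.e'τ_mul (u, b)
      refine (k1.sub (((dq2 u b).const_mul (D.R u * D.R u)).mul k2)).congr_deriv ?_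
      simp only [Function.comp, Pi.sub_apply, _root_.sub_apply, lin_apply, hJ, hZ,
        dLb_psi hχ.contDiff]
      simp only [τ] at he ⊢
      linear_combination (-D.R u ^ 2 * D.S' b) * he)
    (fun u b => by
      have h1 := ((N.hasFDerivAt_comp_Θ (dP (u, b))).sub (D.hasFDerivAt_R_mul_e (u, b)))
      have h2 := ((N.hasFDerivAt_comp_Θ (dPb (u, b))).sub (D.hasFDerivAt_S_mul_e (u, b)))
      have k1 := h1.comp_hasDerivAt u ((hasDerivAt_id' u).prodMk (hasDerivAt_const u b))
      have k2 := h2.comp_hasDerivAt u ((hasDerivAt_id' u).prodMk (hasDerivAt_const u b))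
      have he := D.e'τ_mul (u, b)
      refine (k2.sub (((dq1 u b).const_mul (D.S b * D.S b)).mul k1)).congr_deriv ?_
      simp only [Function.comp, Pi.sub_apply, _root_.sub_apply, lin_apply, hJ, hY,
        dLb_psi hχ.contDiff]
      simp only [τ] at he ⊢
      linear_combination (-D.S b ^ 2 * D.R' u) * he)
    (fun u => by simp [(diag u).1, (diag u).2]) (fun u => by simp [(diag u).1, (diag u).2])
    (fun A => by
      obtain ⟨C, hC0, hC⟩ := N.abs_defect_le hf hfit hχ.contDiff hχ.equation A
      set T : ℝ × ℝ → ℝ := fun q => |(N.X q).1| + |(N.X q).2| +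
        |D.R q.1 * D.R q.1 * (c.q' (D.τ q) * (D.R q.1 * D.S' q.2))| +
        |D.S q.2 * D.S q.2 * (c.q' (D.τ q) * (D.R' q.1 * D.S q.2))| +
        |D.R q.1 * D.R q.1 * D.qτ q| + |D.S q.2 * D.S q.2 * D.qτ q| with hT
      have cT : Continuous T := by simp only [hT]; fun_prop
      obtain ⟨M, hM⟩ := ((isCompact_Icc (a := -A) (b := A)).prod
        (isCompact_Icc (a := -A) (b := A))).exists_bound_of_continuousOn cT.continuousOn
      refine ⟨(|M| * C + |M|) * (2 * (1 + |M|)), fun u b hu hb => ?_⟩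
      have hMq : T (u, b) ≤ |M| := (le_abs_self _).trans
        ((hM (u, b) ⟨abs_le.1 hu, abs_le.1 hb⟩).trans (le_abs_self _))
      have hJq := hC (u, b) hu hb
      have hΔ := D.Δi_mul (u, b)
      have hΔ2 := D.abs_Δi_le (u, b)
      simp only [hT] at hMq
      have n1 := abs_nonneg (N.X (u, b)).1
      have n2 := abs_nonneg (N.X (u, b)).2
      have n3 := abs_nonneg (D.R u * D.R u * (c.q' (D.τ (u, b)) * (D.R u * D.S' b)))
      have n4 := abs_nonneg (D.S b * D.S b * (c.q' (D.τ (u, b)) * (D.R' u * D.S b)))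
      have n5 := abs_nonneg (D.R u * D.R u * D.qτ (u, b))
      have n6 := abs_nonneg (D.S b * D.S b * D.qτ (u, b))
      change |J (u, b)| ≤ C * (|Y (u, b)| + |Z (u, b)|) at hJq
      simp only [τ] at hΔ
      generalize J (u, b) = j at *
      generalize Y (u, b) = y at *
      generalize Z (u, b) = z at *
      -- Inverting the passage to the characteristic combinations bounds |Y| + |Z|, hence J, by the
      -- unknowns of the inequality.
      have ey : y = D.Δi (u, b) * ((y - D.R u * D.R u * D.qτ (u, b) * z) +
          D.R u * D.R u * D.qτ (u, b) * (z - D.S b * D.S b * D.qτ (u, b) * y)) := by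
        linear_combination (-y) * hΔ
      have ez : z = D.Δi (u, b) * ((z - D.S b * D.S b * D.qτ (u, b) * y) +
          D.S b * D.S b * D.qτ (u, b) * (y - D.R u * D.R u * D.qτ (u, b) * z)) := by
        linear_combination (-z) * hΔ
      generalize y - D.R u * D.R u * D.qτ (u, b) * z = y1 at *
      generalize z - D.S b * D.S b * D.qτ (u, b) * y = z1 at *
      have hM0 := abs_nonneg M
      have by1 : |y| ≤ 2 * (|y1| + |M| * |z1|) := by
        rw [ey, abs_mul]
        refine mul_le_mul hΔ2 ?_ (abs_nonneg _) (by norm_num)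
        refine (abs_add_le _ _).trans ?_
        rw [abs_mul (D.R u * D.R u * D.qτ (u, b))]
        have := mul_le_mul_of_nonneg_right (by linarith : |D.R u * D.R u * D.qτ (u, b)| ≤ |M|)
          (abs_nonneg z1)
        linarith
      have bz1 : |z| ≤ 2 * (|z1| + |M| * |y1|) := by
        rw [ez, abs_mul]
        refine mul_le_mul hΔ2 ?_ (abs_nonneg _) (by norm_num)
        refine (abs_add_le _ _).trans ?_
        rw [abs_mul (D.S b * D.S b * D.qτ (u, b))]
        have := mul_le_mul_of_nonneg_right (by linarith : |D.S b * D.S b * D.qτ (u, b)| ≤ |M|)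
          (abs_nonneg y1)
        linarith
      have bs : |y| + |z| ≤ 2 * (1 + |M|) * (|y1| + |z1|) := by linarith
      have hy0 := abs_nonneg y
      have hz0 := abs_nonneg z
      have fin : ∀ {x t s : ℝ}, |x| ≤ |M| → |t| ≤ |M| → |s| ≤ |y| + |z| →
          |1 / 2 * x * j - t * s| ≤ (|M| * C + |M|) * (2 * (1 + |M|)) * (|y1| + |z1|) := by
        intro x t s hx ht hs
        have t0 := abs_sub (1 / 2 * x * j) (t * s)
        have t1 : |1 / 2 * x * j| ≤ |M| * (C * (|y| + |z|)) := by
          rw [abs_mul, abs_mul]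
          refine mul_le_mul ?_ hJq (abs_nonneg _) hM0
          rw [abs_of_pos (by norm_num : (0 : ℝ) < 1 / 2)]
          linarith [abs_nonneg x]
        have t2 : |t * s| ≤ |M| * (|y| + |z|) := by
          rw [abs_mul]; exact mul_le_mul ht hs (abs_nonneg _) hM0
        have t3 := mul_le_mul_of_nonneg_left bs (by positivity : 0 ≤ |M| * C + |M|)
        linarith
      exact ⟨fin (by linarith) (by linarith) (by linarith),
        fin (by linarith) (by linarith) (by linarith)⟩)
  obtain ⟨k1, k2⟩ := key q
  have hΔ := D.Δi_mul q
  simp only [τ] at hΔ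
  have ey : Y q = 0 := by
    linear_combination (-Y q) * hΔ + D.Δi q * k1 + D.Δi q * D.R q.1 * D.R q.1 * D.qτ q * k2
  have ez : Z q = 0 := by
    linear_combination (-Z q) * hΔ + D.Δi q * k2 + D.Δi q * D.S q.2 * D.S q.2 * D.qτ q * k1
  exact ⟨sub_eq_zero.1 ey, sub_eq_zero.1 ez⟩

theorem eq_of_isGlobalSolution {f φ₁ : ℝ → ℝ} (hf : ContDiff ℝ 3 f) (hfit : c.Fits f)
    (hφ₁ : ∀ x, φ₁ x = 1 / 2 * (D.eτ (x, -x) * (D.R x + D.S (-x)))) {χ : ℝ × ℝ → ℝ}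
    (hχ : IsGlobalSolution f g φ₁ χ) : χ = N.φ := by
  have hφ := N.isGlobalSolution (hf.differentiable (by norm_num)) hfit hφ₁
  refine eq_of_fderiv_eq (𝕜 := ℝ) (hχ.contDiff.differentiable (by norm_num))
    (hφ.contDiff.differentiable (by norm_num)) (fun p => ?_) (0, 0) ?_
  · obtain ⟨q, rfl⟩ := N.Θ.surjective p
    obtain ⟨h1, h2⟩ := N.psi_eq_of_isGlobalSolution hf hfit hφ₁ hχ q
    obtain ⟨h3, h4⟩ := N.psi_Θ_psibar_Θ q
    refine ContinuousLinearMap.ext fun x => ?_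
    rw [fderiv_apply_eq, fderiv_apply_eq, ← psi_eq, ← psibar_eq, ← psi_eq, ← psibar_eq,
      h1, h2, h3, h4]
  · rw [hχ.initial, hφ.initial]

end RiemannData.NullSolution

/-! ### Uniqueness of the double null coordinates. -/

namespace RiemannData.NullSolution

variable {δ K B θ κ I : ℝ} {c : Profile δ K} {ω : ℝ → ℝ} {D : RiemannData c ω B θ κ} {g : ℝ → ℝ}
  (N : D.NullSolution g)

theorem fderiv_comp_Θ_mul_eq_zero {f : ℝ → ℝ} (hfit : c.Fits f) {F : ℝ × ℝ → ℝ}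
    (hF : Differentiable ℝ F) (he : Eikonal f N.φ F) (q : ℝ × ℝ) :
    fderiv ℝ (fun q => F (N.Θ q)) q (1, 0) * fderiv ℝ (fun q => F (N.Θ q)) q (0, 1) = 0 := by
  have h1 := N.eikonal_sum hfit F q
  rw [he (N.Θ q), zero_mul] at h1
  rw [(N.hasFDerivAt_comp_Θ (hF (N.Θ q))).fderiv]
  simp only [lin_apply]
  linear_combination 1 / 4 * (N.X q).1 * (N.X q).2 * h1

/-- In the constructed coordinates each component of U has one vanishing partial derivative at every
point, and the two differentials are independent. By connectedness the choice is the same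
everywhere: U composed with Θ is either the identity or a swap of the null families, and the
orientation rules out the swap. -/
theorem eq_of_isDoubleNull {f : ℝ → ℝ} (h : Setting K B I κ θ ω)
    (hω : Tendsto ω atTop (𝓝 0)) (hfit : c.Fits f) {U : ℝ × ℝ ≃ ℝ × ℝ}
    (hU : IsDoubleNull f N.φ U) : U = N.Θ.symm := by
  have cU1 : ContDiff ℝ 1 fun p => (U p).1 := hU.contDiff.fst
  have cU2 : ContDiff ℝ 1 fun p => (U p).2 := hU.contDiff.snd
  have dU1 := cU1.differentiable (by norm_num)
  have dU2 := cU2.differentiable (by norm_num)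
  set a : ℝ × ℝ → ℝ := fun q => (U (N.Θ q)).1 with ha
  set b : ℝ × ℝ → ℝ := fun q => (U (N.Θ q)).2 with hb
  have ca : ContDiff ℝ 1 a := cU1.comp N.contDiff_Θ
  have cb : ContDiff ℝ 1 b := cU2.comp N.contDiff_Θ
  have da := ca.differentiable (by norm_num)
  have db := cb.differentiable (by norm_num)
  have pa : ∀ q, fderiv ℝ a q (1, 0) * fderiv ℝ a q (0, 1) = 0 :=
    N.fderiv_comp_Θ_mul_eq_zero hfit dU1 hU.eikonal_u
  have pb : ∀ q, fderiv ℝ b q (1, 0) * fderiv ℝ b q (0, 1) = 0 :=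
    N.fderiv_comp_Θ_mul_eq_zero hfit dU2 hU.eikonal_ubar
  have inj : ∀ q x, fderiv ℝ a q x = 0 → fderiv ℝ b q x = 0 → x = 0 := by
    intro q x hax hbx
    set G : ℝ × ℝ → ℝ × ℝ := fun p => N.Θ.symm (U.symm p)
    have hG : Differentiable ℝ G :=
      (N.contDiff_Θ_symm.comp hU.contDiff_symm).differentiable (by norm_num)
    have h1 : HasFDerivAt (fun q => (a q, b q)) ((fderiv ℝ a q).prod (fderiv ℝ b q)) q :=
      (da q).hasFDerivAt.prodMk (db q).hasFDerivAt
    have h2 := (hG (a q, b q)).hasFDerivAt.comp q h1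
    have h3 : G ∘ (fun q => (a q, b q)) = fun q => q := by
      ext q <;> simp [G, ha, hb]
    rw [h3] at h2
    have h4 := congrArg (fun l : (ℝ × ℝ) →L[ℝ] (ℝ × ℝ) => l x) (h2.unique (hasFDerivAt_id q))
    simp only [ContinuousLinearMap.comp_apply, ContinuousLinearMap.prod_apply, hax, hbx,
      ContinuousLinearMap.id_apply] at h4
    rw [← h4]
    exact map_zero _
  have e1 : ((1 : ℝ), (0 : ℝ)) ≠ 0 := by simp
  have e2 : ((0 : ℝ), (1 : ℝ)) ≠ 0 := by simp
  have alt : ∀ q, fderiv ℝ a q (1, 0) = 0 ↔ fderiv ℝ a q (0, 1) ≠ 0 := by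
    intro q
    constructor
    · intro h1 h2
      have h3 : fderiv ℝ b q (1, 0) ≠ 0 := fun h => e1 (inj q _ h1 h)
      have h4 : fderiv ℝ b q (0, 1) ≠ 0 := fun h => e2 (inj q _ h2 h)
      exact mul_ne_zero h3 h4 (pb q)
    · intro h1
      exact (mul_eq_zero.1 (pa q)).resolve_right h1
  have ca1 : Continuous fun q => fderiv ℝ a q (1, 0) :=
    (ca.continuous_fderiv (by norm_num)).clm_apply continuous_const
  have ca2 : Continuous fun q => fderiv ℝ a q (0, 1) :=
    (ca.continuous_fderiv (by norm_num)).clm_apply continuous_const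
  -- By `alt` exactly one of the two partial derivatives of a vanishes at each point, so the set is
  -- closed and, as the complement of a closed set, open.
  have hclopen : IsClopen {q | fderiv ℝ a q (1, 0) = 0} := by
    refine ⟨isClosed_singleton.preimage ca1, ?_⟩
    have : {q | fderiv ℝ a q (1, 0) = 0} = {q | fderiv ℝ a q (0, 1) ≠ 0} := Set.ext alt
    rw [this]
    exact isOpen_ne.preimage ca2
  have hdiag : ∀ u, a (u, -u) = u ∧ b (u, -u) = -u := fun u => by
    simp only [ha, hb, N.Θ_antidiagonal, hU.initial, and_self]
  have const_fst : ∀ F : ℝ × ℝ → ℝ, Differentiable ℝ F → (∀ q, fderiv ℝ F q (1, 0) = 0) →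
      ∀ u u' s, F (u, s) = F (u', s) := fun F hF h0 u u' s => by
    have hd : ∀ u, HasDerivAt (fun u => F (u, s)) 0 u := fun u => by
      have := (hF (u, s)).hasFDerivAt.comp_hasDerivAt u
        ((hasDerivAt_id' u).prodMk (hasDerivAt_const u s))
      rwa [h0] at this
    exact is_const_of_deriv_eq_zero (fun u => (hd u).differentiableAt) (fun u => (hd u).deriv) u u'
  have const_snd : ∀ F : ℝ × ℝ → ℝ, Differentiable ℝ F → (∀ q, fderiv ℝ F q (0, 1) = 0) →
      ∀ u s s', F (u, s) = F (u, s') := fun F hF h0 u s s' => by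
    have hd : ∀ s, HasDerivAt (fun s => F (u, s)) 0 s := fun s => by
      have := (hF (u, s)).hasFDerivAt.comp_hasDerivAt s
        ((hasDerivAt_const s u).prodMk (hasDerivAt_id' s))
      rwa [h0] at this
    exact is_const_of_deriv_eq_zero (fun u => (hd u).differentiableAt) (fun u => (hd u).deriv) s s'
  rcases isClopen_iff.1 hclopen with hemp | huniv
  · have a1 : ∀ q, fderiv ℝ a q (1, 0) ≠ 0 := fun q hq => by
      have : q ∈ {q | fderiv ℝ a q (1, 0) = 0} := hq
      rw [hemp] at this
      exact this
    have a2 : ∀ q, fderiv ℝ a q (0, 1) = 0 := fun q => (mul_eq_zero.1 (pa q)).resolve_left (a1 q)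
    have b1 : ∀ q, fderiv ℝ b q (1, 0) = 0 := fun q =>
      (mul_eq_zero.1 (pb q)).resolve_right fun h => e2 (inj q _ (a2 q) h)
    have hUΘ : ∀ q, U (N.Θ q) = q := fun q => by
      have k1 : a q = q.1 := (const_snd a da a2 q.1 q.2 (-q.1)).trans (hdiag q.1).1
      have k2 : b q = q.2 := by
        have := (hdiag (-q.2)).2
        rw [neg_neg] at this
        exact (const_fst b db b1 q.1 (-q.2) q.2).trans this
      exact Prod.ext k1 k2
    ext1 p
    obtain ⟨q, rfl⟩ := N.Θ.surjective p
    rw [hUΘ, Equiv.symm_apply_apply]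
  · exfalso
    have a1 : ∀ q, fderiv ℝ a q (1, 0) = 0 := fun q => by
      have : q ∈ (univ : Set (ℝ × ℝ)) := mem_univ q
      rwa [← huniv] at this
    have b2 : ∀ q, fderiv ℝ b q (0, 1) = 0 := fun q =>
      (mul_eq_zero.1 (pb q)).resolve_left fun h => e1 (inj q _ (a1 q) h)
    have hbu : ∀ q, b q = -q.1 := fun q =>
      (const_snd b db b2 q.1 q.2 (-q.1)).trans (hdiag q.1).2
    have hB := h.one_le_B
    have hK := h.one_le_K
    -- In the swapped case Lbar ubar = S² q L ubar with L ubar < 0, so ∂_t ubar < 0 wherever S² q >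
    -- -1. The standing bounds do not give this everywhere, but it holds far out, where S has
    -- decayed.
    obtain ⟨s, hs⟩ := ((hω.const_mul (B ^ 2 * K)).eventually
      (gt_mem_nhds (show B ^ 2 * K * 0 < 1 by simp))).exists
    have hor := hU.orientation (-s)
    rw [← N.Θ_antidiagonal, neg_neg, pd_zero] at hor
    set q : ℝ × ℝ := (-s, s) with hq
    obtain ⟨h1, h2⟩ := N.partials_comp_Θ (dU2 (N.Θ q)) (a := -1) (b := 0) (by
      change HasFDerivAt b (lin (-1) 0) q
      rw [show b = fun q => -q.1 from funext hbu]
      exact (hasFDerivAt_fst (𝕜 := ℝ)).neg.congr_fderiv (by ext <;> simp))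
    have hV := N.V_pos q
    have hW := N.W_pos q
    generalize dL (fun p => (U p).2) (N.Θ q) = ξ at *
    generalize dLb (fun p => (U p).2) (N.Θ q) = ξb at *
    rw [mul_eq_zero, or_iff_right (by positivity), sub_eq_zero] at h2
    have hd := (D.denom_bounds q).1
    have k : ξ * (N.X q).1 * (1 - D.qτ q * D.τ q * (D.qτ q * D.τ q)) = -2 := by
      rw [h2] at h1
      simp only [τ]
      linear_combination 2 * h1
    have hξ : ξ < 0 := by
      by_contra! hn
      have : 0 ≤ ξ * (N.X q).1 * (1 - D.qτ q * D.τ q * (D.qτ q * D.τ q)) :=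
        mul_nonneg (mul_nonneg hn hV.le) (by linarith)
      linarith
    have hS : |D.S q.2 * D.S q.2 * D.qτ q| < 1 := by
      have s1 := D.abs_S_le s
      have s2 := D.abs_S_le' h s
      have s3 := D.abs_qτ_le q
      have hw := h.weight_pos s
      rw [abs_mul, abs_mul]
      calc _ ≤ B * ω s * B * K := by gcongr
        _ = B ^ 2 * K * ω s := by ring
        _ < 1 := hs
    have := (abs_lt.1 hS).1
    rw [h2] at hor
    nlinarith

end RiemannData.NullSolution

/-! ### Lipschitz dependence on the Riemann invariants -/

theorem Ctl.of_lipschitz {K L d s t x y : ℝ} (h : Ctl K 1 |s - t| x y) (hst : |s - t| ≤ L * d)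
    (hL : 0 ≤ L) (hd : 0 ≤ d) : Ctl (K * (1 + L)) 1 d x y := by
  obtain ⟨h1, h2, h3⟩ := h
  have hK : 0 ≤ K := by simpa using (abs_nonneg _).trans h1
  have hKL : 0 ≤ K * L := by positivity
  have hKd : 0 ≤ K * d := by positivity
  have := mul_le_mul_of_nonneg_left hst hK
  exact ⟨by linarith, by linarith, by linarith⟩

theorem NullClose.of_ctl {C d γ : ℝ} {F F' P P' Q Q' : ℝ × ℝ → ℝ}
    (hF : ∀ p, HasFDerivAt F (lin (P p) (Q p)) p) (hF' : ∀ p, HasFDerivAt F' (lin (P' p) (Q' p)) p)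
    (h0 : ∀ p, |F p - F' p| ≤ C * d) (h1 : ∀ p, Ctl C (modDec 1 γ p.1) d (P p) (P' p))
    (h2 : ∀ p, Ctl C (modDec 1 γ p.2) d (Q p) (Q' p)) : NullClose (C * d) γ F F' := by
  intro p
  refine ⟨h0 p, ?_, ?_⟩
  · rw [modDec_eq_mul]
    have := (h1 p).2.2
    simp only [pd, (hF p).fderiv, (hF' p).fderiv, if_pos, lin_apply, mul_one, mul_zero,
      add_zero]
    linarith
  · rw [modDec_eq_mul]
    have := (h2 p).2.2
    simp only [pd, (hF p).fderiv, (hF' p).fderiv, lin_apply]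
    norm_num
    linarith

/-- Lipschitz constant of functions of `τ`. -/
def lipQ (K B : ℝ) : ℝ := K * (1 + 2 * B * B)

/-- Lipschitz constant of `q τ`. -/
def lipQτ (K B : ℝ) : ℝ := 2 * lipQ K B * (2 * B * B)

/-- Lipschitz constant of `(1 - q² τ²)⁻¹`. -/
def lipΔi (K B : ℝ) : ℝ :=
  (1 / 2 : ℝ)⁻¹ + (|1| + 2 * lipQτ K B * lipQτ K B) * (1 / 2 : ℝ)⁻¹ ^ 2

/-- Lipschitz constant of the coefficients `a` and `c`. -/
def lipA (K B : ℝ) : ℝ := 2 * B * (2 * (2 * (2 * (2 * B * B) * B) * lipQ K B) * lipΔi K B)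

/-- Lipschitz constant of the coefficients `b` and `d`. -/
def lipB (K B : ℝ) : ℝ :=
  2 * B * (2 * (2 * (2 * (2 * (2 * (2 * (2 * B * B) * B) * B) * B) * lipQ K B) * lipQ K B) *
    lipΔi K B)

/-- Lipschitz constant of the data of the hodograph system. -/
def lipV (K B : ℝ) : ℝ := 2 * (|1| + 2 * (2 * B * B) * lipQ K B) * lipΔi K B

/-- Lipschitz constant of the hodograph system. -/
def lipSys (K B : ℝ) : ℝ := |lipA K B| + |lipB K B| + |lipV K B|

/-- Lipschitz constant of the solution of the hodograph system. -/
def lipX (K B I : ℝ) : ℝ :=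
  4 * (1 + B ^ 2 * K) + 2 * (lipSys K B + 2 * (lipSys K B * (4 * (1 + B ^ 2 * K))) * I)

namespace RiemannData

variable {δ K B θ κ I d : ℝ} {c : Profile δ K} {ω : ℝ → ℝ}

/-- The Riemann invariants and their derivatives differ by at most a multiple of `d`. -/
structure Close (D D' : RiemannData c ω B θ κ) (d : ℝ) : Prop where
  R : ∀ u, Ctl B (ω u) d (D.R u) (D'.R u)
  R' : ∀ u, Ctl B (ω u) d (D.R' u) (D'.R' u)
  S : ∀ u, Ctl B (ω u) d (D.S u) (D'.S u)
  S' : ∀ u, Ctl B (ω u) d (D.S' u) (D'.S' u)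

namespace Close

variable {D D' : RiemannData c ω B θ κ} (h : Setting K B I κ θ ω) (hd : 0 ≤ d)
  (hc : D.Close D' d)

include h hd hc

theorem R₁ (u : ℝ) : Ctl B 1 d (D.R u) (D'.R u) :=
  (hc.R u).unweight (by linarith [h.one_le_B]) (h.weight_le_one u) hd

theorem R'₁ (u : ℝ) : Ctl B 1 d (D.R' u) (D'.R' u) :=
  (hc.R' u).unweight (by linarith [h.one_le_B]) (h.weight_le_one u) hd

theorem S₁ (u : ℝ) : Ctl B 1 d (D.S u) (D'.S u) :=
  (hc.S u).unweight (by linarith [h.one_le_B]) (h.weight_le_one u) hd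

theorem S'₁ (u : ℝ) : Ctl B 1 d (D.S' u) (D'.S' u) :=
  (hc.S' u).unweight (by linarith [h.one_le_B]) (h.weight_le_one u) hd

theorem τ (p : ℝ × ℝ) : Ctl (2 * B * B) 1 d (D.τ p) (D'.τ p) :=
  (hc.R₁ h hd p.1).mul (hc.S₁ h hd p.2)

theorem comp_τ {g : ℝ → ℝ} (hg : ∀ s t, |s| ≤ δ → |t| ≤ δ → Ctl K 1 |s - t| (g s) (g t))
    (p : ℝ × ℝ) : Ctl (lipQ K B) 1 d (g (D.τ p)) (g (D'.τ p)) := by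
  have hB := h.one_le_B
  refine (hg _ _ (D.abs_τ_le p) (D'.abs_τ_le p)).of_lipschitz ?_ (by positivity) hd
  simpa using (hc.τ h hd p).2.2

theorem qτ (p : ℝ × ℝ) : Ctl (lipQ K B) 1 d (D.qτ p) (D'.qτ p) := hc.comp_τ h hd c.ctl_q p

theorem q'τ (p : ℝ × ℝ) : Ctl (lipQ K B) 1 d (c.q' (D.τ p)) (c.q' (D'.τ p)) :=
  hc.comp_τ h hd c.ctl_q' p

theorem eτ (p : ℝ × ℝ) : Ctl (lipQ K B) 1 d (D.eτ p) (D'.eτ p) := hc.comp_τ h hd c.ctl_e p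

theorem qτ_mul (p : ℝ × ℝ) : Ctl (lipQτ K B) 1 d (D.qτ p * D.τ p) (D'.qτ p * D'.τ p) :=
  (hc.qτ h hd p).mul (hc.τ h hd p)

theorem Δi (p : ℝ × ℝ) : Ctl (lipΔi K B) 1 d (D.Δi p) (D'.Δi p) :=
  ((Ctl.const 1 hd).sub ((hc.qτ_mul h hd p).mul (hc.qτ_mul h hd p))).inv (by norm_num)
    (D.denom_bounds p).1 (D'.denom_bounds p).1

theorem coeffs : D.coeffs.Close D'.coeffs ω (lipSys K B * d) := by
  have key : ∀ {C w x y : ℝ}, Ctl C w d x y → 0 ≤ w → C ≤ lipSys K B →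
      |x - y| ≤ lipSys K B * d * w := fun {C w x y} hx hw hC => by
    have := (hx.mono hC hw hd).2.2
    linarith
  have n1 := abs_nonneg (lipA K B)
  have n2 := abs_nonneg (lipB K B)
  have n3 := abs_nonneg (lipV K B)
  have hA : lipA K B ≤ lipSys K B := by
    unfold lipSys; linarith [le_abs_self (lipA K B)]
  have hB : lipB K B ≤ lipSys K B := by
    unfold lipSys; linarith [le_abs_self (lipB K B)]
  have hV : lipV K B ≤ lipSys K B := by
    unfold lipSys; linarith [le_abs_self (lipV K B)]
  have hw := fun s => (h.weight_pos s).le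
  constructor
  · intro p
    exact key (((hc.S p.2).mul (((((hc.S₁ h hd p.2).mul (hc.S₁ h hd p.2)).mul
      (hc.R'₁ h hd p.1)).mul (hc.q'τ h hd p)).mul (hc.Δi h hd p))).neg) (hw _) hA
  · intro p
    exact key ((hc.S p.2).mul ((((((((hc.R₁ h hd p.1).mul (hc.R₁ h hd p.1)).mul
      (hc.R₁ h hd p.1)).mul (hc.S₁ h hd p.2)).mul (hc.S'₁ h hd p.2)).mul (hc.qτ h hd p)).mul
      (hc.q'τ h hd p)).mul (hc.Δi h hd p))) (hw _) hB
  · intro p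
    exact key (((hc.R p.1).mul (((((hc.R₁ h hd p.1).mul (hc.R₁ h hd p.1)).mul
      (hc.S'₁ h hd p.2)).mul (hc.q'τ h hd p)).mul (hc.Δi h hd p))).neg) (hw _) hA
  · intro p
    exact key ((hc.R p.1).mul ((((((((hc.S₁ h hd p.2).mul (hc.S₁ h hd p.2)).mul
      (hc.S₁ h hd p.2)).mul (hc.R₁ h hd p.1)).mul (hc.R'₁ h hd p.1)).mul (hc.qτ h hd p)).mul
      (hc.q'τ h hd p)).mul (hc.Δi h hd p))) (hw _) hB
  · intro u
    have := key (((Ctl.const 1 hd).sub (((hc.S₁ h hd (-u)).mul (hc.S₁ h hd (-u))).mul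
      (hc.qτ h hd (u, -u)))).mul (hc.Δi h hd (u, -u))) zero_le_one hV
    rwa [mul_one] at this
  · intro b
    have := key (((Ctl.const 1 hd).sub (((hc.R₁ h hd (-b)).mul (hc.R₁ h hd (-b))).mul
      (hc.qτ h hd (-b, b)))).mul (hc.Δi h hd (-b, b))) zero_le_one hV
    rwa [mul_one] at this

/-- The fixed-point estimate turns closeness of the coefficients into closeness of V and W; `lipX`
also dominates the size of both solutions. -/
theorem solution {X X' : BoundedContinuousFunction (ℝ × ℝ) (ℝ × ℝ)}
    (hX : ∀ p, X p = D.coeffs.step X p) (hX' : ∀ p, X' p = D'.coeffs.step X' p) (p : ℝ × ℝ) :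
    Ctl (lipX K B I) 1 d (X p).1 (X' p).1 ∧ Ctl (lipX K B I) 1 d (X p).2 (X' p).2 := by
  have hB := h.one_le_B
  have hK := h.one_le_K
  have hθ := h.θ_nonneg
  have hI : 0 ≤ I := (abs_nonneg _).trans (h.abs_integral_le 0 0)
  have hs : 0 ≤ lipSys K B := by unfold lipSys; positivity
  have key := Coeffs.norm_solution_sub_le h.continuous_weight (fun s => (h.weight_pos s).le)
    h.abs_integral_le (by positivity) h.small_integral (by positivity) (D.bounded_coeffs h)
    (D'.bounded_coeffs h) (hc.coeffs h hd) hX hX'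
  have hN := D'.norm_solution_le h hX'
  have e : ‖X p - X' p‖ ≤ lipX K B I * d := by
    refine ((X - X').norm_coe_le_norm p).trans (key.trans ?_)
    have h1 : 2 * (lipSys K B * d + 2 * (lipSys K B * d * ‖X'‖) * I) ≤
        2 * (lipSys K B * d + 2 * (lipSys K B * d * (4 * (1 + B ^ 2 * K))) * I) := by gcongr
    have h2 : 0 ≤ 4 * (1 + B ^ 2 * K) * d := by positivity
    unfold lipX
    linarith
  have hl : 4 * (1 + B ^ 2 * K) ≤ lipX K B I := by
    have : 0 ≤ 2 * (lipSys K B + 2 * (lipSys K B * (4 * (1 + B ^ 2 * K))) * I) := by positivity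
    unfold lipX
    linarith
  refine ⟨⟨?_, ?_, ?_⟩, ⟨?_, ?_, ?_⟩⟩
  · linarith [D.abs_V_le h hX p]
  · linarith [D'.abs_V_le h hX' p]
  · rw [mul_one]; exact (norm_fst_le (X p - X' p)).trans e
  · linarith [D.abs_W_le h hX p]
  · linarith [D'.abs_W_le h hX' p]
  · rw [mul_one]; exact (norm_snd_le (X p - X' p)).trans e

/-- Lipschitz constant of `1 - q τ`. -/
def _root_.SimpleWave.lipSub (K B : ℝ) : ℝ := |1| + lipQτ K B

theorem one_sub (p : ℝ × ℝ) :
    Ctl (lipSub K B) 1 d (1 - D.qτ p * D.τ p) (1 - D'.qτ p * D'.τ p) :=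
  (Ctl.const 1 hd).sub (hc.qτ_mul h hd p)

/-- Lipschitz constant of `e'(τ)`. -/
def _root_.SimpleWave.lipE' (K B : ℝ) : ℝ :=
  2 * (2 * lipQ K B * lipQ K B) * ((1 / 2 : ℝ)⁻¹ + lipSub K B * (1 / 2 : ℝ)⁻¹ ^ 2)

theorem e'τ (p : ℝ × ℝ) : Ctl (lipE' K B) 1 d (D.e'τ p) (D'.e'τ p) := by
  have h1 := abs_le.1 (D.abs_qτ_mul_le p)
  have h2 := abs_le.1 (D'.abs_qτ_mul_le p)
  have h3 := (hc.one_sub h hd p).inv (c := 1 / 2) (by norm_num) (by linarith) (by linarith)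
  simp only [RiemannData.e'τ, div_eq_mul_inv]
  exact ((hc.qτ h hd p).mul (hc.eτ h hd p)).mul h3

end Close

end RiemannData

/-- Lipschitz constant of the first derivatives of the solution. -/
def lipGrad (K B I : ℝ) : ℝ :=
  2 * (2 * (2 * (2 * B * lipQ K B) * lipSub K B) * lipX K B I) * |1 / 2|

/-- Lipschitz constant of the solution. -/
def lipSol (K B I : ℝ) : ℝ := 1 + |lipGrad K B I| * (1 + I)

/-- Lipschitz constants of the rectangular derivatives and of their null derivatives. -/
def lipPsi (K B : ℝ) : ℝ :=
  |2 * B * lipQ K B| + |2 * B * lipQ K B + 2 * B * (2 * (2 * B * B) * lipE' K B)| +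
    |2 * B * (2 * (2 * B * lipE' K B) * B)|

namespace RiemannData.NullSolution

variable {δ K B θ κ I d γ : ℝ} {c : Profile δ K} {g g' : ℝ → ℝ}
  {D D' : RiemannData c (modDec 1 γ) B θ κ} (N : D.NullSolution g) (N' : D'.NullSolution g')
  (h : Setting K B I κ θ (modDec 1 γ)) (hd : 0 ≤ d) (hc : D.Close D' d)

include h hd hc

/-- The derivatives are products of controlled factors, weighted by R(u) or S(b). For the values,
the difference of the b-derivatives is integrated from the antidiagonal, where the difference is
that of the data; the weight contributes at most I. -/
theorem nullClose_A (hg : ∀ u, |g u - g' u| ≤ d) :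
    NullClose (lipSol K B I * d) γ N.A N'.A := by
  have hw := fun s => (h.weight_pos s).le
  have hI : 0 ≤ I := (abs_nonneg _).trans (h.abs_integral_le 0 0)
  have hle : lipGrad K B I ≤ lipSol K B I := by
    have := le_abs_self (lipGrad K B I)
    have : 0 ≤ |lipGrad K B I| * I := by positivity
    unfold lipSol
    linarith
  have h1 : ∀ p, Ctl (lipGrad K B I) (modDec 1 γ p.1) d
      (1 / 2 * (D.R p.1 * D.eτ p * (1 - D.qτ p * D.τ p) * (N.X p).1))
      (1 / 2 * (D'.R p.1 * D'.eτ p * (1 - D'.qτ p * D'.τ p) * (N'.X p).1)) := fun p =>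
    (Ctl.const (1 / 2) hd).mul' ((((hc.R p.1).mul (hc.eτ h hd p)).mul (hc.one_sub h hd p)).mul
      (hc.solution h hd N.eq_step N'.eq_step p).1)
  have h2 : ∀ p, Ctl (lipGrad K B I) (modDec 1 γ p.2) d
      (1 / 2 * (D.S p.2 * D.eτ p * (1 - D.qτ p * D.τ p) * (N.X p).2))
      (1 / 2 * (D'.S p.2 * D'.eτ p * (1 - D'.qτ p * D'.τ p) * (N'.X p).2)) := fun p =>
    (Ctl.const (1 / 2) hd).mul' ((((hc.S p.2).mul (hc.eτ h hd p)).mul (hc.one_sub h hd p)).mul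
      (hc.solution h hd N.eq_step N'.eq_step p).2)
  refine NullClose.of_ctl N.hasFDerivAt_A N'.hasFDerivAt_A (fun p => ?_)
    (fun p => (h1 p).mono hle (hw _) hd) (fun p => (h2 p).mono hle (hw _) hd)
  obtain ⟨u, b⟩ := p
  have cR := D.continuous_R
  have cS := D.continuous_S
  have cq := D.continuous_qτ
  have ce := D.continuous_eτ
  have ct := D.continuous_τ
  have cR' := D'.continuous_R
  have cS' := D'.continuous_S
  have cq' := D'.continuous_qτ
  have ce' := D'.continuous_eτ
  have ct' := D'.continuous_τ
  have hder : ∀ s, HasDerivAt (fun s => N.A (u, s) - N'.A (u, s)) _ s := fun s =>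
    (HasFDerivAt.partial_snd (N.hasFDerivAt_A (u, s))).sub
      (HasFDerivAt.partial_snd (N'.hasFDerivAt_A (u, s)))
  have hint := intervalIntegral.integral_eq_sub_of_hasDerivAt (a := -u) (b := b)
    (fun s _ => hder s) (Continuous.intervalIntegrable (by fun_prop) _ _)
  have hbd := Coeffs.abs_integral_le_of_weight h.continuous_weight h.abs_integral_le
    (C := |lipGrad K B I| * d) (by positivity) (fun s => (by
      have h3 := ((h2 (u, s)).mono (le_abs_self _) (hw _) hd).2.2
      simp only at h3
      calc _ ≤ _ := h3
        _ = _ := by ring)) (-u) b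
  rw [hint] at hbd
  simp only [N.A_antidiagonal, N'.A_antidiagonal] at hbd
  have t := abs_add_le (N.A (u, b) - N'.A (u, b) - (g u - g' u)) (g u - g' u)
  rw [sub_add_cancel] at t
  have hgu := hg u
  have : 0 ≤ |lipGrad K B I| * d := by positivity
  unfold lipSol
  linarith

/-- R e(RS) is explicit in the Riemann invariants, so the hodograph system plays no role. In the
b-derivative the weight comes from S'(b). -/
theorem nullClose_psi : NullClose (lipPsi K B * d) γ (fun p => D.R p.1 * D.eτ p)
    (fun p => D'.R p.1 * D'.eτ p) := by
  have hw := fun s => (h.weight_pos s).le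
  have n1 := abs_nonneg (2 * B * lipQ K B)
  have n2 := abs_nonneg (2 * B * lipQ K B + 2 * B * (2 * (2 * B * B) * lipE' K B))
  have n3 := abs_nonneg (2 * B * (2 * (2 * B * lipE' K B) * B))
  have m1 := le_abs_self (2 * B * lipQ K B)
  have m2 := le_abs_self (2 * B * lipQ K B + 2 * B * (2 * (2 * B * B) * lipE' K B))
  have m3 := le_abs_self (2 * B * (2 * (2 * B * lipE' K B) * B))
  refine NullClose.of_ctl D.hasFDerivAt_R_mul_e D'.hasFDerivAt_R_mul_e (fun p => ?_)
    (fun p => ?_) (fun p => ?_)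
  · have h1 := ((hc.R₁ h hd p.1).mul (hc.eτ h hd p)).mono (B' := lipPsi K B)
      (by unfold lipPsi; linarith) zero_le_one hd
    simpa using h1.2.2
  · refine Ctl.mono (((hc.R' p.1).mul (hc.eτ h hd p)).add ((hc.R p.1).mul
      ((hc.e'τ h hd p).mul' ((hc.R'₁ h hd p.1).mul (hc.S₁ h hd p.2))))) ?_ (hw _) hd
    unfold lipPsi; linarith
  · refine Ctl.mono ((hc.R₁ h hd p.1).mul' ((hc.e'τ h hd p).mul'
      ((hc.R₁ h hd p.1).mul' (hc.S' p.2)))) ?_ (hw _) hd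
    unfold lipPsi; linarith

theorem nullClose_psibar : NullClose (lipPsi K B * d) γ (fun p => D.S p.2 * D.eτ p)
    (fun p => D'.S p.2 * D'.eτ p) := by
  have hw := fun s => (h.weight_pos s).le
  have n1 := abs_nonneg (2 * B * lipQ K B)
  have n2 := abs_nonneg (2 * B * lipQ K B + 2 * B * (2 * (2 * B * B) * lipE' K B))
  have n3 := abs_nonneg (2 * B * (2 * (2 * B * lipE' K B) * B))
  have m1 := le_abs_self (2 * B * lipQ K B)
  have m2 := le_abs_self (2 * B * lipQ K B + 2 * B * (2 * (2 * B * B) * lipE' K B))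
  have m3 := le_abs_self (2 * B * (2 * (2 * B * lipE' K B) * B))
  refine NullClose.of_ctl D.hasFDerivAt_S_mul_e D'.hasFDerivAt_S_mul_e (fun p => ?_)
    (fun p => ?_) (fun p => ?_)
  · have h1 := ((hc.S₁ h hd p.2).mul (hc.eτ h hd p)).mono (B' := lipPsi K B)
      (by unfold lipPsi; linarith) zero_le_one hd
    simpa using h1.2.2
  · refine Ctl.mono ((hc.S₁ h hd p.2).mul' ((hc.e'τ h hd p).mul'
      ((hc.R' p.1).mul (hc.S₁ h hd p.2)))) ?_ (hw _) hd
    unfold lipPsi; linarith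
  · refine Ctl.mono (((hc.S' p.2).mul (hc.eτ h hd p)).add ((hc.S p.2).mul
      ((hc.e'τ h hd p).mul' ((hc.R₁ h hd p.1).mul (hc.S'₁ h hd p.2))))) ?_ (hw _) hd
    unfold lipPsi; linarith

theorem solutionClose (hg : ∀ u, |g u - g' u| ≤ d) :
    SolutionClose ((lipSol K B I + lipPsi K B) * d) γ N.φ N.Θ.symm N'.φ N'.Θ.symm := by
  have hP : 0 ≤ lipPsi K B := by unfold lipPsi; positivity
  have hI : 0 ≤ I := (abs_nonneg _).trans (h.abs_integral_le 0 0)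
  have hS : 0 ≤ lipSol K B I := by unfold lipSol; positivity
  have mono : ∀ {C : ℝ} {F F' : ℝ × ℝ → ℝ}, C ≤ lipSol K B I + lipPsi K B →
      NullClose (C * d) γ F F' → NullClose ((lipSol K B I + lipPsi K B) * d) γ F F' := by
    intro C F F' hC hF q
    obtain ⟨h1, h2, h3⟩ := hF q
    have hCd := mul_le_mul_of_nonneg_right hC hd
    rw [modDec_eq_mul] at h2 h3
    rw [modDec_eq_mul, modDec_eq_mul _ _ q.2]
    exact ⟨h1.trans hCd, h2.trans (mul_le_mul_of_nonneg_right hCd (h.weight_pos _).le),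
      h3.trans (mul_le_mul_of_nonneg_right hCd (h.weight_pos _).le)⟩
  have e0 : N.φ ∘ N.Θ.symm.symm = N.A := by ext q; simp [φ]
  have e0' : N'.φ ∘ N'.Θ.symm.symm = N'.A := by ext q; simp [φ]
  have e1 : Psi N.φ ∘ N.Θ.symm.symm = fun p => D.R p.1 * D.eτ p :=
    funext fun q => (N.psi_Θ_psibar_Θ q).1
  have e1' : Psi N'.φ ∘ N'.Θ.symm.symm = fun p => D'.R p.1 * D'.eτ p :=
    funext fun q => (N'.psi_Θ_psibar_Θ q).1
  have e2 : Psibar N.φ ∘ N.Θ.symm.symm = fun p => D.S p.2 * D.eτ p :=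
    funext fun q => (N.psi_Θ_psibar_Θ q).2
  have e2' : Psibar N'.φ ∘ N'.Θ.symm.symm = fun p => D'.S p.2 * D'.eτ p :=
    funext fun q => (N'.psi_Θ_psibar_Θ q).2
  rw [SolutionClose, e0, e0', e1, e1', e2, e2']
  exact ⟨mono (by linarith) (N.nullClose_A N' h hd hc hg),
    mono (by linarith) (nullClose_psi h hd hc), mono (by linarith) (nullClose_psibar h hd hc)⟩

end RiemannData.NullSolution

/-! ### From the data to the Riemann invariants -/

/-- The restrictions `P` of `Ψ` and `Q` of `Ψbar` to the initial line. -/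
structure InitialSlopes (A : ℝ) (ω : ℝ → ℝ) where
  P : ℝ → ℝ
  P' : ℝ → ℝ
  Q : ℝ → ℝ
  Q' : ℝ → ℝ
  hasDerivAt_P : ∀ x, HasDerivAt P (P' x) x
  hasDerivAt_Q : ∀ x, HasDerivAt Q (Q' x) x
  continuous_P' : Continuous P'
  continuous_Q' : Continuous Q'
  abs_P_le : ∀ x, |P x| ≤ A * ω x
  abs_P'_le : ∀ x, |P' x| ≤ A * ω x
  abs_Q_le : ∀ x, |Q x| ≤ A * ω x
  abs_Q'_le : ∀ x, |Q' x| ≤ A * ω x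

/-- Bound and Lipschitz constant of the Riemann invariants in terms of the data. -/
def lipData (K A : ℝ) : ℝ :=
  2 * A * (K * (1 + 2 * A * A)) +
    2 * A * (2 * (K * (1 + 2 * A * A)) * (2 * A * A + 2 * A * A))

/-- The Riemann invariant that belongs to `P`. -/
def invariant (E P Q : ℝ → ℝ) (x : ℝ) : ℝ := P x * E (-(P x * Q x))

/-- The derivative of the Riemann invariant. -/
def invariant' (E E' P P' Q Q' : ℝ → ℝ) (x : ℝ) : ℝ :=
  P' x * E (-(P x * Q x)) + P x * (E' (-(P x * Q x)) * -(P' x * Q x + P x * Q' x))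

section Invariant

variable {δ K A w d : ℝ} {c : Profile δ K} {E E' : ℝ → ℝ}

theorem hasDerivAt_invariant (hE : c.Inverts E E') {P P' Q Q' : ℝ → ℝ}
    {x : ℝ} (hP : HasDerivAt P (P' x) x) (hQ : HasDerivAt Q (Q' x) x) (hδ : |P x * Q x| ≤ δ) :
    HasDerivAt (invariant E P Q) (invariant' E E' P P' Q Q' x) x :=
  hP.mul (HasDerivAt.comp x (hE.hasDerivAt _ (by rwa [abs_neg])) (hP.mul hQ).neg)

theorem continuous_invariant' (hE : c.Inverts E E') {P P' Q Q' : ℝ → ℝ} (hP : Continuous P)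
    (hP' : Continuous P') (hQ : Continuous Q) (hQ' : Continuous Q')
    (hδ : ∀ x, |P x * Q x| ≤ δ) : Continuous (invariant' E E' P P' Q Q') := by
  have hs : Continuous fun x => -(P x * Q x) := (hP.mul hQ).neg
  have hsδ : ∀ x, |-(P x * Q x)| ≤ δ := fun x => by rw [abs_neg]; exact hδ x
  exact (hP'.mul (continuous_comp_of_ctl hE.ctl hs hsδ)).add
    (hP.mul ((continuous_comp_of_ctl hE.ctl' hs hsδ).mul ((hP'.mul hQ).add (hP.mul hQ')).neg))

theorem ctl_invariant (hE : c.Inverts E E') (hA : 0 ≤ A) (hw : 0 ≤ w) (hw1 : w ≤ 1) (hd : 0 ≤ d)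
    {P P' Q Q' p p' q q' : ℝ → ℝ} {x : ℝ} (hP : Ctl A w d (P x) (p x))
    (hP' : Ctl A w d (P' x) (p' x)) (hQ : Ctl A w d (Q x) (q x)) (hQ' : Ctl A w d (Q' x) (q' x))
    (hδ : |P x * Q x| ≤ δ) (hδ' : |p x * q x| ≤ δ) :
    Ctl (lipData K A) w d (invariant E P Q x) (invariant E p q x) ∧
      Ctl (lipData K A) w d (invariant' E E' P P' Q Q' x) (invariant' E E' p p' q q' x) := by
  rw [← abs_neg] at hδ hδ'
  have uP := hP.unweight hA hw1 hd
  have uP' := hP'.unweight hA hw1 hd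
  have uQ := hQ.unweight hA hw1 hd
  have uQ' := hQ'.unweight hA hw1 hd
  have hK : 0 ≤ K := by simpa using (abs_nonneg _).trans (hE.ctl _ _ hδ hδ).1
  have hs : |-(P x * Q x) - -(p x * q x)| ≤ 2 * A * A * d := by
    simpa using (uP.mul uQ).neg.2.2
  have e1 := (hE.ctl _ _ hδ hδ').of_lipschitz hs (by positivity) hd
  have e2 := (hE.ctl' _ _ hδ hδ').of_lipschitz hs (by positivity) hd
  refine ⟨(hP.mul e1).mono ?_ hw hd, (hP'.mul e1).add
    (hP.mul (e2.mul ((uP'.mul uQ).add (uP.mul uQ')).neg))⟩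
  exact le_add_of_nonneg_right (by positivity)

theorem invariant_mul_invariant (P Q : ℝ → ℝ) (x : ℝ) :
    invariant E P Q x * invariant E Q P x = -(-(P x * Q x) * E (-(P x * Q x)) ^ 2) := by
  simp only [invariant, mul_comm (Q x) (P x)]; ring

/-- E(σ) and e(τ) are reciprocal when τ = -σ E(σ)², and that is the product of the two invariants;
hence the slopes are recovered from the invariants. -/
theorem invariant_mul_e (hE : c.Inverts E E') {P Q : ℝ → ℝ} {x : ℝ} (hδ : |P x * Q x| ≤ δ) :
    invariant E P Q x * c.e (invariant E P Q x * invariant E Q P x) = P x := by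
  rw [invariant_mul_invariant, invariant, mul_assoc, hE.mul_e _ (by rwa [abs_neg]), mul_one]

end Invariant

namespace InitialSlopes

variable {δ K A B κ d ε : ℝ} {c : Profile δ K} {E E' : ℝ → ℝ} {ω : ℝ → ℝ}

/-- The data and their derivatives differ by at most a multiple of `d`. -/
structure Close (D D' : InitialSlopes A ω) (d : ℝ) : Prop where
  P : ∀ x, Ctl A (ω x) d (D.P x) (D'.P x)
  P' : ∀ x, Ctl A (ω x) d (D.P' x) (D'.P' x)
  Q : ∀ x, Ctl A (ω x) d (D.Q x) (D'.Q x)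
  Q' : ∀ x, Ctl A (ω x) d (D.Q' x) (D'.Q' x)

theorem ctl_invariants (hE : c.Inverts E E') (hA : 0 ≤ A) (hw : ∀ x, 0 ≤ ω x)
    (hw1 : ∀ x, ω x ≤ 1) {D D' : InitialSlopes A ω} (hD : ∀ x, |D.P x * D.Q x| ≤ δ)
    (hD' : ∀ x, |D'.P x * D'.Q x| ≤ δ) (hd : 0 ≤ d) (hc : D.Close D' d) (x : ℝ) :
    (Ctl (lipData K A) (ω x) d (invariant E D.P D.Q x) (invariant E D'.P D'.Q x) ∧
      Ctl (lipData K A) (ω x) d (invariant' E E' D.P D.P' D.Q D.Q' x)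
        (invariant' E E' D'.P D'.P' D'.Q D'.Q' x)) ∧
    (Ctl (lipData K A) (ω x) d (invariant E D.Q D.P x) (invariant E D'.Q D'.P x) ∧
      Ctl (lipData K A) (ω x) d (invariant' E E' D.Q D.Q' D.P D.P' x)
        (invariant' E E' D'.Q D'.Q' D'.P D'.P' x)) :=
  ⟨ctl_invariant hE hA (hw x) (hw1 x) hd (hc.P x) (hc.P' x) (hc.Q x) (hc.Q' x) (hD x) (hD' x),
    ctl_invariant hE hA (hw x) (hw1 x) hd (hc.Q x) (hc.Q' x) (hc.P x) (hc.P' x)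
      (by rw [mul_comm]; exact hD x) (by rw [mul_comm]; exact hD' x)⟩

/-- Smallness of the distance `ε` to the simple wave `Z`. -/
structure NearSimple (c : Profile δ K) (κ ε : ℝ) (D Z : InitialSlopes A ω) : Prop where
  close : D.Close Z ε
  P_eq_zero : ∀ x, Z.P x = 0
  P'_eq_zero : ∀ x, Z.P' x = 0
  lower : ∀ x, 2 * κ ≤ 1 - Z.Q x * Z.Q x * c.q 0
  nonneg : 0 ≤ ε
  small_PQ : A * A * ε ≤ δ
  small_RS : lipData K A * lipData K A * ε ≤ δ
  small_lower : 2 * (2 * lipData K A * lipData K A) * (K * (1 + lipData K A * lipData K A)) * ε ≤ κ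

namespace NearSimple

variable {D Z : InitialSlopes A ω}

theorem abs_mul_le (h : NearSimple c κ ε D Z) (hA : 0 ≤ A)
    (hw1 : ∀ x, ω x ≤ 1) (x : ℝ) : |D.P x * D.Q x| ≤ δ := by
  have h1 := ((h.close.P x).unweight hA (hw1 x) h.nonneg).2.2
  have h2 := ((h.close.Q x).unweight hA (hw1 x) h.nonneg).1
  rw [h.P_eq_zero, sub_zero, mul_one] at h1
  rw [abs_mul]
  refine (mul_le_mul h1 h2 (abs_nonneg _) ((abs_nonneg _).trans h1)).trans (le_trans ?_ h.small_PQ)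
  linarith

theorem abs_mul_eq_zero (h : NearSimple c κ ε D Z) (hA : 0 ≤ A) (x : ℝ) :
    |Z.P x * Z.Q x| ≤ δ := by
  rw [h.P_eq_zero, zero_mul, abs_zero]
  exact le_trans (mul_nonneg (mul_nonneg hA hA) h.nonneg) h.small_PQ

theorem K_nonneg (h : NearSimple c κ ε D Z) (hE : c.Inverts E E') (hA : 0 ≤ A) : 0 ≤ K := by
  have h0 : |(0 : ℝ)| ≤ δ := by simpa [h.P_eq_zero] using h.abs_mul_eq_zero hA 0
  simpa using (abs_nonneg _).trans (hE.ctl 0 0 h0 h0).1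

/-- For the simple wave P = 0, so its invariant R vanishes and the bound on the difference is a
bound on R itself. This is the source of the small factor. -/
theorem abs_invariant_le (h : NearSimple c κ ε D Z) (hE : c.Inverts E E') (hA : 0 ≤ A)
    (hw : ∀ x, 0 ≤ ω x) (hw1 : ∀ x, ω x ≤ 1) (u : ℝ) :
    |invariant E D.P D.Q u| ≤ lipData K A * ε * ω u := by
  have := (ctl_invariants hE hA hw hw1 (h.abs_mul_le hA hw1) (h.abs_mul_eq_zero hA) h.nonneg
    h.close u).1.1.2.2
  rw [invariant, invariant, h.P_eq_zero, zero_mul, sub_zero] at this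
  rw [invariant]; linarith

theorem ctl_invariant_Q (h : NearSimple c κ ε D Z) (hE : c.Inverts E E') (hA : 0 ≤ A)
    (hw : ∀ x, 0 ≤ ω x) (hw1 : ∀ x, ω x ≤ 1) (x : ℝ) :
    Ctl (lipData K A) 1 ε (invariant E D.Q D.P x) (Z.Q x) := by
  have hK := h.K_nonneg hE hA
  have := (ctl_invariants hE hA hw hw1 (h.abs_mul_le hA hw1) (h.abs_mul_eq_zero hA) h.nonneg
    h.close x).2.1.unweight (by unfold lipData; positivity) (hw1 x) h.nonneg
  rwa [show invariant E Z.Q Z.P x = Z.Q x by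
    rw [invariant, h.P_eq_zero, mul_zero, neg_zero, hE.zero, mul_one]] at this

theorem abs_invariant_mul_invariant_le (h : NearSimple c κ ε D Z) (hE : c.Inverts E E')
    (hA : 0 ≤ A) (hw : ∀ x, 0 ≤ ω x) (hw1 : ∀ x, ω x ≤ 1) (u x : ℝ) :
    |invariant E D.P D.Q u * invariant E D.Q D.P x| ≤ lipData K A * lipData K A * ε := by
  have hK := h.K_nonneg hE hA
  have hL : 0 ≤ lipData K A := by unfold lipData; positivity
  have h1 := (h.abs_invariant_le hE hA hw hw1 u).trans
    (mul_le_of_le_one_right (mul_nonneg hL h.nonneg) (hw1 u))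
  have h2 := (h.ctl_invariant_Q hE hA hw hw1 x).1
  rw [abs_mul]
  refine (mul_le_mul h1 h2 (abs_nonneg _) ((abs_nonneg _).trans h1)).trans (le_of_eq ?_)
  ring

/-- For the simple wave τ = 0 and S is the slope Q, with lower bound 2κ. Passing to the nearby data
and to arbitrary pairs (u, x) costs at most κ by `small_lower`. -/
theorem le_one_sub (h : NearSimple c κ ε D Z) (hE : c.Inverts E E') (hA : 0 ≤ A)
    (hw : ∀ x, 0 ≤ ω x) (hw1 : ∀ x, ω x ≤ 1) (u x : ℝ) :
    κ ≤ 1 - invariant E D.Q D.P x * invariant E D.Q D.P x *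
      c.q (invariant E D.P D.Q u * invariant E D.Q D.P x) := by
  have h1 := h.abs_invariant_mul_invariant_le hE hA hw hw1 u x
  have h0 : |(0 : ℝ)| ≤ δ := by simpa [h.P_eq_zero] using h.abs_mul_eq_zero hA 0
  have hS := h.ctl_invariant_Q hE hA hw hw1 x
  have hq := (c.ctl_q _ 0 (h1.trans h.small_RS) h0).of_lipschitz (by rwa [sub_zero])
    (mul_self_nonneg _) h.nonneg
  have h3 := ((hS.mul hS).mul hq).2.2
  have h4 := (le_abs_self _).trans h3
  have := h.lower x
  have := h.small_lower
  linarith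

/-- The Riemann invariants of data that are close to a simple wave. -/
def toRiemannData (h : NearSimple c κ ε D Z) (hE : c.Inverts E E') (hA : 0 ≤ A)
    (hw : ∀ x, 0 ≤ ω x) (hw1 : ∀ x, ω x ≤ 1) (hωn : ∀ x, ω (-x) = ω x) (hB : lipData K A ≤ B) :
    RiemannData c ω B (lipData K A * ε) κ where
  R := invariant E D.P D.Q
  R' := invariant' E E' D.P D.P' D.Q D.Q'
  -- The initial line is ubar = -x, hence the reflection here and the sign in S'.
  S b := invariant E D.Q D.P (-b)
  S' b := -invariant' E E' D.Q D.Q' D.P D.P' (-b)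
  hasDerivAt_R u := hasDerivAt_invariant hE (D.hasDerivAt_P u) (D.hasDerivAt_Q u)
    (h.abs_mul_le hA hw1 u)
  hasDerivAt_S b := by
    have := (hasDerivAt_invariant hE (D.hasDerivAt_Q (-b)) (D.hasDerivAt_P (-b))
      (by rw [mul_comm]; exact h.abs_mul_le hA hw1 (-b))).comp b (hasDerivAt_neg b)
    rwa [mul_neg, mul_one] at this
  continuous_R' := continuous_invariant' hE
    (continuous_iff_continuousAt.2 fun u => (D.hasDerivAt_P u).continuousAt) D.continuous_P'
    (continuous_iff_continuousAt.2 fun u => (D.hasDerivAt_Q u).continuousAt) D.continuous_Q'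
    (h.abs_mul_le hA hw1)
  continuous_S' := by
    refine ((continuous_invariant' hE
      (continuous_iff_continuousAt.2 fun u => (D.hasDerivAt_Q u).continuousAt) D.continuous_Q'
      (continuous_iff_continuousAt.2 fun u => (D.hasDerivAt_P u).continuousAt) D.continuous_P'
      fun x => ?_).comp continuous_neg).neg
    rw [mul_comm]; exact h.abs_mul_le hA hw1 x
  abs_R_le := h.abs_invariant_le hE hA hw hw1
  abs_R'_le u := by
    have := (ctl_invariants hE hA hw hw1 (h.abs_mul_le hA hw1) (h.abs_mul_eq_zero hA) h.nonneg
      h.close u).1.2.2.2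
    rw [invariant', invariant', h.P_eq_zero, h.P'_eq_zero, zero_mul, zero_mul, add_zero,
      sub_zero] at this
    rw [invariant']; linarith
  abs_S_le b := by
    have := (ctl_invariants hE hA hw hw1 (h.abs_mul_le hA hw1) (h.abs_mul_eq_zero hA) h.nonneg
      h.close (-b)).2.1.1
    rw [hωn] at this
    exact this.trans (mul_le_mul_of_nonneg_right hB (hw b))
  abs_S'_le b := by
    have := (ctl_invariants hE hA hw hw1 (h.abs_mul_le hA hw1) (h.abs_mul_eq_zero hA) h.nonneg
      h.close (-b)).2.2.1
    rw [hωn] at this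
    rw [abs_neg]
    exact this.trans (mul_le_mul_of_nonneg_right hB (hw b))
  abs_mul_le u b := (h.abs_invariant_mul_invariant_le hE hA hw hw1 u (-b)).trans h.small_RS
  le_one_sub u b := h.le_one_sub hE hA hw hw1 u (-b)

theorem toRiemannData_close {D' : InitialSlopes A ω} (h : NearSimple c κ ε D Z)
    (h' : NearSimple c κ ε D' Z) (hE : c.Inverts E E') (hA : 0 ≤ A)
    (hw : ∀ x, 0 ≤ ω x) (hw1 : ∀ x, ω x ≤ 1) (hωn : ∀ x, ω (-x) = ω x) (hB : lipData K A ≤ B)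
    (hd : 0 ≤ d) (hc : D.Close D' d) :
    (h.toRiemannData hE hA hw hw1 hωn hB).Close (h'.toRiemannData hE hA hw hw1 hωn hB) d := by
  have key := ctl_invariants hE hA hw hw1 (h.abs_mul_le hA hw1) (h'.abs_mul_le hA hw1) hd hc
  refine ⟨fun u => (key u).1.1.mono hB (hw u) hd, fun u => (key u).1.2.mono hB (hw u) hd,
    fun u => ?_, fun u => ?_⟩
  · rw [← hωn]
    exact (key (-u)).2.1.mono hB (hw _) hd
  · rw [← hωn]
    exact ((key (-u)).2.2.mono hB (hw _) hd).neg

theorem toRiemannData_eτ_mul (h : NearSimple c κ ε D Z) (hE : c.Inverts E E') (hA : 0 ≤ A)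
    (hw : ∀ x, 0 ≤ ω x) (hw1 : ∀ x, ω x ≤ 1) (hωn : ∀ x, ω (-x) = ω x) (hB : lipData K A ≤ B)
    {D₀ : RiemannData c ω B (lipData K A * ε) κ}
    (hD₀ : D₀ = h.toRiemannData hE hA hw hw1 hωn hB) (x : ℝ) :
    D₀.R x * D₀.eτ (x, -x) = D.P x ∧ D₀.S (-x) * D₀.eτ (x, -x) = D.Q x := by
  have hP : D₀.R x = invariant E D.P D.Q x := by rw [hD₀]; rfl
  have hQ : D₀.S (-x) = invariant E D.Q D.P x := by
    rw [hD₀]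
    change invariant E D.Q D.P (- -x) = _
    rw [neg_neg]
  have hδ := h.abs_mul_le hA hw1 x
  rw [RiemannData.eτ, RiemannData.τ, hP, hQ]
  refine ⟨invariant_mul_e hE hδ, ?_⟩
  rw [mul_comm (invariant E D.P D.Q x)]
  exact invariant_mul_e hE (by rwa [mul_comm])

end NearSimple

end InitialSlopes

/-! ### Admissible data -/

theorem deriv_reflect (ζ : ℝ → ℝ) :
    (deriv fun x => ζ (-x)) = fun x => -deriv ζ (-x) := funext fun x => deriv_comp_neg ζ x

theorem deriv_deriv_reflect (ζ : ℝ → ℝ) (x : ℝ) :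
    deriv (deriv fun x => ζ (-x)) x = deriv (deriv ζ) (-x) := by
  rw [deriv_reflect, deriv.fun_neg, deriv_comp_neg, neg_neg]

theorem DataClose.nonneg {ε γ : ℝ} {φ₀ φ₁ χ₀ χ₁ : ℝ → ℝ} (h : DataClose ε γ φ₀ φ₁ χ₀ χ₁) :
    0 ≤ ε := by
  have := (abs_nonneg _).trans (h 0).1
  rw [modDec_eq_mul] at this
  exact nonneg_of_mul_nonneg_left this (modDec_pos one_pos γ 0)

namespace AdmissibleData

variable {ε γ M : ℝ} {ζ φ₀ φ₁ χ₀ χ₁ : ℝ → ℝ}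

theorem bounds (h : AdmissibleData ε γ ζ φ₀ φ₁) (hε : ε ≤ 1) (hζ : ProfileDecay M γ ζ) (x : ℝ) :
    |deriv φ₀ x| ≤ (M + 1) * modDec 1 γ x ∧ |deriv (deriv φ₀) x| ≤ (M + 1) * modDec 1 γ x ∧
      |φ₁ x| ≤ (M + 1) * modDec 1 γ x ∧ |deriv φ₁ x| ≤ (M + 1) * modDec 1 γ x := by
  obtain ⟨-, h1, h2, h3, h4⟩ := h.close x
  obtain ⟨-, k1, k2⟩ := hζ (-x)
  rw [deriv_deriv_reflect] at h2
  rw [deriv_reflect] at h1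
  rw [deriv_comp_neg] at h4
  rw [modDec_neg] at k1 k2
  rw [modDec_eq_mul] at h1 h2 h3 h4 k1 k2
  have hw := mul_le_mul_of_nonneg_right hε (modDec_pos one_pos γ x).le
  rw [abs_le] at *
  rw [abs_le, abs_le, abs_le]
  refine ⟨⟨?_, ?_⟩, ⟨?_, ?_⟩, ⟨?_, ?_⟩, ⟨?_, ?_⟩⟩ <;> linarith

/-- The restrictions of `Ψ` and `Ψbar` to the initial line. -/
def toInitialSlopes (h : AdmissibleData ε γ ζ φ₀ φ₁) (hε : ε ≤ 1) (hζ : ProfileDecay M γ ζ) :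
    InitialSlopes (2 * M + 2) (modDec 1 γ) where
  P x := φ₁ x + deriv φ₀ x
  P' x := deriv φ₁ x + deriv (deriv φ₀) x
  Q x := φ₁ x - deriv φ₀ x
  Q' x := deriv φ₁ x - deriv (deriv φ₀) x
  hasDerivAt_P x := ((h.contDiff_snd.differentiable (by norm_num)) x).hasDerivAt.add
    (((contDiff_succ_iff_deriv (n := 1)).1 h.contDiff_fst).2.2.differentiable
      (by norm_num) x).hasDerivAt
  hasDerivAt_Q x := ((h.contDiff_snd.differentiable (by norm_num)) x).hasDerivAt.sub
    (((contDiff_succ_iff_deriv (n := 1)).1 h.contDiff_fst).2.2.differentiable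
      (by norm_num) x).hasDerivAt
  continuous_P' := (h.contDiff_snd.continuous_deriv le_rfl).add
    (((contDiff_succ_iff_deriv (n := 1)).1 h.contDiff_fst).2.2.continuous_deriv le_rfl)
  continuous_Q' := (h.contDiff_snd.continuous_deriv le_rfl).sub
    (((contDiff_succ_iff_deriv (n := 1)).1 h.contDiff_fst).2.2.continuous_deriv le_rfl)
  abs_P_le x := by
    obtain ⟨h1, h2, h3, h4⟩ := h.bounds hε hζ x
    linarith [abs_add_le (φ₁ x) (deriv φ₀ x)]
  abs_P'_le x := by
    obtain ⟨h1, h2, h3, h4⟩ := h.bounds hε hζ x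
    linarith [abs_add_le (deriv φ₁ x) (deriv (deriv φ₀) x)]
  abs_Q_le x := by
    obtain ⟨h1, h2, h3, h4⟩ := h.bounds hε hζ x
    linarith [abs_sub (φ₁ x) (deriv φ₀ x)]
  abs_Q'_le x := by
    obtain ⟨h1, h2, h3, h4⟩ := h.bounds hε hζ x
    linarith [abs_sub (deriv φ₁ x) (deriv (deriv φ₀) x)]

theorem toInitialSlopes_close (h : AdmissibleData ε γ ζ φ₀ φ₁) (h' : AdmissibleData ε γ ζ χ₀ χ₁)
    (hε : ε ≤ 1) (hM : 0 ≤ M) (hζ : ProfileDecay M γ ζ) {d : ℝ}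
    (hd : DataClose d γ φ₀ φ₁ χ₀ χ₁) :
    (h.toInitialSlopes hε hζ).Close (h'.toInitialSlopes hε hζ) d := by
  have hMw : ∀ x, 0 ≤ M * modDec 1 γ x * d := fun x =>
    mul_nonneg (mul_nonneg hM (modDec_pos one_pos γ x).le) hd.nonneg
  refine ⟨fun x => ⟨InitialSlopes.abs_P_le _ x, InitialSlopes.abs_P_le _ x, ?_⟩,
    fun x => ⟨InitialSlopes.abs_P'_le _ x, InitialSlopes.abs_P'_le _ x, ?_⟩,
    fun x => ⟨InitialSlopes.abs_Q_le _ x, InitialSlopes.abs_Q_le _ x, ?_⟩,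
    fun x => ⟨InitialSlopes.abs_Q'_le _ x, InitialSlopes.abs_Q'_le _ x, ?_⟩⟩
  all_goals
    obtain ⟨-, h1, h2, h3, h4⟩ := hd x
    rw [modDec_eq_mul, abs_le] at h1 h2 h3 h4
    have := hMw x
    simp only [toInitialSlopes]
    rw [abs_le]
    constructor <;> linarith

/-- The data of the simple wave. -/
theorem simple (hζ : ContDiff ℝ 2 ζ) (hε : 0 ≤ ε) :
    AdmissibleData ε γ ζ (fun x => ζ (-x)) (fun x => deriv ζ (-x)) where
  contDiff_fst := hζ.comp contDiff_neg
  contDiff_snd := ((contDiff_succ_iff_deriv (n := 1)).1 hζ).2.2.comp contDiff_neg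
  close x := by
    have : 0 ≤ modDec ε γ x := by
      rw [modDec_eq_mul]; exact mul_nonneg hε (modDec_pos one_pos γ x).le
    simpa using this

/-- Admissible data are close to the data of the simple wave. -/
theorem nearSimple {δ K κ : ℝ} {c : Profile δ K} {f : ℝ → ℝ} (hδ : 0 < δ) (hfit : c.Fits f)
    (hζ : ContDiff ℝ 2 ζ) (hdec : ProfileDecay M γ ζ) (hM : 0 ≤ M)
    (hH : ∀ x, -1 + κ ≤ H f 0 * deriv ζ x ^ 2) (hε0 : 0 ≤ ε) (hε : ε ≤ 1)
    (h1 : (2 * M + 2) * (2 * M + 2) * ε ≤ δ)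
    (h2 : lipData K (2 * M + 2) * lipData K (2 * M + 2) * ε ≤ δ)
    (h3 : 2 * (2 * lipData K (2 * M + 2) * lipData K (2 * M + 2)) *
      (K * (1 + lipData K (2 * M + 2) * lipData K (2 * M + 2))) * ε ≤ κ / 2)
    (h : AdmissibleData ε γ ζ φ₀ φ₁) :
    (h.toInitialSlopes hε hdec).NearSimple c (κ / 2) ε
      ((AdmissibleData.simple hζ hε0).toInitialSlopes hε hdec) where
  close := h.toInitialSlopes_close _ hε hM hdec h.close
  P_eq_zero x := by simp [toInitialSlopes, deriv_reflect]
  P'_eq_zero x := by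
    simp only [toInitialSlopes, deriv_deriv_reflect]
    rw [deriv_comp_neg, neg_add_cancel]
  lower x := by
    -- At τ = 0 this reads f'(0) = 2 q(0). As Ψbar = 2ζ'(-x) for the simple wave, 1 - Ψbar² q(0) = 1
    -- + H(0) ζ'², so the hypothesis becomes the lower bound κ.
    have hq := hfit 0 (by simpa using hδ.le)
    simp only [c.e_zero, neg_zero, mul_zero, add_zero, one_pow, mul_one] at hq
    have := hH (-x)
    simp only [H, mul_zero, add_zero, div_one] at this
    simp only [toInitialSlopes, deriv_reflect]
    rw [hq] at this
    linarith
  nonneg := hε0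
  small_PQ := h1
  small_RS := h2
  small_lower := h3

/-- The solution on the null plane with given admissible data. -/
theorem exists_nullSolution {δ K κ B I : ℝ} {c : Profile δ K} {E E' : ℝ → ℝ}
    (hE : c.Inverts E E') (h : AdmissibleData ε γ ζ φ₀ φ₁) (hε : ε ≤ 1)
    (hζ : ProfileDecay M γ ζ) (hM : 0 ≤ M) {Z : InitialSlopes (2 * M + 2) (modDec 1 γ)}
    (hnear : (h.toInitialSlopes hε hζ).NearSimple c κ ε Z)
    (hset : Setting K B I κ (lipData K (2 * M + 2) * ε) (modDec 1 γ))
    (hB : lipData K (2 * M + 2) ≤ B) :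
    ∃ D : RiemannData c (modDec 1 γ) B (lipData K (2 * M + 2) * ε) κ,
      D = hnear.toRiemannData hE (by positivity) (fun x => (hset.weight_pos x).le)
        hset.weight_le_one (modDec_neg 1 γ) hB ∧
      (∀ x, φ₁ x = 1 / 2 * (D.eτ (x, -x) * (D.R x + D.S (-x)))) ∧
      Nonempty (D.NullSolution φ₀) := by
  obtain ⟨D, hD⟩ : ∃ D : RiemannData c (modDec 1 γ) B (lipData K (2 * M + 2) * ε) κ,
      D = hnear.toRiemannData hE (by positivity) (fun x => (hset.weight_pos x).le)
        hset.weight_le_one (modDec_neg 1 γ) hB := ⟨_, rfl⟩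
  have key : ∀ x, D.R x * D.eτ (x, -x) = φ₁ x + deriv φ₀ x ∧
      D.S (-x) * D.eτ (x, -x) = φ₁ x - deriv φ₀ x :=
    hnear.toRiemannData_eτ_mul hE _ _ _ _ hB hD
  refine ⟨D, hD, fun x => ?_, ?_⟩
  · linear_combination -(1 / 2) * (key x).1 - 1 / 2 * (key x).2
  · refine RiemannData.nonempty_nullSolution _ hset (g' := deriv φ₀)
      (fun u => (h.contDiff_fst.differentiable (by norm_num) u).hasDerivAt) fun u => ?_
    linear_combination -(1 / 2) * (key u).1 + 1 / 2 * (key u).2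

end AdmissibleData

theorem SolutionClose.mono {K K' γ : ℝ} {φ χ : ℝ × ℝ → ℝ} {U V : ℝ × ℝ ≃ ℝ × ℝ} (hK : K ≤ K')
    (h : SolutionClose K γ φ U χ V) : SolutionClose K' γ φ U χ V := by
  have mono : ∀ {F F' : ℝ × ℝ → ℝ}, NullClose K γ F F' → NullClose K' γ F F' := by
    intro F F' hF q
    obtain ⟨h1, h2, h3⟩ := hF q
    have hw : ∀ s, modDec K γ s ≤ modDec K' γ s := fun s => by
      rw [modDec_eq_mul, modDec_eq_mul K']
      exact mul_le_mul_of_nonneg_right hK (modDec_pos one_pos γ s).le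
    exact ⟨h1.trans hK, h2.trans (hw _), h3.trans (hw _)⟩
  exact ⟨mono h.1, mono h.2.1, mono h.2.2⟩

/-! ### The choice of the constants -/

theorem eventually_mul_le (a : ℝ) {d : ℝ} (hd : 0 < d) : ∀ᶠ ε in 𝓝[>] (0 : ℝ), a * ε ≤ d := by
  have : Tendsto (fun ε : ℝ => a * ε) (𝓝[>] 0) (𝓝 0) := by
    refine tendsto_nhdsWithin_of_tendsto_nhds ?_
    simpa using (continuous_const_mul a).tendsto (0 : ℝ)
  filter_upwards [this.eventually_lt_const hd] with ε h using h.le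

/-- Each smallness condition bounds a fixed multiple of ε by a positive number, so all hold for ε
near 0. The choice B = L + 1 ensures both 1 ≤ B and L ≤ B. -/
theorem exists_setting {γ δ K I κ : ℝ} (hγ : 0 < γ) (hδ : 0 < δ) (hK : 1 ≤ K) (hκ : 0 < κ)
    (hI : ∀ a b, |∫ s in a..b, modDec 1 γ s| ≤ I) (L A : ℝ) (hL : 0 ≤ L) :
    ∃ ε : ℝ, 0 < ε ∧ ε ≤ 1 ∧ Setting K (L + 1) I κ (L * ε) (modDec 1 γ) ∧ A * A * ε ≤ δ ∧
      L * L * ε ≤ δ ∧ 2 * (2 * L * L) * (K * (1 + L * L)) * ε ≤ κ := by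
  set B := L + 1
  have hm : 0 < min (κ / 2) (1 / 4) := by positivity
  have hm' : 0 < min (κ / 2) (1 / 2) ^ 2 := by positivity
  have ev := (eventually_mul_le 1 one_pos).and <| (eventually_mul_le L one_pos).and <|
    (eventually_mul_le (2 * B ^ 3 * K ^ 2 * L * I) (by norm_num : (0 : ℝ) < 1 / 8)).and <|
    (eventually_mul_le (2 * (2 * B ^ 3 * K ^ 2 * L * (4 * (1 + B ^ 2 * K))) * I) hm).and <|
    (eventually_mul_le (L * K) (by norm_num : (0 : ℝ) < 1 / 4)).and <|
    (eventually_mul_le (4 * (B ^ 2 * K * (4 * (1 + B ^ 2 * K))) *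
      (L * K * (4 * (1 + B ^ 2 * K)))) hm').and <|
    (eventually_mul_le (A * A) hδ).and <| (eventually_mul_le (L * L) hδ).and <|
    (eventually_mul_le (2 * (2 * L * L) * (K * (1 + L * L))) hκ).and self_mem_nhdsWithin
  obtain ⟨ε, h1, h2, h3, h4, h5, h6, h7, h8, h9, h0⟩ := ev.exists
  have h0 : 0 < ε := h0
  refine ⟨ε, h0, by linarith, ⟨continuous_modDec 1 γ, modDec_pos one_pos γ, modDec_one_le_one hγ,
    hI, hK, by linarith, hκ, by positivity, h2, by linarith, ?_, by linarith, ?_⟩, h7, h8, h9⟩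
  · refine le_trans (le_of_eq ?_) h4; ring
  · refine le_trans (le_of_eq ?_) h6; ring

end SimpleWave

end

theorem mainTheorem1 (M₀ m₀ Mζ γ κ : ℝ) (hm₀ : 0 < m₀) (hMζ : 0 < Mζ) (hγ : 0 < γ) (hκ : 0 < κ) :
    ∃ ε : ℝ, 0 < ε ∧ ∃ C : ℝ, 0 < C ∧
      ∀ f : ℝ → ℝ, ContDiff ℝ 3 f → SimpleWave.NonlinearityBounds f M₀ m₀ →
      ∀ ζ : ℝ → ℝ, ContDiff ℝ 2 ζ → SimpleWave.ProfileDecay Mζ γ ζ →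
        (∀ x : ℝ, -1 + κ ≤ SimpleWave.H f 0 * deriv ζ x ^ 2) →
        (∀ φ₀ φ₁ : ℝ → ℝ, SimpleWave.AdmissibleData ε γ ζ φ₀ φ₁ →
          (∃! φ : ℝ × ℝ → ℝ, SimpleWave.IsGlobalSolution f φ₀ φ₁ φ) ∧
          (∀ φ : ℝ × ℝ → ℝ, SimpleWave.IsGlobalSolution f φ₀ φ₁ φ →
            ∃! U : ℝ × ℝ ≃ ℝ × ℝ, SimpleWave.IsDoubleNull f φ U)) ∧
        (∀ φ₀ φ₁ χ₀ χ₁ : ℝ → ℝ,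
          SimpleWave.AdmissibleData ε γ ζ φ₀ φ₁ → SimpleWave.AdmissibleData ε γ ζ χ₀ χ₁ →
          ∀ φ χ : ℝ × ℝ → ℝ,
            SimpleWave.IsGlobalSolution f φ₀ φ₁ φ → SimpleWave.IsGlobalSolution f χ₀ χ₁ χ →
          ∀ U V : ℝ × ℝ ≃ ℝ × ℝ,
            SimpleWave.IsDoubleNull f φ U → SimpleWave.IsDoubleNull f χ V →
          ∀ D : ℝ, SimpleWave.DataClose D γ φ₀ φ₁ χ₀ χ₁ →
            SimpleWave.SolutionClose (C * D) γ φ U χ V) := by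
  obtain ⟨δ, K, hδ, hK, hprof⟩ := SimpleWave.exists_profile M₀ m₀ hm₀
  obtain ⟨I, -, hI⟩ := SimpleWave.exists_abs_integral_modDec_le hγ
  set L := SimpleWave.lipData K (2 * Mζ + 2)
  have hL : 0 ≤ L := by simp only [L]; unfold SimpleWave.lipData; positivity
  -- Half of the margin κ is given up in passing from the simple wave to perturbed data.
  obtain ⟨ε, hε0, hε1, hset, s1, s2, s3⟩ := SimpleWave.exists_setting (κ := κ / 2) hγ hδ hK
    (by positivity) hI L (2 * Mζ + 2) hL
  have hLB : L ≤ L + 1 := by linarith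
  refine ⟨ε, hε0, |SimpleWave.lipSol K (L + 1) I + SimpleWave.lipPsi K (L + 1)| + 1,
    by positivity, fun f hf hbounds ζ hζ hdec hH => ?_⟩
  obtain ⟨c, hfit, E, E', hE⟩ := hprof f hf hbounds
  have near := fun (φ₀ φ₁ : ℝ → ℝ) (h : SimpleWave.AdmissibleData ε γ ζ φ₀ φ₁) =>
    h.nearSimple hδ hfit hζ hdec hMζ.le hH hε0.le hε1 s1 s2 s3
  have hω := SimpleWave.tendsto_modDec hγ 1
  refine ⟨fun φ₀ φ₁ h => ?_, fun φ₀ φ₁ χ₀ χ₁ h h' φ χ hφ hχ U V hU hV d hd => ?_⟩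
  · obtain ⟨D, -, hφ₁, ⟨N⟩⟩ :=
      h.exists_nullSolution hE hε1 hdec hMζ.le (near _ _ h) hset hLB
    refine ⟨⟨N.φ, N.isGlobalSolution (hf.differentiable (by norm_num)) hfit hφ₁,
      fun ψ hψ => N.eq_of_isGlobalSolution hf hfit hφ₁ hψ⟩, fun φ hφ => ?_⟩
    rw [N.eq_of_isGlobalSolution hf hfit hφ₁ hφ]
    exact ⟨N.Θ.symm, N.isDoubleNull hset hfit, fun U hU => N.eq_of_isDoubleNull hset hω hfit hU⟩
  · obtain ⟨D, hD, hφ₁, ⟨N⟩⟩ :=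
      h.exists_nullSolution hE hε1 hdec hMζ.le (near _ _ h) hset hLB
    obtain ⟨D', hD', hχ₁, ⟨N'⟩⟩ :=
      h'.exists_nullSolution hE hε1 hdec hMζ.le (near _ _ h') hset hLB
    -- By uniqueness arbitrary solutions and coordinate systems are the constructed ones, to which
    -- the Lipschitz estimate applies.
    obtain rfl := N.eq_of_isGlobalSolution hf hfit hφ₁ hφ
    obtain rfl := N'.eq_of_isGlobalSolution hf hfit hχ₁ hχ
    obtain rfl := N.eq_of_isDoubleNull hset hω hfit hU
    obtain rfl := N'.eq_of_isDoubleNull hset hω hfit hV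
    have hclose : D.Close D' d := by
      rw [hD, hD']
      exact (near _ _ h).toRiemannData_close (near _ _ h') hE _ _ _ _ _ hd.nonneg
        (h.toInitialSlopes_close h' hε1 hMζ.le hdec hd)
    refine (N.solutionClose N' hset hd.nonneg hclose fun u => (hd u).1.trans ?_).mono
      (mul_le_mul_of_nonneg_right ((le_abs_self _).trans (by linarith)) hd.nonneg)
    rw [SimpleWave.modDec_eq_mul]
    exact mul_le_of_le_one_right hd.nonneg (SimpleWave.modDec_one_le_one hγ u)
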